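/- Let $Y,Y_1,Y_2,\dots$ be independent, identically distributed $\mathbf Z$-valued random variables with $EY=0$ and $\sigma^2:=E|Y|^2<\infty$ such that the random walk $S^x_n=x+Y_1+\cdots+Y_n$ on $\mathbf Z$ is irreducible. Put $p^n(x)=P[S^0_n=x]$ and let $$a(x)=\sum_{n=0}^\infty\big[p^n(0)-p^n(-x)\big]\qquad(x\in\mathbf Z)$$ be the potential function (the sum being the limit of the partial sums). Let $f_+$ (resp. $f_-$) be the positive function on $\{1,2,\dots\}$ with $$f_\pm(x)=E[f_\pm(x\pm Y);\,x\pm Y>0]\quad(x\ge1),\qquad \lim_{x\to\infty}f_\pm(x)/x=1,$$ and put $$H_\infty^+(y)=\frac2{\sigma^2}E[f_-(y-Y);Y<y]\ (y\le 0),\qquad H_{-\infty}^-(y)=\frac2{\sigma^2}E[f_+(Y-y);Y>y]\ (y\ge0),$$ $$C^+=\sum_{y=-\infty}^{-1}H_\infty^+(y)\big[\sigma^2a(y)+|y|\big],\qquad C^-=\sum_{y=1}^{\infty}H_{-\infty}^-(y)\big[\sigma^2a(y)+y\big]$$ (elements of $[0,\infty]$). These objects are well defined: the series for $a(x)$ converges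 and $a(x)\ge0$ for every $x\in\mathbf Z$, and $f_+$ and $f_-$ exist and are unique. Moreover, the following limits exist in $(-\infty,\infty]$ and $$C^+=\lim_{x\to+\infty}\big(\sigma^2a(x)-x\big),\qquad C^-=\lim_{x\to-\infty}\big(\sigma^2a(x)-|x|\big).$$ Furthermore, $C^+<\infty$ if and only if $E[|Y|^3;Y<0]<\infty$, and $C^-<\infty$ if and only if $E[|Y|^3;Y>0]<\infty$; and $C^+>0$ if and only if the walk is not left continuous (i.e. $P[Y\le-2]>0$), and $C^->0$ if and only if it is not right continuous (i.e. $P[Y\ge2]>0$). -/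

import Mathlib

open MeasureTheory ProbabilityTheory Filter Topology
open scoped ENNReal

noncomputable section

namespace LatticeWalk

variable {Ω : Type*} [MeasurableSpace Ω]

/-- The walk `S^x_n = x + (Y_1 + ⋯ + Y_n)` on `ℤ`; the increments are indexed from `0`. -/
def walk (Y : ℕ → Ω → ℤ) (x : ℤ) (n : ℕ) (ω : Ω) : ℤ :=
  x + ∑ i ∈ Finset.range n, Y i ω

/-- `p^n(x) = P[S^0_n = x]`. -/
def stepProb (P : Measure Ω) (Y : ℕ → Ω → ℤ) (n : ℕ) (x : ℤ) : ℝ :=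
  P.real {ω | walk Y 0 n ω = x}

/-- Every site is reached from every site with positive probability. -/
def IsIrreducible (P : Measure Ω) (Y : ℕ → Ω → ℤ) : Prop :=
  ∀ x y : ℤ, ∃ n : ℕ, 0 < P {ω | walk Y x n ω = y}

/-- `σ² = E|Y|²`. -/
def sigmaSq (P : Measure Ω) (Y : ℕ → Ω → ℤ) : ℝ :=
  ∫ ω, (Y 0 ω : ℝ) ^ 2 ∂P

/-- The partial sums `∑_{n < N} [p^n(0) - p^n(-x)]` of the series of the potential function. -/
def potentialPartial (P : Measure Ω) (Y : ℕ → Ω → ℤ) (x : ℤ) (N : ℕ) : ℝ :=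
  ∑ n ∈ Finset.range N, (stepProb P Y n 0 - stepProb P Y n (-x))

/-- The potential function `a(x) = ∑_{n ≥ 0} [p^n(0) - p^n(-x)]`. The sum of the series is the limit
of its partial sums: for a periodic walk the series need not converge absolutely. -/
def potential (P : Measure Ω) (Y : ℕ → Ω → ℤ) (x : ℤ) : ℝ :=
  limUnder atTop (potentialPartial P Y x)

/-- `f` is the positive function on `{1, 2, …}` (extended by `0` to the other integers) that is
harmonic for the walk with increments distributed as `X`, absorbed on `(-∞, 0]`, and that is
asymptotic to `x` as `x → ∞`. Since `f x ≠ 0`, the integral in `harmonic` cannot be the default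
value of a divergent integral. -/
structure IsHalfLineHarmonic (P : Measure Ω) (X : Ω → ℤ) (f : ℤ → ℝ) : Prop where
  zero : ∀ x : ℤ, x ≤ 0 → f x = 0
  pos : ∀ x : ℤ, 1 ≤ x → 0 < f x
  harmonic : ∀ x : ℤ, 1 ≤ x → f x = ∫ ω in {ω | 0 < x + X ω}, f (x + X ω) ∂P
  asymp : Tendsto (fun x : ℤ => f x / (x : ℝ)) atTop (𝓝 1)

/-- The function singled out by `IsHalfLineHarmonic`. -/
def halfLineHarmonic (P : Measure Ω) (X : Ω → ℤ) : ℤ → ℝ :=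
  Classical.epsilon (IsHalfLineHarmonic P X)

/-- `f_+`, for the walk `S_n`. -/
def fPlus (P : Measure Ω) (Y : ℕ → Ω → ℤ) : ℤ → ℝ :=
  halfLineHarmonic P (fun ω => Y 0 ω)

/-- `f_-`, for the walk `-S_n`. -/
def fMinus (P : Measure Ω) (Y : ℕ → Ω → ℤ) : ℤ → ℝ :=
  halfLineHarmonic P (fun ω => -Y 0 ω)

/-- `H_∞^+(y) = (2/σ²) E[f_-(y - Y); Y < y]`, used for `y ≤ 0`. -/
def HPlus (P : Measure Ω) (Y : ℕ → Ω → ℤ) (y : ℤ) : ℝ :=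
  2 / sigmaSq P Y * ∫ ω in {ω | Y 0 ω < y}, fMinus P Y (y - Y 0 ω) ∂P

/-- `H_{-∞}^-(y) = (2/σ²) E[f_+(Y - y); Y > y]`, used for `y ≥ 0`. -/
def HMinus (P : Measure Ω) (Y : ℕ → Ω → ℤ) (y : ℤ) : ℝ :=
  2 / sigmaSq P Y * ∫ ω in {ω | y < Y 0 ω}, fPlus P Y (Y 0 ω - y) ∂P

/-- `C⁺ = ∑_{y < 0} H_∞^+(y) (σ² a(y) + |y|)`, a sum of nonnegative terms (as `H_∞^+ ≥ 0` and
`a ≥ 0`) with value in `[0, ∞]`. -/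
def CPlus (P : Measure Ω) (Y : ℕ → Ω → ℤ) : ℝ≥0∞ :=
  ∑' y : Set.Iio (0 : ℤ),
    ENNReal.ofReal (HPlus P Y y * (sigmaSq P Y * potential P Y y + |((y : ℤ) : ℝ)|))

/-- `C⁻ = ∑_{y > 0} H_{-∞}^-(y) (σ² a(y) + y)`, a sum of nonnegative terms with value in
`[0, ∞]`. -/
def CMinus (P : Measure Ω) (Y : ℕ → Ω → ℤ) : ℝ≥0∞ :=
  ∑' y : Set.Ioi (0 : ℤ),
    ENNReal.ofReal (HMinus P Y y * (sigmaSq P Y * potential P Y y + ((y : ℤ) : ℝ)))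

/-- `P[Y ≤ -2] = 0`. -/
def IsLeftContinuous (P : Measure Ω) (Y : ℕ → Ω → ℤ) : Prop :=
  P {ω | Y 0 ω ≤ -2} = 0

/-- `P[Y ≥ 2] = 0`. -/
def IsRightContinuous (P : Measure Ω) (Y : ℕ → Ω → ℤ) : Prop :=
  P {ω | 2 ≤ Y 0 ω} = 0

end LatticeWalk

end

/-!
The argument is potential theory on `ℤ` for the step distribution `p` of the walk; put
`s = σ²`. Suppose that `a` solves the Poisson equation `∑ p(y) a(x+y) = a(x) + δ₀(x)`, vanishes at
the origin and has increments tending to `±1/s` at `±∞` (`PotentialKernel`). Everything else follows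
from a minimum principle (`CenteredKernel.nonneg_of_superharmonic`): `a ≥ 0`; the function
`a(x) + a(-z) - a(x-z)`, which is the Green function of the walk killed at `0`, is nonnegative, and
so it dominates the Green function `g(x, z)` of the walk killed on `(-∞, 0]`, whence
`g(x, z) ≤ C min(|x|, |z|)` (`exists_green_le`). With this bound, potentials of summable charges are
`o(x)`. Hence `f(x) = x - E[S_T]`, with `T` the exit time from the half-line, is harmonic and
asymptotic to `x`; it is the only such function, and every function `F` of linear growth for
which `F(x)/x` has a limit is represented on the half-line by `f`, its charge and its values at the
exit (`representation`).

Applied to `s a(x) - x`, the representation gives `s a(x) - x = ∑ g(x, z) b(z)`, where `b(z)` is the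
mean of `s a(w) + |w|` over the steps from `z` to points `w ≤ 0`. Applied to `z ↦ a(x - z)` and the
reflected walk, it expresses `g(x, z)` through `f_-` and increments of `a`, and shows that
`g(x, z) → (2/s) f_-(z)` (`tendsto_green`). As `g(x, z) ≤ C |z| ≤ C f_-(z)` for `z ≥ 1`, the sums
converge to `(2/s) ∑ f_-(z) b(z)`, be it finite or infinite, and this is `C⁺`. Since `f_-(z)` and
`s a(w) + |w|` are comparable to `z` and `|w|`, finiteness amounts to the convergence of
`∑ p(-k) ∑_{z < k} z (k - z)`, a third moment, and positivity to the existence of a step from some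
`z ≥ 1` to some `w ≤ -1`. The statements on `C⁻` are those on `C⁺` for the walk `-S`.

It remains to see that the potential function of the walk is such an `a`. By Fourier inversion its
partial sums are integrals over `(0, π]` of `Re[(1 - φ^N)(1 - e^{ixt})/(1 - φ)]`. The singularity
`1/t` at the origin is purely imaginary up to terms that are bounded or of order `|Im φ|/t³`, and
the latter are integrable because the second moment is finite; dominated convergence
(`exists_dominating`) then gives the convergence of the series and the Poisson equation. The
increments are compared with those of the simple random walk, whose potential function is `|x|`; the
difference of the two Fourier kernels is `o(1/t)`, and its oscillatory integral tends to zero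
(`oscillatory_integral_small`).
-/

namespace LatticeWalk

/-! ### Centred kernels on the integers and the minimum principle -/

/-- A probability kernel `p` on `ℤ` with mean zero and finite second moment `s > 0`, as the step
distribution of a walk. -/
structure CenteredKernel (p : ℤ → ℝ) (s : ℝ) : Prop where
  nonneg : ∀ y, 0 ≤ p y
  hasSum_one : HasSum p 1
  hasSum_mean : HasSum (fun y : ℤ => p y * (y : ℝ)) 0
  hasSum_sq : HasSum (fun y : ℤ => p y * (y : ℝ) ^ 2) s
  pos : 0 < s

theorem abs_le_sq_intCast (y : ℤ) : |(y : ℝ)| ≤ (y : ℝ) ^ 2 := by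
  rcases eq_or_ne y 0 with rfl | hy
  · simp
  · have h : (1 : ℝ) ≤ |(y : ℝ)| := by
      rw [← Int.cast_abs]
      exact_mod_cast Int.one_le_abs hy
    rw [← sq_abs]
    nlinarith

namespace CenteredKernel

variable {p : ℤ → ℝ} {s : ℝ}

theorem reflect (h : CenteredKernel p s) : CenteredKernel (fun y => p (-y)) s where
  nonneg y := h.nonneg _
  hasSum_one := (Equiv.neg ℤ).hasSum_iff.2 h.hasSum_one
  hasSum_mean := by
    have := ((Equiv.neg ℤ).hasSum_iff.2 h.hasSum_mean).neg
    simpa [Function.comp_def] using this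
  hasSum_sq := by
    have := (Equiv.neg ℤ).hasSum_iff.2 h.hasSum_sq
    simpa [Function.comp_def] using this
  pos := h.pos

theorem exists_neg (h : CenteredKernel p s) : ∃ y : ℤ, y < 0 ∧ 0 < p y := by
  by_contra! hcon
  have h0 : ∀ y : ℤ, y < 0 → p y = 0 := fun y hy => le_antisymm (hcon y hy) (h.nonneg y)
  have h1 : (fun y : ℤ => p y * (y : ℝ)) = 0 := by
    refine (hasSum_zero_iff_of_nonneg fun y => ?_).1 h.hasSum_mean
    rcases lt_or_ge y 0 with hy | hy
    · simp [h0 y hy]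
    · exact mul_nonneg (h.nonneg y) (by exact_mod_cast hy)
  have h2 : (fun y : ℤ => p y * (y : ℝ) ^ 2) = fun _ => 0 := by
    funext y
    have := congrFun h1 y
    simp only [Pi.zero_apply] at this
    rw [pow_two, ← mul_assoc, this, zero_mul]
  have h3 := h.hasSum_sq
  rw [h2] at h3
  exact h.pos.ne (hasSum_zero.unique h3)

theorem summable_growth (h : CenteredKernel p s) (K : ℝ) (x : ℤ) :
    Summable fun y : ℤ => p y * (K * (1 + |((x + y : ℤ) : ℝ)|)) := by
  have h1 : Summable fun y : ℤ => |K| * ((1 + |(x : ℝ)|) * p y + p y * (y : ℝ) ^ 2) :=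
    ((h.hasSum_one.summable.mul_left _).add h.hasSum_sq.summable).mul_left _
  refine Summable.of_norm_bounded h1 fun y => ?_
  have h2 : |((x + y : ℤ) : ℝ)| ≤ |(x : ℝ)| + (y : ℝ) ^ 2 := by
    push_cast
    exact (abs_add_le _ _).trans (by gcongr; exact abs_le_sq_intCast y)
  rw [Real.norm_eq_abs, abs_mul, abs_mul, abs_of_nonneg (h.nonneg y),
    abs_of_nonneg (a := 1 + |((x + y : ℤ) : ℝ)|) (by positivity)]
  calc p y * (|K| * (1 + |((x + y : ℤ) : ℝ)|))
      ≤ p y * (|K| * (1 + (|(x : ℝ)| + (y : ℝ) ^ 2))) := by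
        have := h.nonneg y
        gcongr
    _ = _ := by ring

theorem summable_of_growth (h : CenteredKernel p s) {F : ℤ → ℝ} {K : ℝ}
    (hF : ∀ w, |F w| ≤ K * (1 + |(w : ℝ)|)) (x : ℤ) :
    Summable fun y : ℤ => p y * F (x + y) := by
  refine Summable.of_norm_bounded (h.summable_growth K x) fun y => ?_
  rw [Real.norm_eq_abs, abs_mul, abs_of_nonneg (h.nonneg y)]
  exact mul_le_mul_of_nonneg_left (hF _) (h.nonneg y)

/-- Minimum principle: a function that is superharmonic wherever it is negative, and negative at
finitely many points only, is nonnegative. Otherwise its minimum is attained on a nonempty finite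
set, which is stable under the negative steps of the kernel. -/
theorem nonneg_of_superharmonic (h : CenteredKernel p s) {u : ℤ → ℝ}
    (hfin : {x | u x < 0}.Finite)
    (hsup : ∀ x, u x < 0 → ∃ v ≤ u x, HasSum (fun y : ℤ => p y * u (x + y)) v) (x : ℤ) :
    0 ≤ u x := by
  by_contra! hx
  obtain ⟨x₀, hx₀, hmin⟩ := Set.exists_min_image _ u hfin ⟨x, hx⟩
  simp only [Set.mem_ofPred_eq] at hx₀ hmin
  have hmin' : ∀ w, u x₀ ≤ u w := fun w => by
    rcases lt_or_ge (u w) 0 with hw | hw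
    · exact hmin w hw
    · exact hx₀.le.trans hw
  have hfin' : {z | u z = u x₀}.Finite :=
    hfin.subset fun z hz => by simp only [Set.mem_ofPred_eq] at hz ⊢; rwa [hz]
  obtain ⟨x₁, hx₁, hmin₁⟩ := Set.exists_min_image _ id hfin' ⟨x₀, rfl⟩
  simp only [Set.mem_ofPred_eq, id] at hx₁ hmin₁
  obtain ⟨y, hy, hpy⟩ := h.exists_neg
  obtain ⟨v, hv, hsum⟩ := hsup x₁ (by rwa [hx₁])
  have h1 : HasSum (fun y : ℤ => p y * (u (x₁ + y) - u x₀)) (v - u x₀) := by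
    have := hsum.sub (h.hasSum_one.mul_right (u x₀))
    simpa [mul_sub] using this
  have hnn : ∀ y : ℤ, 0 ≤ p y * (u (x₁ + y) - u x₀) := fun y =>
    mul_nonneg (h.nonneg y) (sub_nonneg.2 (hmin' _))
  have h2 : p y * (u (x₁ + y) - u x₀) ≤ v - u x₀ := le_hasSum h1 y fun j _ => hnn j
  have h3 : u (x₁ + y) = u x₀ := by
    have h4 : p y * (u (x₁ + y) - u x₀) = 0 := le_antisymm (h2.trans (by linarith)) (hnn y)
    rcases mul_eq_zero.1 h4 with h5 | h5
    · exact absurd h5 hpy.ne'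
    · linarith
  have := hmin₁ _ h3
  omega

end CenteredKernel

/-! ### Potential kernels -/

/-- A centred kernel `p` together with a potential function `a` for it: `a` vanishes at the origin,
solves the Poisson equation `∑ p(y) a(x+y) = a(x) + δ₀(x)`, and its increments tend to `±1/s` at
`±∞`. -/
structure PotentialKernel (p a : ℤ → ℝ) (s : ℝ) : Prop extends CenteredKernel p s where
  a_zero : a 0 = 0
  poisson : ∀ x, HasSum (fun y : ℤ => p y * a (x + y)) (a x + if x = 0 then 1 else 0)
  tendsto_top : Tendsto (fun x : ℤ => a (x + 1) - a x) atTop (𝓝 (1 / s))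
  tendsto_bot : Tendsto (fun x : ℤ => a (x + 1) - a x) atBot (𝓝 (-(1 / s)))

namespace PotentialKernel

variable {p a : ℤ → ℝ} {s : ℝ}

theorem reflect (h : PotentialKernel p a s) :
    PotentialKernel (fun y => p (-y)) (fun y => a (-y)) s where
  toCenteredKernel := h.toCenteredKernel.reflect
  a_zero := by simpa using h.a_zero
  poisson x := by
    have := (Equiv.neg ℤ).hasSum_iff.2 (h.poisson (-x))
    simpa [Function.comp_def, add_comm] using this
  tendsto_top := by
    have h1 : Tendsto (fun x : ℤ => -x - 1) atTop atBot :=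
      tendsto_atBot_add_const_right _ (-1 : ℤ) tendsto_neg_atTop_atBot
    have := (h.tendsto_bot.comp h1).neg
    refine (this.congr fun x => ?_).trans (by simp)
    simp only [Function.comp]
    rw [show -x - 1 + 1 = -x by ring, show -(x + 1) = -x - 1 by ring]
    ring
  tendsto_bot := by
    have h1 : Tendsto (fun x : ℤ => -x - 1) atBot atTop :=
      tendsto_atTop_add_const_right _ (-1 : ℤ) tendsto_neg_atBot_atTop
    have := (h.tendsto_top.comp h1).neg
    refine this.congr fun x => ?_
    simp only [Function.comp]
    rw [show -x - 1 + 1 = -x by ring, show -(x + 1) = -x - 1 by ring]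
    ring

theorem exists_lipschitz (h : PotentialKernel p a s) :
    ∃ L : ℝ, 0 < L ∧ ∀ x y : ℤ, |a x - a y| ≤ L * |((x - y : ℤ) : ℝ)| := by
  obtain ⟨B, hB⟩ : ∃ B : ℝ, ∀ x : ℤ, |a (x + 1) - a x| ≤ B := by
    obtain ⟨N, hN⟩ := eventually_atTop.1
      (h.tendsto_top.abs.eventually (eventually_le_nhds (lt_add_one _)))
    obtain ⟨M, hM⟩ := eventually_atBot.1
      (h.tendsto_bot.abs.eventually (eventually_le_nhds (lt_add_one _)))
    obtain ⟨B, hB⟩ := ((Set.finite_Icc M N).image fun x : ℤ => |a (x + 1) - a x|).bddAbove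
    refine ⟨max B (max (|1 / s| + 1) (|-(1 / s)| + 1)), fun x => ?_⟩
    rcases le_total N x with hx | hx
    · exact (hN x hx).trans ((le_max_left _ _).trans (le_max_right _ _))
    rcases le_total x M with hx' | hx'
    · exact (hM x hx').trans ((le_max_right _ _).trans (le_max_right _ _))
    · exact (hB ⟨x, ⟨hx', hx⟩, rfl⟩).trans (le_max_left _ _)
  have hnat : ∀ (n : ℕ) (x : ℤ), |a (x + n) - a x| ≤ (|B| + 1) * n := by
    intro n x
    induction n with
    | zero => simp
    | succ n ih =>
      have h1 := (hB (x + n)).trans (le_abs_self B)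
      have h2 : a (x + (n + 1 : ℕ)) - a x
          = (a (x + n + 1) - a (x + n)) + (a (x + n) - a x) := by
        push_cast
        rw [add_assoc]
        ring
      rw [h2]
      refine (abs_add_le _ _).trans ?_
      push_cast
      linarith
  refine ⟨|B| + 1, by positivity, fun x y => ?_⟩
  rcases le_total y x with hxy | hxy
  · obtain ⟨n, hn⟩ := Int.le.dest hxy
    have := hnat n y
    rw [hn] at this
    rwa [← hn, add_sub_cancel_left, Int.cast_natCast, abs_of_nonneg (a := (n : ℝ)) (by positivity),
      hn]
  · obtain ⟨n, hn⟩ := Int.le.dest hxy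
    have := hnat n x
    rw [hn] at this
    rw [abs_sub_comm, ← hn, show x - (x + n) = -(n : ℤ) by ring, Int.cast_neg, abs_neg,
      Int.cast_natCast, abs_of_nonneg (a := (n : ℝ)) (by positivity), hn]
    exact this

theorem tendsto_div_top (h : PotentialKernel p a s) :
    Tendsto (fun x : ℤ => a x / (x : ℝ)) atTop (𝓝 (1 / s)) := by
  rw [← Nat.map_cast_int_atTop, tendsto_map'_iff]
  have h1 : Tendsto (fun n : ℕ => a ((n : ℤ) + 1) - a n) atTop (𝓝 (1 / s)) :=
    h.tendsto_top.comp tendsto_natCast_atTop_atTop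
  refine h1.cesaro.congr fun n => ?_
  have := Finset.sum_range_sub (fun n : ℕ => a (n : ℤ)) n
  push_cast at this
  rw [this, h.a_zero]
  simp [div_eq_inv_mul]

theorem tendsto_atTop_top (h : PotentialKernel p a s) : Tendsto a atTop atTop := by
  have h1 := h.tendsto_div_top.pos_mul_atTop (by have := h.pos; positivity)
    (tendsto_intCast_atTop_atTop (R := ℝ))
  refine h1.congr' ?_
  filter_upwards [eventually_gt_atTop 0] with x hx
  have : (x : ℝ) ≠ 0 := by exact_mod_cast hx.ne'
  field_simp

theorem tendsto_atBot_top (h : PotentialKernel p a s) : Tendsto a atBot atTop := by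
  have := h.reflect.tendsto_atTop_top.comp tendsto_neg_atBot_atTop
  refine this.congr fun x => by simp

theorem finite_le (h : PotentialKernel p a s) (M : ℝ) : {x | a x ≤ M}.Finite := by
  have h1 : Tendsto a cofinite atTop := by
    rw [Int.cofinite_eq]
    exact h.tendsto_atBot_top.sup h.tendsto_atTop_top
  have := h1.eventually (eventually_gt_atTop M)
  rw [eventually_cofinite] at this
  simpa using this

theorem a_nonneg (h : PotentialKernel p a s) (x : ℤ) : 0 ≤ a x := by
  refine h.toCenteredKernel.nonneg_of_superharmonic
    ((h.finite_le 0).subset fun x (hx : a x < 0) => show a x ≤ 0 from hx.le)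
    (fun x hx => ⟨_, le_rfl, ?_⟩) x
  have h0 : x ≠ 0 := by
    rintro rfl
    exact absurd h.a_zero hx.ne
  simpa [h0] using h.poisson x

/-- `a(x) + a(-z) - a(x-z)` is the Green function of the walk killed at the origin; the minimum
principle shows that it is nonnegative. -/
theorem subadd (h : PotentialKernel p a s) (z x : ℤ) : 0 ≤ a x + a (-z) - a (x - z) := by
  obtain ⟨L, hL, hlip⟩ := h.exists_lipschitz
  -- the function is only bounded; adding `ε a`, which tends to infinity, makes its negative part
  -- finitely supported
  have key : ∀ ε : ℝ, 0 < ε → 0 ≤ (1 + ε) * a x + a (-z) - a (x - z) := by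
    intro ε hε
    refine h.toCenteredKernel.nonneg_of_superharmonic
      (u := fun x => (1 + ε) * a x + a (-z) - a (x - z)) ?_ ?_ x
    · refine (h.finite_le (L * |(z : ℝ)| / ε)).subset fun w hw => ?_
      simp only [Set.mem_ofPred_eq] at hw ⊢
      have h1 := (abs_le.1 (hlip w (w - z))).1
      rw [show w - (w - z) = z by ring] at h1
      have h2 := h.a_nonneg (-z)
      rw [le_div_iff₀ hε]
      nlinarith
    · intro w hw
      have h0 : w ≠ 0 := by
        rintro rfl
        simp [h.a_zero] at hw
      refine ⟨((1 + ε) * (a w + if w = 0 then 1 else 0) + 1 * a (-z)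
          - (a (w - z) + if w - z = 0 then 1 else 0)), ?_, ?_⟩
      · rw [if_neg h0]
        split_ifs <;> linarith
      · have := (((h.poisson w).mul_left (1 + ε)).add (h.hasSum_one.mul_right (a (-z)))).sub
          (h.poisson (w - z))
        refine (congrArg (HasSum · _) (funext fun y => ?_)).mpr this
        rw [show w + y - z = w - z + y by ring]
        ring
  by_contra! hcon
  have h1 := h.a_nonneg x
  have h2 := key ((-(a x + a (-z) - a (x - z))) / (2 * (a x + 1))) (by
    apply div_pos <;> linarith)
  have h3 : (-(a x + a (-z) - a (x - z))) / (2 * (a x + 1)) * (2 * (a x + 1))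
      = -(a x + a (-z) - a (x - z)) := by
    field_simp
  nlinarith

end PotentialKernel

/-! ### The Green function of the walk killed on the nonpositive half-line -/

theorem hasSum_of_eq {ι : Type*} {f g : ι → ℝ} {v w : ℝ} (hf : HasSum f v)
    (hg : ∀ i, g i = f i) (hw : w = v) : HasSum g w := by
  rw [hw, show g = f from funext hg]
  exact hf

/-- The probability of moving from `x` to `z` in `n` steps of `p` without leaving `{1, 2, …}`. -/
noncomputable def killedStep (p : ℤ → ℝ) : ℕ → ℤ → ℤ → ℝ≥0∞
  | 0, x, z => if 1 ≤ x ∧ x = z then 1 else 0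
  | n + 1, x, z => if 1 ≤ x then ∑' y, ENNReal.ofReal (p y) * killedStep p n (x + y) z else 0

theorem killedStep_succ_right (p : ℤ → ℝ) (n : ℕ) (x z : ℤ) :
    killedStep p (n + 1) x z
      = if 1 ≤ z then ∑' y, ENNReal.ofReal (p y) * killedStep p n x (z - y) else 0 := by
  induction n generalizing x z with
  | zero =>
    simp only [killedStep]
    have h1 : ∑' y, ENNReal.ofReal (p y) * (if 1 ≤ x + y ∧ x + y = z then 1 else 0)
        = if 1 ≤ z then ENNReal.ofReal (p (z - x)) else 0 := by
      rw [tsum_eq_single (z - x) fun y hy => ?_]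
      · simp
      · rw [if_neg fun h => hy (by omega), mul_zero]
    have h2 : ∑' y, ENNReal.ofReal (p y) * (if 1 ≤ x ∧ x = z - y then 1 else 0)
        = if 1 ≤ x then ENNReal.ofReal (p (z - x)) else 0 := by
      rw [tsum_eq_single (z - x) fun y hy => ?_]
      · simp
      · rw [if_neg fun h => hy (by omega), mul_zero]
    rw [h1, h2]
    split_ifs <;> rfl
  | succ n ih =>
    have e : ∀ y, killedStep p (n + 1) x (z - y)
        = if 1 ≤ x then ∑' y', ENNReal.ofReal (p y') * killedStep p n (x + y') (z - y) else 0 :=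
      fun _ => rfl
    rw [killedStep]
    simp only [e, ih]
    by_cases hz : 1 ≤ z
    · simp only [hz, if_true]
      by_cases hx : 1 ≤ x
      · simp only [hx, if_true, ← ENNReal.tsum_mul_left]
        rw [ENNReal.tsum_comm]
        refine tsum_congr fun y => tsum_congr fun y' => by ring
      · simp [hx]
    · simp [hz]

/-- Time reversal turns the kernel `p` into its reflection. -/
theorem killedStep_reflect (p : ℤ → ℝ) (n : ℕ) (x z : ℤ) :
    killedStep (fun y => p (-y)) n z x = killedStep p n x z := by
  induction n generalizing x z with
  | zero =>
    simp only [killedStep]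
    refine if_congr ⟨fun h => ?_, fun h => ?_⟩ rfl rfl <;> omega
  | succ n ih =>
    rw [killedStep_succ_right p, killedStep]
    refine if_congr Iff.rfl ?_ rfl
    rw [← (Equiv.neg ℤ).tsum_eq]
    refine tsum_congr fun y => ?_
    simp [ih, sub_eq_add_neg]

/-- The expected number of visits to `z`, starting from `x`, before the walk leaves `{1, 2, …}`. -/
noncomputable def greenENN (p : ℤ → ℝ) (x z : ℤ) : ℝ≥0∞ := ∑' n, killedStep p n x z

theorem greenENN_reflect (p : ℤ → ℝ) (x z : ℤ) :
    greenENN (fun y => p (-y)) z x = greenENN p x z :=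
  tsum_congr fun n => killedStep_reflect p n x z

theorem greenENN_of_nonpos (p : ℤ → ℝ) {x : ℤ} (hx : x ≤ 0) (z : ℤ) : greenENN p x z = 0 := by
  have hx' : ¬ 1 ≤ x := by omega
  refine ENNReal.tsum_eq_zero.2 fun n => ?_
  cases n <;> simp [killedStep, hx']

theorem greenENN_eq (p : ℤ → ℝ) {x : ℤ} (hx : 1 ≤ x) (z : ℤ) :
    greenENN p x z
      = (if x = z then 1 else 0) + ∑' y, ENNReal.ofReal (p y) * greenENN p (x + y) z := by
  rw [greenENN, tsum_eq_zero_add' ENNReal.summable]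
  congr 1
  · simp [killedStep, hx]
  · simp only [killedStep, hx, if_true, greenENN, ← ENNReal.tsum_mul_left]
    rw [ENNReal.tsum_comm]

/-- The Green function is the smallest nonnegative supersolution of the Poisson equation on the
half-line. -/
theorem greenENN_le (p : ℤ → ℝ) (z : ℤ) (v : ℤ → ℝ≥0∞)
    (hv : ∀ x, 1 ≤ x →
      (if x = z then 1 else 0) + ∑' y, ENNReal.ofReal (p y) * v (x + y) ≤ v x) (x : ℤ) :
    greenENN p x z ≤ v x := by
  refine ENNReal.tsum_le_of_sum_range_le fun n => ?_
  induction n generalizing x with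
  | zero => simp
  | succ n ih =>
    by_cases hx : 1 ≤ x
    · refine le_trans ?_ (hv x hx)
      rw [Finset.sum_range_succ', add_comm]
      refine add_le_add (by simp [killedStep, hx]) ?_
      simp only [killedStep, hx, if_true]
      rw [← Summable.tsum_finsetSum fun _ _ => ENNReal.summable]
      refine ENNReal.tsum_le_tsum fun y => ?_
      rw [← Finset.mul_sum]
      gcongr
      exact ih _
    · have : ∀ i, killedStep p i x z = 0 := fun i => by cases i <;> simp [killedStep, hx]
      simp [this]

/-- The real-valued Green function of the half-line. -/
noncomputable def green (p : ℤ → ℝ) (x z : ℤ) : ℝ := (greenENN p x z).toReal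

theorem green_nonneg (p : ℤ → ℝ) (x z : ℤ) : 0 ≤ green p x z := ENNReal.toReal_nonneg

theorem green_reflect (p : ℤ → ℝ) (x z : ℤ) : green (fun y => p (-y)) z x = green p x z := by
  rw [green, greenENN_reflect, green]

theorem green_of_nonpos (p : ℤ → ℝ) {x : ℤ} (hx : x ≤ 0) (z : ℤ) : green p x z = 0 := by
  rw [green, greenENN_of_nonpos p hx, ENNReal.toReal_zero]

namespace PotentialKernel

variable {p a : ℤ → ℝ} {s : ℝ}

/-- The half-line Green function is dominated by the Green function of the walk killed at the
origin. -/
theorem greenENN_le_ofReal (h : PotentialKernel p a s) (x z : ℤ) :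
    greenENN p x z ≤ ENNReal.ofReal (a x + a (-z) - a (x - z)) := by
  refine greenENN_le p z (fun x => ENNReal.ofReal (a x + a (-z) - a (x - z))) (fun x hx => ?_) x
  have h1 := ((h.poisson x).add (h.hasSum_one.mul_right (a (-z)))).sub (h.poisson (x - z))
  have h2 : HasSum (fun y => p y * (a (x + y) + a (-z) - a (x + y - z)))
      (a x + a (-z) - a (x - z) - if x = z then 1 else 0) := by
    refine hasSum_of_eq h1 (fun y => ?_) ?_
    · rw [show x + y - z = x - z + y by ring]
      ring
    · rw [if_neg (by omega : x ≠ 0)]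
      simp only [sub_eq_zero]
      ring
  have h3 : ∑' y, ENNReal.ofReal (p y) * ENNReal.ofReal (a (x + y) + a (-z) - a (x + y - z))
      = ENNReal.ofReal (a x + a (-z) - a (x - z) - if x = z then 1 else 0) := by
    rw [← h2.tsum_eq, ENNReal.ofReal_tsum_of_nonneg
      (fun y => mul_nonneg (h.nonneg y) (h.subadd z _)) h2.summable]
    exact tsum_congr fun y => (ENNReal.ofReal_mul (h.nonneg y)).symm
  have h4 : 0 ≤ a x + a (-z) - a (x - z) - if x = z then 1 else 0 :=
    h2.nonneg fun y => mul_nonneg (h.nonneg y) (h.subadd z _)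
  rw [h3]
  split_ifs at h4 ⊢ with hxz
  · rw [← ENNReal.ofReal_one, ← ENNReal.ofReal_add zero_le_one h4]
    exact ENNReal.ofReal_le_ofReal (by linarith)
  · simp

theorem greenENN_ne_top (h : PotentialKernel p a s) (x z : ℤ) : greenENN p x z ≠ ∞ :=
  ((h.greenENN_le_ofReal x z).trans_lt ENNReal.ofReal_lt_top).ne

theorem exists_green_le (h : PotentialKernel p a s) :
    ∃ C : ℝ, 0 < C ∧ ∀ x z : ℤ, green p x z ≤ C * |(x : ℝ)| ∧ green p x z ≤ C * |(z : ℝ)| := by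
  obtain ⟨L, hL, hlip⟩ := h.exists_lipschitz
  refine ⟨2 * L, by positivity, fun x z => ?_⟩
  have h1 : green p x z ≤ a x + a (-z) - a (x - z) := by
    have := ENNReal.toReal_mono ENNReal.ofReal_ne_top (h.greenENN_le_ofReal x z)
    rwa [ENNReal.toReal_ofReal (h.subadd z x)] at this
  have h2 := (abs_le.1 (hlip x 0)).2
  have h3 := (abs_le.1 (hlip (-z) (x - z))).2
  have h4 := (abs_le.1 (hlip (-z) 0)).2
  have h5 := (abs_le.1 (hlip x (x - z))).2
  rw [h.a_zero] at h2 h4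
  rw [show -z - (x - z) = -x by ring, Int.cast_neg, abs_neg] at h3
  rw [show -z - 0 = -z by ring, Int.cast_neg, abs_neg] at h4
  rw [show x - (x - z) = z by ring] at h5
  simp only [sub_zero] at h2 h4
  constructor <;> linarith

theorem hasSum_green (h : PotentialKernel p a s) {x : ℤ} (hx : 1 ≤ x) (z : ℤ) :
    HasSum (fun y => p y * green p (x + y) z) (green p x z - if x = z then 1 else 0) := by
  have h1 := greenENN_eq p hx z
  have h2 : ∑' y, ENNReal.ofReal (p y) * greenENN p (x + y) z ≠ ∞ := fun hcon => by
    rw [hcon, add_top] at h1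
    exact h.greenENN_ne_top x z h1
  have h3 := (ENNReal.summable_toReal h2).hasSum
  rw [← ENNReal.tsum_toReal_eq fun y =>
    ENNReal.mul_ne_top ENNReal.ofReal_ne_top (h.greenENN_ne_top _ _)] at h3
  refine hasSum_of_eq h3 (fun y => ?_) ?_
  · rw [ENNReal.toReal_mul, ENNReal.toReal_ofReal (h.nonneg y), green]
  · rw [green, h1, ENNReal.toReal_add (by split_ifs <;> simp) h2]
    split_ifs <;> simp

end PotentialKernel

/-! ### Potentials of the half-line -/

/-- The potential `∑ g(x, z) b(z)` of the charge `b` for the Green function `g` of the half-line. -/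
noncomputable def greenPot (p : ℤ → ℝ) (b : ℤ → ℝ) (x : ℤ) : ℝ := ∑' z, green p x z * b z

theorem greenPot_of_nonpos (p b : ℤ → ℝ) {x : ℤ} (hx : x ≤ 0) : greenPot p b x = 0 := by
  simp [greenPot, green_of_nonpos p hx]

theorem greenPot_nonneg (p : ℤ → ℝ) {b : ℤ → ℝ} (hb : ∀ z, 0 ≤ b z) (x : ℤ) :
    0 ≤ greenPot p b x :=
  tsum_nonneg fun z => mul_nonneg (green_nonneg p x z) (hb z)

/-- `bd p F x = E[F(x + Y); x + Y ≤ 0]` for `x ≥ 1`: the mean of `F` over the steps by which the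
walk leaves the half-line from `x`. -/
noncomputable def bd (p : ℤ → ℝ) (F : ℤ → ℝ) (x : ℤ) : ℝ :=
  if 1 ≤ x then ∑' y, p y * (if x + y ≤ 0 then F (x + y) else 0) else 0

/-- The restriction of `F` to `{1, 2, …}`, extended by `0`. -/
noncomputable def posPart (F : ℤ → ℝ) (x : ℤ) : ℝ := if 1 ≤ x then F x else 0

namespace CenteredKernel

variable {p : ℤ → ℝ} {s : ℝ}

theorem summable_bd_term (h : CenteredKernel p s) {F : ℤ → ℝ} {K : ℝ}
    (hF : ∀ w, |F w| ≤ K * (1 + |(w : ℝ)|)) (x : ℤ) :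
    Summable fun y : ℤ => p y * (if x + y ≤ 0 then F (x + y) else 0) :=
  h.summable_of_growth (F := fun w => if w ≤ 0 then F w else 0) (K := K) (fun w => by
    have := (abs_nonneg _).trans (hF w)
    split_ifs
    · exact hF w
    · simpa using this) x

theorem hasSum_posPart (h : CenteredKernel p s) {F : ℤ → ℝ} {K : ℝ}
    (hF : ∀ w, |F w| ≤ K * (1 + |(w : ℝ)|)) {x : ℤ} (hx : 1 ≤ x) {v : ℝ}
    (hv : HasSum (fun y => p y * F (x + y)) v) :
    HasSum (fun y => p y * posPart F (x + y)) (v - bd p F x) := by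
  refine hasSum_of_eq (hv.sub (h.summable_bd_term hF x).hasSum) (fun y => ?_) (by simp [bd, hx])
  rw [posPart]
  split_ifs <;> first | omega | ring

/-- The charge `bd p F` of a function of linear growth is summable, as the second moment is
finite: the sites `x ≥ 1` from which a step `y` leads out of the half-line are at most `|y|` in
number. -/
theorem summable_bd (h : CenteredKernel p s) {F : ℤ → ℝ} {K : ℝ}
    (hF : ∀ w, |F w| ≤ K * (1 + |(w : ℝ)|)) : Summable (bd p F) := by
  have hK : 0 ≤ K := by simpa using (abs_nonneg _).trans (hF 0)
  have h1 : ∀ y : ℤ, HasSum (fun x : ℤ => if 1 ≤ x ∧ x + y ≤ 0 then p y * (K * |(y : ℝ)|) else 0)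
      (∑ x ∈ Finset.Icc 1 (-y), p y * (K * |(y : ℝ)|)) := by
    intro y
    refine hasSum_of_eq (hasSum_sum_of_ne_finset_zero
      (f := fun x : ℤ => if 1 ≤ x ∧ x + y ≤ 0 then p y * (K * |(y : ℝ)|) else 0)
      (s := Finset.Icc 1 (-y)) fun x hx => ?_) (fun _ => rfl) ?_
    · rw [if_neg fun hcon => hx (Finset.mem_Icc.2 ⟨hcon.1, by omega⟩)]
    · refine Finset.sum_congr rfl fun x hx => ?_
      rw [Finset.mem_Icc] at hx
      rw [if_pos ⟨hx.1, by omega⟩]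
  have hnn : ∀ x y : ℤ, 0 ≤ if 1 ≤ x ∧ x + y ≤ 0 then p y * (K * |(y : ℝ)|) else 0 := fun x y => by
    have := h.nonneg y
    split_ifs <;> positivity
  have h2 : Summable fun q : ℤ × ℤ =>
      if 1 ≤ q.2 ∧ q.2 + q.1 ≤ 0 then p q.1 * (K * |(q.1 : ℝ)|) else 0 := by
    rw [summable_prod_of_nonneg fun q => hnn q.2 q.1]
    refine ⟨fun y => (h1 y).summable, ?_⟩
    refine Summable.of_nonneg_of_le (fun y => tsum_nonneg fun x => hnn x y) (fun y => ?_)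
      (h.hasSum_sq.summable.mul_left K)
    rw [(h1 y).tsum_eq, Finset.sum_const, Int.card_Icc, nsmul_eq_mul]
    have h3 : (((-y + 1 - 1).toNat : ℕ) : ℝ) ≤ |(y : ℝ)| := by
      rw [add_sub_cancel_right, ← Int.cast_natCast, ← Int.cast_abs, Int.cast_le]
      rcases le_total 0 y with hy | hy
      · rw [abs_of_nonneg hy]; omega
      · rw [abs_of_nonpos hy]; omega
    calc _ ≤ |(y : ℝ)| * (p y * (K * |(y : ℝ)|)) := by
          have := h.nonneg y
          gcongr
      _ = K * (p y * (y : ℝ) ^ 2) := by rw [← sq_abs (y : ℝ)]; ring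
  have h3 := ((Equiv.prodComm ℤ ℤ).summable_iff.2 h2).prod
  refine Summable.of_norm_bounded h3 fun x => ?_
  have h4 := ((Equiv.prodComm ℤ ℤ).summable_iff.2 h2).prod_factor x
  simp only [Function.comp_def, Equiv.prodComm_apply, Prod.swap] at h4 ⊢
  rw [bd]
  split_ifs with hx
  · have hb : ∀ y : ℤ, ‖p y * (if x + y ≤ 0 then F (x + y) else 0)‖
        ≤ if 1 ≤ x ∧ x + y ≤ 0 then p y * (K * |(y : ℝ)|) else 0 := by
      intro y
      rw [norm_mul, Real.norm_eq_abs, abs_of_nonneg (h.nonneg y)]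
      by_cases hxy : x + y ≤ 0
      · rw [if_pos hxy, if_pos ⟨hx, hxy⟩, Real.norm_eq_abs]
        refine mul_le_mul_of_nonneg_left ((hF _).trans ?_) (h.nonneg y)
        gcongr
        have : (1 + |x + y| : ℤ) ≤ |y| := by
          rw [abs_of_nonpos hxy, abs_of_nonpos (by omega)]
          omega
        exact_mod_cast this
      · rw [if_neg hxy, if_neg fun hcon => hxy hcon.2]
        simp
    exact tsum_of_norm_bounded h4.hasSum hb
  · rw [norm_zero]
    exact tsum_nonneg fun y => hnn x y

theorem bd_nonneg (h : CenteredKernel p s) {F : ℤ → ℝ} (hF : ∀ w ≤ 0, 0 ≤ F w) (x : ℤ) :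
    0 ≤ bd p F x := by
  rw [bd]
  split_ifs
  · refine tsum_nonneg fun y => mul_nonneg (h.nonneg y) ?_
    split_ifs with hy
    · exact hF _ hy
    · exact le_rfl
  · exact le_rfl

end CenteredKernel

namespace PotentialKernel

variable {p a : ℤ → ℝ} {s : ℝ}

theorem summable_green_mul (h : PotentialKernel p a s) {b : ℤ → ℝ} (hb : Summable b) (x : ℤ) :
    Summable fun z => green p x z * b z := by
  obtain ⟨C, hC, hg⟩ := h.exists_green_le
  refine Summable.of_norm_bounded (hb.norm.mul_left (C * |(x : ℝ)|)) fun z => ?_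
  rw [norm_mul, Real.norm_eq_abs, abs_of_nonneg (green_nonneg p x z)]
  gcongr
  exact (hg x z).1

/-- The potential of a summable charge `b` solves `∑ p(y) u(x+y) = u(x) - b(x)` on the
half-line. -/
theorem hasSum_greenPot (h : PotentialKernel p a s) {b : ℤ → ℝ} (hb : Summable b) {x : ℤ}
    (hx : 1 ≤ x) :
    HasSum (fun y => p y * greenPot p b (x + y)) (greenPot p b x - b x) := by
  obtain ⟨C, hC, hg⟩ := h.exists_green_le
  have hp : Summable fun y : ℤ => p y * (C * (1 + |((x + y : ℤ) : ℝ)|)) := h.summable_growth C x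
  have h1 : Summable fun q : ℤ × ℤ => p q.1 * (green p (x + q.1) q.2 * b q.2) := by
    refine Summable.of_norm_bounded (hp.mul_of_nonneg hb.norm (fun y => ?_) fun z => norm_nonneg _)
      fun q => ?_
    · exact mul_nonneg (h.nonneg y) (by positivity)
    · rw [norm_mul, norm_mul, Real.norm_eq_abs, Real.norm_eq_abs, abs_of_nonneg (h.nonneg _),
        abs_of_nonneg (green_nonneg _ _ _), ← mul_assoc]
      have h2 := h.nonneg q.1
      gcongr
      refine (hg _ _).1.trans ?_
      gcongr
      linarith
  have h3 := h1.prod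
  have h4 := Summable.tsum_comm (f := fun y z => p y * (green p (x + y) z * b z)) h1
  have h5 : HasSum (fun z => (green p x z - if x = z then 1 else 0) * b z)
      (greenPot p b x - b x) := by
    refine hasSum_of_eq ((h.summable_green_mul hb x).hasSum.sub (hasSum_ite_eq x (b x)))
      (fun z => ?_) rfl
    by_cases hz : x = z
    · subst hz; simp; ring
    · simp [hz, Ne.symm hz]
  have h6 : ∑' y, ∑' z, p y * (green p (x + y) z * b z) = greenPot p b x - b x := by
    rw [← h4, ← h5.tsum_eq]
    refine tsum_congr fun z => ?_
    rw [← ((h.hasSum_green hx z).mul_right (b z)).tsum_eq]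
    exact tsum_congr fun y => by ring
  rw [← h6]
  refine hasSum_of_eq h3.hasSum (fun y => ?_) rfl
  rw [greenPot, ← tsum_mul_left]

theorem tendsto_greenPot_div (h : PotentialKernel p a s) {b : ℤ → ℝ} (hb : Summable b) :
    Tendsto (fun x : ℤ => greenPot p b x / (x : ℝ)) atTop (𝓝 0) := by
  obtain ⟨C, hC, hg⟩ := h.exists_green_le
  have h1 : Tendsto (fun x : ℤ => ∑' z, green p x z * b z / (x : ℝ)) atTop
      (𝓝 (∑' _ : ℤ, (0 : ℝ))) := by
    refine tendsto_tsum_of_dominated_convergence (bound := fun z => C * ‖b z‖)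
      (hb.norm.mul_left C) (fun z => ?_) ?_
    · have h2 : Tendsto (fun x : ℤ => C * |(z : ℝ)| * ‖b z‖ / (x : ℝ)) atTop (𝓝 0) :=
        tendsto_const_nhds.div_atTop tendsto_intCast_atTop_atTop
      refine squeeze_zero_norm' ?_ h2
      filter_upwards [eventually_gt_atTop 0] with x hx
      have hx' : (0 : ℝ) < x := by exact_mod_cast hx
      rw [norm_div, norm_mul, Real.norm_of_nonneg (green_nonneg p x z), Real.norm_of_nonneg hx'.le]
      gcongr
      exact (hg x z).2
    · filter_upwards [eventually_gt_atTop 0] with x hx z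
      have hx' : (0 : ℝ) < x := by exact_mod_cast hx
      rw [norm_div, norm_mul, Real.norm_of_nonneg (green_nonneg p x z), Real.norm_of_nonneg hx'.le,
        div_le_iff₀ hx']
      have h3 := (hg x z).1
      rw [abs_of_pos hx'] at h3
      calc _ ≤ C * x * ‖b z‖ := by gcongr
        _ = _ := by ring
  rw [tsum_zero] at h1
  refine h1.congr fun x => ?_
  rw [tsum_div_const, greenPot]

end PotentialKernel

/-! ### The harmonic function of the half-line -/

theorem abs_neg_intCast_le (w : ℤ) : |-(w : ℝ)| ≤ 1 * (1 + |(w : ℝ)|) := by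
  rw [abs_neg]
  linarith

/-- The positive function on `{1, 2, …}` that is harmonic for the killed walk and asymptotic to `x`,
extended by `0`: it is `x - E[S_T]` with `T` the exit time from the half-line. -/
noncomputable def harm (p : ℤ → ℝ) (x : ℤ) : ℝ :=
  posPart (fun w => (w : ℝ)) x + greenPot p (bd p fun w => -(w : ℝ)) x

theorem harm_of_nonpos (p : ℤ → ℝ) {x : ℤ} (hx : x ≤ 0) : harm p x = 0 := by
  have hx' : ¬ 1 ≤ x := by omega
  simp [harm, posPart, greenPot_of_nonpos p _ hx, hx']

namespace PotentialKernel

variable {p a : ℤ → ℝ} {s : ℝ}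

theorem le_harm (h : PotentialKernel p a s) {x : ℤ} (hx : 1 ≤ x) : (x : ℝ) ≤ harm p x := by
  rw [harm, posPart, if_pos hx]
  refine le_add_of_nonneg_right (greenPot_nonneg p (h.bd_nonneg fun w hw => ?_) x)
  have : (w : ℝ) ≤ 0 := by exact_mod_cast hw
  linarith

theorem harm_nonneg (h : PotentialKernel p a s) (x : ℤ) : 0 ≤ harm p x := by
  rcases lt_or_ge x 1 with hx | hx
  · rw [harm_of_nonpos p (by omega)]
  · refine le_trans ?_ (h.le_harm hx)
    exact_mod_cast (by omega : 0 ≤ x)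

theorem bd_neg_function (p : ℤ → ℝ) (F : ℤ → ℝ) (x : ℤ) :
    bd p (fun w => -F w) x = -bd p F x := by
  rw [bd, bd]
  split_ifs
  · rw [← tsum_neg]
    refine tsum_congr fun y => ?_
    split_ifs <;> ring
  · simp

theorem hasSum_harm (h : PotentialKernel p a s) {x : ℤ} (hx : 1 ≤ x) :
    HasSum (fun y => p y * harm p (x + y)) (harm p x) := by
  have h1 : HasSum (fun y : ℤ => p y * ((x + y : ℤ) : ℝ)) (x : ℝ) := by
    refine hasSum_of_eq ((h.hasSum_one.mul_right (x : ℝ)).add h.hasSum_mean) (fun y => ?_) (by ring)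
    push_cast
    ring
  have h2 := h.hasSum_posPart (F := fun w => (w : ℝ)) (K := 1) (fun w => by linarith) hx h1
  have h3 := h.hasSum_greenPot (h.summable_bd abs_neg_intCast_le) hx
  refine hasSum_of_eq (h2.add h3) (fun y => ?_) ?_
  · rw [harm]
    ring
  · rw [harm, posPart, if_pos hx, bd_neg_function]
    ring

theorem tendsto_harm_div (h : PotentialKernel p a s) :
    Tendsto (fun x : ℤ => harm p x / (x : ℝ)) atTop (𝓝 1) := by
  have h1 := (h.tendsto_greenPot_div (h.summable_bd abs_neg_intCast_le)).const_add 1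
  rw [add_zero] at h1
  refine h1.congr' ?_
  filter_upwards [eventually_ge_atTop 1] with x hx
  have hx' : (x : ℝ) ≠ 0 := by
    have : x ≠ 0 := by omega
    exact_mod_cast this
  rw [harm, posPart, if_pos hx]
  field_simp

/-- A function that is harmonic for the killed walk and `o(x)` vanishes, by the minimum principle
applied to `ε f ± d`. -/
theorem eq_zero_of_harmonic (h : PotentialKernel p a s) {d : ℤ → ℝ}
    (h0 : ∀ x ≤ 0, d x = 0) (hd : ∀ x, 1 ≤ x → HasSum (fun y => p y * d (x + y)) (d x))
    (hlim : Tendsto (fun x : ℤ => d x / (x : ℝ)) atTop (𝓝 0)) (x : ℤ) : d x = 0 := by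
  have key : ∀ (d : ℤ → ℝ), (∀ x ≤ 0, d x = 0) →
      (∀ x, 1 ≤ x → HasSum (fun y => p y * d (x + y)) (d x)) →
      Tendsto (fun x : ℤ => d x / (x : ℝ)) atTop (𝓝 0) → ∀ x, 0 ≤ d x := by
    intro d h0 hd hlim x
    refine le_of_forall_pos_le_add fun ε hε => ?_
    have hH : 0 < harm p x + 1 := by linarith [h.harm_nonneg x]
    set η := ε / (harm p x + 1) with hη
    have hη0 : 0 < η := by positivity
    have h1 : 0 ≤ d x + η * harm p x := by
      refine h.nonneg_of_superharmonic (u := fun x => d x + η * harm p x) ?_ ?_ x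
      · have h2 := hlim.add (h.tendsto_harm_div.const_mul η)
        rw [zero_add, mul_one] at h2
        obtain ⟨N, hN⟩ := eventually_atTop.1 (h2.eventually (lt_mem_nhds hη0))
        refine (Set.finite_Icc 1 (max N 1)).subset fun w (hw : d w + η * harm p w < 0) => ?_
        have hw1 : 1 ≤ w := by
          by_contra! hcon
          rw [h0 w (by omega), harm_of_nonpos p (by omega)] at hw
          simp at hw
        refine ⟨hw1, ?_⟩
        by_contra! hcon
        have h3 := hN w ((le_max_left _ _).trans hcon.le)
        have hw' : (0 : ℝ) < w := by exact_mod_cast (by omega : 0 < w)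
        rw [← mul_div_assoc, ← add_div] at h3
        exact absurd (div_pos_iff_of_pos_right hw' |>.1 h3) (not_lt.2 hw.le)
      · intro w hw
        have hw1 : 1 ≤ w := by
          by_contra! hcon
          rw [h0 w (by omega), harm_of_nonpos p (by omega)] at hw
          simp at hw
        refine ⟨_, le_rfl, hasSum_of_eq ((hd w hw1).add ((h.hasSum_harm hw1).mul_left η))
          (fun y => by ring) rfl⟩
    have h4 : η * (harm p x + 1) = ε := by rw [hη]; field_simp
    nlinarith
  refine le_antisymm ?_ (key d h0 hd hlim x)
  have := key (fun x => -d x) (fun x hx => by simp [h0 x hx])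
    (fun x hx => hasSum_of_eq (hd x hx).neg (fun y => by ring) rfl)
    (by simpa [neg_div] using hlim.neg) x
  linarith

theorem harm_unique (h : PotentialKernel p a s) {f : ℤ → ℝ}
    (h0 : ∀ x ≤ 0, f x = 0) (hf : ∀ x, 1 ≤ x → HasSum (fun y => p y * f (x + y)) (f x))
    (hlim : Tendsto (fun x : ℤ => f x / (x : ℝ)) atTop (𝓝 1)) : f = harm p := by
  funext x
  refine sub_eq_zero.1 (h.eq_zero_of_harmonic (d := fun x => f x - harm p x)
    (fun x hx => by rw [h0 x hx, harm_of_nonpos p hx, sub_zero])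
    (fun x hx => hasSum_of_eq ((hf x hx).sub (h.hasSum_harm hx)) (fun y => by ring) rfl) ?_ x)
  simpa [sub_div] using hlim.sub h.tendsto_harm_div

/-- Riesz-type representation on the half-line: a function with `∑ p(y) F(x+y) = F(x) - ρ(x)` for
`x ≥ 1` and `F(x)/x → c` is the sum of `c f`, of the potential of `ρ` and of the mean of `F` at
the exit from the half-line. -/
theorem representation (h : PotentialKernel p a s) {F ρ : ℤ → ℝ} {K c : ℝ}
    (hF : ∀ w, |F w| ≤ K * (1 + |(w : ℝ)|)) (hρ : Summable ρ)
    (hFρ : ∀ x, 1 ≤ x → HasSum (fun y => p y * F (x + y)) (F x - ρ x))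
    (hc : Tendsto (fun x : ℤ => F x / (x : ℝ)) atTop (𝓝 c)) {x : ℤ} (hx : 1 ≤ x) :
    F x = c * harm p x + greenPot p (fun z => ρ z + bd p F z) x := by
  have hs : Summable fun z => ρ z + bd p F z := hρ.add (h.summable_bd hF)
  have h1 := h.eq_zero_of_harmonic
    (d := fun x => posPart F x - c * harm p x - greenPot p (fun z => ρ z + bd p F z) x)
    (fun x hx => ?_) (fun x hx => ?_) ?_ x
  · rw [posPart, if_pos hx] at h1
    linarith
  · rw [posPart, if_neg (by omega), harm_of_nonpos p hx, greenPot_of_nonpos p _ hx]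
    simp
  · refine hasSum_of_eq (((h.hasSum_posPart hF hx (hFρ x hx)).sub
      ((h.hasSum_harm hx).mul_left c)).sub (h.hasSum_greenPot hs hx)) (fun y => by ring) ?_
    rw [posPart, if_pos hx]
    ring
  · have h2 := (hc.sub (h.tendsto_harm_div.const_mul c)).sub (h.tendsto_greenPot_div hs)
    simp only [mul_one, sub_self] at h2
    refine h2.congr' ?_
    filter_upwards [eventually_ge_atTop 1] with x hx
    rw [posPart, if_pos hx]
    ring

theorem exists_harm_le (h : PotentialKernel p a s) :
    ∃ K : ℝ, 0 < K ∧ ∀ x, 1 ≤ x → harm p x ≤ K * (x : ℝ) := by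
  obtain ⟨N, hN⟩ := eventually_atTop.1
    (h.tendsto_harm_div.eventually (gt_mem_nhds (one_lt_two)))
  obtain ⟨B, hB⟩ := ((Set.finite_Icc 1 N).image (harm p)).bddAbove
  refine ⟨max 2 B, by positivity, fun x hx => ?_⟩
  have hx' : (1 : ℝ) ≤ x := by exact_mod_cast hx
  rcases le_total N x with hxN | hxN
  · have := hN x hxN
    rw [div_lt_iff₀ (by linarith)] at this
    exact this.le.trans (by gcongr; exact le_max_left _ _)
  · have h1 := hB ⟨x, ⟨hx, hxN⟩, rfl⟩
    have h2 : (2 : ℝ) ≤ max 2 B := le_max_left _ _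
    have h3 : B ≤ max 2 B := le_max_right _ _
    nlinarith

/-! ### Asymptotics of the Green function and the limit of `s a(x) - x` -/

/-- Dominated convergence for `g(x, ·)` applied to the exit means of a family of functions of
uniformly linear growth. -/
theorem tendsto_greenPot_bd (h : PotentialKernel p a s) {ι : Type*} {l : Filter ι}
    {F : ι → ℤ → ℝ} {F₀ : ℤ → ℝ} {K : ℝ}
    (hF : ∀ i w, |F i w| ≤ K * (1 + |(w : ℝ)|))
    (hlim : ∀ w, Tendsto (fun i => F i w) l (𝓝 (F₀ w))) (x : ℤ) :
    Tendsto (fun i => greenPot p (bd p (F i)) x) l (𝓝 (greenPot p (bd p F₀) x)) := by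
  have hG : ∀ w : ℤ, |K * (1 + |(w : ℝ)|)| ≤ |K| * (1 + |(w : ℝ)|) := fun w => by
    rw [abs_mul, abs_of_nonneg (a := 1 + |(w : ℝ)|) (by positivity)]
  have hterm : ∀ i (z y : ℤ), ‖p y * (if z + y ≤ 0 then F i (z + y) else 0)‖
      ≤ p y * (if z + y ≤ 0 then K * (1 + |((z + y : ℤ) : ℝ)|) else 0) := by
    intro i z y
    rw [norm_mul, Real.norm_of_nonneg (h.nonneg y)]
    refine mul_le_mul_of_nonneg_left ?_ (h.nonneg y)
    split_ifs
    · exact hF i _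
    · simp
  refine tendsto_tsum_of_dominated_convergence
    (h.summable_green_mul (h.summable_bd hG) x) (fun z => ?_) (Eventually.of_forall fun i z => ?_)
  · refine Tendsto.const_mul _ ?_
    simp only [bd]
    split_ifs with hz
    · refine tendsto_tsum_of_dominated_convergence (h.summable_bd_term hG z) (fun y => ?_)
        (Eventually.of_forall fun i y => hterm i z y)
      refine Tendsto.const_mul _ ?_
      split_ifs
      · exact hlim _
      · exact tendsto_const_nhds
    · exact tendsto_const_nhds
  · rw [norm_mul, Real.norm_of_nonneg (green_nonneg p x z)]
    refine mul_le_mul_of_nonneg_left ?_ (green_nonneg p x z)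
    simp only [bd]
    split_ifs
    · exact tsum_of_norm_bounded (h.summable_bd_term hG z).hasSum (hterm i z)
    · simp

theorem abs_le_growth (h : PotentialKernel p a s) :
    ∃ L : ℝ, 0 < L ∧ (∀ x, |a x| ≤ L * |(x : ℝ)|) ∧
      ∀ x y : ℤ, |a x - a y| ≤ L * |((x - y : ℤ) : ℝ)| := by
  obtain ⟨L, hL, hlip⟩ := h.exists_lipschitz
  refine ⟨L, hL, fun x => ?_, hlip⟩
  simpa [h.a_zero] using hlip x 0

theorem tendsto_increment_top (h : PotentialKernel p a s) (k : ℤ) :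
    Tendsto (fun x : ℤ => a (x + k) - a x) atTop (𝓝 (k / s)) := by
  have hnat : ∀ n : ℕ, Tendsto (fun x : ℤ => a (x + n) - a x) atTop (𝓝 (n / s)) := by
    intro n
    induction n with
    | zero => simp
    | succ n ih =>
      have h1 : Tendsto (fun x : ℤ => a (x + n + 1) - a (x + n)) atTop (𝓝 (1 / s)) :=
        h.tendsto_top.comp (tendsto_atTop_add_const_right _ _ tendsto_id)
      have h2 := h1.add ih
      rw [← add_div, add_comm (1 : ℝ)] at h2
      push_cast
      refine h2.congr fun x => ?_
      rw [← add_assoc]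
      ring
  rcases le_total 0 k with hk | hk
  · obtain ⟨n, rfl⟩ := Int.eq_ofNat_of_zero_le hk
    exact_mod_cast hnat n
  · obtain ⟨n, hn⟩ := Int.eq_ofNat_of_zero_le (neg_nonneg.2 hk)
    obtain rfl : k = -(n : ℤ) := by omega
    have h1 : Tendsto (fun x : ℤ => x + -(n : ℤ)) atTop atTop :=
      tendsto_atTop_add_const_right _ _ tendsto_id
    have h2 := ((hnat n).comp h1).neg
    refine (h2.congr fun x => ?_).trans (by simp [neg_div])
    simp [Function.comp]

/-- `g(x, z) → (2/s) f_-(z)` as `x → ∞`. By duality `z ↦ g(x, z)` is a Green function of the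
reflected walk; representing `z ↦ a(x - z)` on the half-line expresses it by `f_-` and by
increments of `a` near `x`. -/
theorem tendsto_green (h : PotentialKernel p a s) {z : ℤ} (hz : 1 ≤ z) :
    Tendsto (fun x => green p x z) atTop (𝓝 (2 / s * harm (fun y => p (-y)) z)) := by
  obtain ⟨L, hL, hgr, hlip⟩ := h.abs_le_growth
  have hd := h.reflect
  set q : ℤ → ℝ := fun y => p (-y) with hq
  -- the walk leaves the half-line almost surely
  have hone : greenPot q (bd q fun _ => 1) z = 1 := by
    have h1 : Tendsto (fun x : ℤ => (1 : ℝ) / (x : ℝ)) atTop (𝓝 0) :=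
      tendsto_const_nhds.div_atTop tendsto_intCast_atTop_atTop
    have h2 := hd.representation (F := fun _ => 1) (ρ := fun _ => 0) (K := 1) (c := 0)
      (fun w => by simp) summable_zero
      (fun x _ => by simpa using hd.hasSum_one) h1 hz
    simpa using h2.symm
  have hgrow : ∀ x w : ℤ, |a (x - w)| ≤ L * (1 + |(x : ℝ)|) * (1 + |(w : ℝ)|) := fun x w => by
    refine (hgr _).trans ?_
    rw [mul_assoc]
    refine mul_le_mul_of_nonneg_left ?_ hL.le
    push_cast
    refine (abs_sub _ _).trans ?_
    nlinarith [abs_nonneg (x : ℝ), abs_nonneg (w : ℝ)]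
  have hgrow' : ∀ x w : ℤ, |a (x - w) - a (x - z)| ≤ L * (1 + |(z : ℝ)|) * (1 + |(w : ℝ)|) :=
    fun x w => by
    refine (hlip _ _).trans ?_
    rw [mul_assoc]
    refine mul_le_mul_of_nonneg_left ?_ hL.le
    push_cast
    rw [show (x : ℝ) - w - (x - z) = z - w by ring]
    refine (abs_sub _ _).trans ?_
    nlinarith [abs_nonneg (z : ℝ), abs_nonneg (w : ℝ)]
  have hrep : ∀ x : ℤ, green p x z
      = greenPot q (bd q fun w => a (x - w) - a (x - z)) z + 1 / s * harm q z := by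
    intro x
    have h1 : Tendsto (fun w : ℤ => a (x - w) / (w : ℝ)) atTop (𝓝 (1 / s)) := by
      have h2 := (hd.tendsto_div_top).add (squeeze_zero_norm
        (f := fun w : ℤ => (a (x - w) - a (-w)) / (w : ℝ))
        (a := fun w : ℤ => L * |(x : ℝ)| / |(w : ℝ)|)
        (fun w => by
          rw [norm_div, Real.norm_eq_abs, Real.norm_eq_abs]
          gcongr
          have := hlip (x - w) (-w)
          rwa [show x - w - -w = x by ring] at this)
        (tendsto_const_nhds.div_atTop (tendsto_abs_atTop_atTop.comp tendsto_intCast_atTop_atTop)))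
      rw [add_zero] at h2
      refine h2.congr fun w => ?_
      rw [← add_div]
      congr 1
      ring
    have hρ : HasSum (fun w => green q z w * -(if x = w then 1 else 0)) (-green p x z) := by
      refine hasSum_of_eq (hasSum_ite_eq x (-green p x z)) (fun w => ?_) rfl
      by_cases hw : x = w
      · subst hw
        simp [hq, green_reflect]
      · simp [hw, Ne.symm hw]
    have hρs : Summable fun w : ℤ => -(if x = w then (1 : ℝ) else 0) := by
      refine Summable.neg ?_
      refine (hasSum_of_eq (hasSum_ite_eq x (1 : ℝ)) (fun w => ?_) rfl).summable
      simp only [eq_comm]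
    have h3 := hd.representation (F := fun w => a (x - w)) (ρ := fun w => -(if x = w then 1 else 0))
      (hgrow x) hρs (fun w _ => by
        refine hasSum_of_eq ((Equiv.neg ℤ).hasSum_iff.2 (h.poisson (x - w))) (fun y => ?_) ?_
        · simp [hq, sub_sub, ← sub_eq_add_neg]
        · simp [sub_eq_zero]) h1 hz
    have hb : Summable (bd q fun w => a (x - w)) := hd.summable_bd (hgrow x)
    have hb1 : Summable (bd q fun _ => 1) := hd.summable_bd (K := 1) (fun w => by simp)
    have h4 : greenPot q (fun w => -(if x = w then 1 else 0) + bd q (fun w => a (x - w)) w) z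
        = -green p x z + greenPot q (bd q fun w => a (x - w)) z := by
      simp only [greenPot, mul_add]
      rw [(hd.summable_green_mul hρs z).tsum_add (hd.summable_green_mul hb z), hρ.tsum_eq]
    have h5 : greenPot q (bd q fun w => a (x - w) - a (x - z)) z
        = greenPot q (bd q fun w => a (x - w)) z - a (x - z) := by
      have h6 : ∀ v, bd q (fun w => a (x - w) - a (x - z)) v
          = bd q (fun w => a (x - w)) v - a (x - z) * bd q (fun _ => 1) v := by
        intro v
        simp only [bd]
        split_ifs with hv
        · rw [← tsum_mul_left, ← (hd.summable_bd_term (hgrow x) v).tsum_sub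
            ((hd.summable_bd_term (F := fun _ => 1) (K := 1) (fun w => by simp) v).mul_left _)]
          refine tsum_congr fun y => ?_
          split_ifs <;> ring
        · simp
      simp only [greenPot, h6, mul_sub]
      rw [(hd.summable_green_mul hb z).tsum_sub]
      · congr 1
        trans a (x - z) * greenPot q (bd q fun _ => 1) z
        · rw [greenPot, ← tsum_mul_left]
          exact tsum_congr fun v => by ring
        · rw [hone, mul_one]
      · refine ((hd.summable_green_mul hb1 z).mul_left (a (x - z))).congr fun v => by ring
    rw [h5]
    linarith
  have hlim := (hd.tendsto_greenPot_bd (l := atTop) (F₀ := fun w => ((z : ℝ) - w) / s) hgrow'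
    (fun w => by
      have h1 : Tendsto (fun x : ℤ => x - z) atTop atTop :=
        tendsto_atTop_add_const_right _ (-z) tendsto_id
      have := (h.tendsto_increment_top (z - w)).comp h1
      push_cast at this
      refine this.congr fun x => ?_
      simp [Function.comp]) z).add_const (1 / s * harm q z)
  have hval : greenPot q (bd q fun w => ((z : ℝ) - w) / s) z = 1 / s * harm q z := by
    have hb1 : Summable (bd q fun _ => 1) := hd.summable_bd (K := 1) (fun w => by simp)
    have hb2 : Summable (bd q fun w => -(w : ℝ)) := hd.summable_bd abs_neg_intCast_le
    have h6 : ∀ v, bd q (fun w => ((z : ℝ) - w) / s) v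
        = z / s * bd q (fun _ => 1) v + 1 / s * bd q (fun w => -(w : ℝ)) v := by
      intro v
      simp only [bd]
      split_ifs with hv
      · rw [← tsum_mul_left, ← tsum_mul_left,
          ← ((hd.summable_bd_term (F := fun _ => 1) (K := 1) (fun w => by simp) v).mul_left
            _).tsum_add ((hd.summable_bd_term abs_neg_intCast_le v).mul_left _)]
        refine tsum_congr fun y => ?_
        split_ifs <;> ring
      · simp
    have h7 : greenPot q (bd q fun w => ((z : ℝ) - w) / s) z
        = z / s * greenPot q (bd q fun _ => 1) z
          + 1 / s * greenPot q (bd q fun w => -(w : ℝ)) z := by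
      simp only [greenPot]
      rw [← tsum_mul_left, ← tsum_mul_left, ← ((hd.summable_green_mul hb1 z).mul_left _).tsum_add
        ((hd.summable_green_mul hb2 z).mul_left _)]
      refine tsum_congr fun v => ?_
      rw [h6]
      ring
    rw [h7, hone, harm, posPart, if_pos hz]
    ring
  rw [hval] at hlim
  refine (hlim.congr fun x => (hrep x).symm).trans ?_
  rw [show 1 / s * harm q z + 1 / s * harm q z = 2 / s * harm q z by ring]

end PotentialKernel

/-- A version of dominated convergence that allows the limit to be infinite: if each `f i` is at
most a constant multiple of the pointwise limit `g`, then the sums converge. -/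
theorem tendsto_tsum_of_le_mul {ι β : Type*} {l : Filter ι} [l.IsCountablyGenerated] [Countable β]
    {f : ι → β → ℝ≥0∞} {g : β → ℝ≥0∞} {K : ℝ≥0∞} (hK : K ≠ ∞)
    (hle : ∀ᶠ i in l, ∀ b, f i b ≤ K * g b) (hlim : ∀ b, Tendsto (fun i => f i b) l (𝓝 (g b))) :
    Tendsto (fun i => ∑' b, f i b) l (𝓝 (∑' b, g b)) := by
  by_cases hg : ∑' b, g b = ∞
  · rw [hg, tendsto_order]
    refine ⟨fun c hc => ?_, fun c hc => absurd hc not_top_lt⟩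
    have h1 : Tendsto (fun t : Finset β => ∑ b ∈ t, g b) atTop (𝓝 ∞) :=
      hg ▸ ENNReal.summable.hasSum
    obtain ⟨t, ht⟩ := (h1.eventually (lt_mem_nhds hc)).exists
    have h2 : Tendsto (fun i => ∑ b ∈ t, f i b) l (𝓝 (∑ b ∈ t, g b)) :=
      tendsto_finsetSum t fun b _ => hlim b
    filter_upwards [h2.eventually (lt_mem_nhds ht)] with i hi
    exact hi.trans_le (ENNReal.sum_le_tsum t)
  · let _ : MeasurableSpace β := ⊤
    have h1 := tendsto_lintegral_filter_of_dominated_convergence (μ := Measure.count) (l := l)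
      (F := f) (f := g) (fun b => K * g b) (Eventually.of_forall fun i => measurable_from_top)
      (hle.mono fun i hi => Eventually.of_forall hi) (by
        rw [lintegral_count, ENNReal.tsum_mul_left]
        exact ENNReal.mul_ne_top hK hg) (Eventually.of_forall hlim)
    simpa only [lintegral_count] using h1

/-- The limit of `s a(x) - x` as `x → ∞`, in the form `(2/s) ∑_z f_-(z) b(z)`, where `b(z)` is the
mean of `s a(w) - w` over the steps that lead from `z` out of the half-line. -/
noncomputable def exitConst (p a : ℤ → ℝ) (s : ℝ) : ℝ≥0∞ :=
  ∑' z, ENNReal.ofReal (2 / s * harm (fun y => p (-y)) z * bd p (fun w => s * a w - w) z)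

namespace PotentialKernel

variable {p a : ℤ → ℝ} {s : ℝ}

theorem exists_growth (h : PotentialKernel p a s) :
    ∃ K : ℝ, 0 < K ∧ ∀ w : ℤ, |s * a w - w| ≤ K * |(w : ℝ)| := by
  obtain ⟨L, hL, hgr, -⟩ := h.abs_le_growth
  have hs := h.pos
  refine ⟨s * L + 1, by positivity, fun w => (abs_sub _ _).trans ?_⟩
  rw [abs_mul, abs_of_pos hs]
  nlinarith [hgr w]

theorem exists_growth' (h : PotentialKernel p a s) :
    ∃ K : ℝ, ∀ w : ℤ, |s * a w - w| ≤ K * (1 + |(w : ℝ)|) := by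
  obtain ⟨K, hK, hw⟩ := h.exists_growth
  exact ⟨K, fun w => (hw w).trans (by gcongr; linarith)⟩

theorem exit_nonneg (h : PotentialKernel p a s) {w : ℤ} (hw : w ≤ 0) : 0 ≤ s * a w - w := by
  have h1 : (w : ℝ) ≤ 0 := by exact_mod_cast hw
  have := mul_nonneg h.pos.le (h.a_nonneg w)
  linarith

/-- On the half-line, `s a(x) - x` is the mean of `s a(w) - w` at the exit from the half-line. -/
theorem sub_eq_greenPot (h : PotentialKernel p a s) {x : ℤ} (hx : 1 ≤ x) :
    s * a x - x = greenPot p (bd p fun w => s * a w - w) x := by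
  obtain ⟨K, hK⟩ := h.exists_growth'
  have h1 := h.representation (F := fun w => s * a w - w) (ρ := fun _ => 0) (c := 0) hK
    summable_zero
    (fun x hx => ?_) ?_ hx
  · simpa using h1
  · have h2 : HasSum (fun y : ℤ => p y * ((x + y : ℤ) : ℝ)) (x : ℝ) := by
      refine hasSum_of_eq ((h.hasSum_one.mul_right (x : ℝ)).add h.hasSum_mean)
        (fun y => ?_) (by ring)
      push_cast
      ring
    refine hasSum_of_eq (((h.poisson x).mul_left s).sub h2) (fun y => by ring) ?_
    rw [if_neg (by omega)]
    ring
  · have h2 := (h.tendsto_div_top.const_mul s).sub_const 1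
    rw [mul_one_div_cancel h.pos.ne', sub_self] at h2
    refine h2.congr' ?_
    filter_upwards [eventually_gt_atTop 0] with x hx
    have : (x : ℝ) ≠ 0 := by exact_mod_cast hx.ne'
    field_simp

theorem tendsto_exitConst (h : PotentialKernel p a s) :
    Tendsto (fun x : ℤ => ENNReal.ofReal (s * a x - x)) atTop (𝓝 (exitConst p a s)) := by
  obtain ⟨K, hK⟩ := h.exists_growth'
  obtain ⟨C, hC, hg⟩ := h.exists_green_le
  have hs := h.pos
  set b := bd p fun w => s * a w - w with hb
  have hb0 : ∀ z, 0 ≤ b z := h.bd_nonneg fun w hw => h.exit_nonneg hw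
  have hbs : Summable b := h.summable_bd hK
  have hbz : ∀ z : ℤ, ¬ 1 ≤ z → b z = 0 := fun z hz => by simp [hb, bd, hz]
  have h1 : Tendsto (fun x : ℤ => ∑' z, ENNReal.ofReal (green p x z * b z)) atTop
      (𝓝 (exitConst p a s)) := by
    refine tendsto_tsum_of_le_mul (K := ENNReal.ofReal (C * s / 2)) ENNReal.ofReal_ne_top
      (Eventually.of_forall fun x z => ?_) fun z => ?_
    · rw [← ENNReal.ofReal_mul (by positivity)]
      refine ENNReal.ofReal_le_ofReal ?_
      by_cases hz : 1 ≤ z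
      · have h2 := h.reflect.le_harm hz
        have hz' : (0 : ℝ) < z := by exact_mod_cast (by omega : 0 < z)
        have h3 := (hg x z).2
        rw [abs_of_pos hz'] at h3
        have h4 : green p x z ≤ C * harm (fun y => p (-y)) z := h3.trans (by gcongr)
        calc green p x z * b z ≤ C * harm (fun y => p (-y)) z * b z := by
              have := hb0 z
              gcongr
          _ = _ := by field_simp; ring
      · rw [← hb, hbz z hz]
        simp
    · by_cases hz : 1 ≤ z
      · exact ENNReal.tendsto_ofReal ((h.tendsto_green hz).mul_const _)
      · simp only [hbz z hz, mul_zero]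
        rw [← hb, hbz z hz, mul_zero]
        exact tendsto_const_nhds
  refine h1.congr' ?_
  filter_upwards [eventually_ge_atTop 1] with x hx
  rw [h.sub_eq_greenPot hx, greenPot, ENNReal.ofReal_tsum_of_nonneg
    (fun z => mul_nonneg (green_nonneg p x z) (hb0 z)) (h.summable_green_mul hbs x)]

theorem exitConst_eq (h : PotentialKernel p a s) :
    exitConst p a s = ∑' z, ∑' y, ENNReal.ofReal (p y) * (if 1 ≤ z ∧ z + y < 0 then
      ENNReal.ofReal (2 / s * harm (fun y => p (-y)) z)
        * ENNReal.ofReal (s * a (z + y) - (z + y : ℤ)) else 0) := by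
  obtain ⟨K, hK⟩ := h.exists_growth'
  have hs := h.pos
  refine tsum_congr fun z => ?_
  rw [bd]
  by_cases hz : 1 ≤ z
  · rw [if_pos hz, ENNReal.ofReal_mul (mul_nonneg (by positivity) (h.reflect.harm_nonneg z)),
      ENNReal.ofReal_tsum_of_nonneg (fun y => mul_nonneg (h.nonneg y) ?_) (h.summable_bd_term hK z),
      ← ENNReal.tsum_mul_left]
    · refine tsum_congr fun y => ?_
      rw [ENNReal.ofReal_mul (h.nonneg y)]
      rcases lt_trichotomy (z + y) 0 with hzy | hzy | hzy
      · rw [if_pos hzy.le, if_pos ⟨hz, hzy⟩]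
        ring
      · simp [hzy, h.a_zero]
      · rw [if_neg (by omega), if_neg (by omega)]
        simp
    · split_ifs with hy
      · exact h.exit_nonneg hy
      · exact le_rfl
  · simp [hz]

theorem summable_entrance (h : PotentialKernel p a s) (w : ℤ) :
    Summable fun k => p k * (if k < w then harm (fun y => p (-y)) (w - k) else 0) := by
  obtain ⟨K, hK, hKz⟩ := h.reflect.exists_harm_le
  refine Summable.of_norm_bounded (h.summable_growth (K * (1 + |(w : ℝ)|)) 0) fun k => ?_
  rw [norm_mul, Real.norm_of_nonneg (h.nonneg k)]
  refine mul_le_mul_of_nonneg_left ?_ (h.nonneg k)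
  split_ifs with hk
  · rw [Real.norm_of_nonneg (h.reflect.harm_nonneg _), mul_assoc]
    refine (hKz _ (by omega)).trans ?_
    gcongr
    push_cast
    have := neg_abs_le (k : ℝ)
    have := le_abs_self (w : ℝ)
    rw [zero_add]
    nlinarith [abs_nonneg (k : ℝ), abs_nonneg (w : ℝ)]
  · rw [norm_zero]
    positivity

/-- The same constant, summed first over the starting points of the last step: this is the sum over
the exit points `w < 0` that is weighted by the entrance law of the negative half-line from
`+∞`. -/
theorem exitConst_eq_tsum_exit (h : PotentialKernel p a s) :
    exitConst p a s = ∑' w : Set.Iio (0 : ℤ), ENNReal.ofReal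
      ((2 / s * ∑' k, p k * (if k < (w : ℤ) then harm (fun y => p (-y)) (w - k) else 0))
        * (s * a w + |((w : ℤ) : ℝ)|)) := by
  have hs := h.pos
  rw [h.exitConst_eq]
  have h1 : ∀ z : ℤ, (∑' y, ENNReal.ofReal (p y) * (if 1 ≤ z ∧ z + y < 0 then
      ENNReal.ofReal (2 / s * harm (fun y => p (-y)) z)
        * ENNReal.ofReal (s * a (z + y) - (z + y : ℤ)) else 0))
      = ∑' w, ENNReal.ofReal (p (w - z)) * (if 1 ≤ z ∧ w < 0 then
      ENNReal.ofReal (2 / s * harm (fun y => p (-y)) z)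
        * ENNReal.ofReal (s * a w - w) else 0) := fun z => by
    rw [← (Equiv.addLeft z).tsum_eq fun w => ENNReal.ofReal (p (w - z)) * _]
    refine tsum_congr fun y => ?_
    simp
  simp only [h1]
  rw [ENNReal.tsum_comm, tsum_subtype (Set.Iio (0 : ℤ)) fun w => ENNReal.ofReal
      ((2 / s * ∑' k, p k * (if k < (w : ℤ) then harm (fun y => p (-y)) (w - k) else 0))
        * (s * a w + |((w : ℤ) : ℝ)|))]
  refine tsum_congr fun w => ?_
  by_cases hw : w < 0
  · rw [Set.indicator_of_mem (show w ∈ Set.Iio (0 : ℤ) from hw)]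
    have hw' : (w : ℝ) < 0 := by exact_mod_cast hw
    have hsum := h.summable_entrance w
    have hnn : ∀ k, 0 ≤ p k * (if k < w then harm (fun y => p (-y)) (w - k) else 0) := fun k => by
      refine mul_nonneg (h.nonneg k) ?_
      split_ifs
      · exact h.reflect.harm_nonneg _
      · exact le_rfl
    rw [abs_of_neg hw', ← sub_eq_add_neg, ENNReal.ofReal_mul (mul_nonneg (by positivity)
      (tsum_nonneg hnn)), ENNReal.ofReal_mul (by positivity),
      ENNReal.ofReal_tsum_of_nonneg hnn hsum, ← ENNReal.tsum_mul_left, ← ENNReal.tsum_mul_right,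
      ← (Equiv.subLeft w).tsum_eq]
    refine tsum_congr fun k => ?_
    rw [ENNReal.ofReal_mul (h.nonneg _)]
    simp only [Equiv.subLeft_apply, sub_sub_cancel]
    by_cases hk : k < w
    · rw [if_pos ⟨by omega, hw⟩, if_pos hk, ENNReal.ofReal_mul (by positivity)]
      ring
    · rw [if_neg (by omega), if_neg hk]
      simp
  · rw [Set.indicator_of_notMem (show w ∉ Set.Iio (0 : ℤ) from hw)]
    simp [hw]

theorem exitConst_pos_iff (h : PotentialKernel p a s) :
    0 < exitConst p a s ↔ ∃ k : ℤ, k ≤ -2 ∧ 0 < p k := by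
  have hs := h.pos
  rw [h.exitConst_eq, pos_iff_ne_zero, Ne, ENNReal.tsum_eq_zero]
  simp only [ENNReal.tsum_eq_zero]
  push Not
  constructor
  · rintro ⟨z, y, hzy⟩
    rw [mul_ne_zero_iff] at hzy
    obtain ⟨h1, h2⟩ := hzy
    have h3 : 1 ≤ z ∧ z + y < 0 := by
      by_contra hcon
      exact h2 (if_neg hcon)
    refine ⟨y, by omega, ?_⟩
    by_contra! hcon
    exact h1 (ENNReal.ofReal_of_nonpos hcon)
  · rintro ⟨k, hk, hpk⟩
    refine ⟨1, k, ?_⟩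
    rw [if_pos ⟨le_rfl, by omega⟩]
    have h1 := h.reflect.le_harm le_rfl
    have h2 : ((1 + k : ℤ) : ℝ) < 0 := by exact_mod_cast (by omega : 1 + k < 0)
    have h3 := mul_nonneg hs.le (h.a_nonneg (1 + k))
    refine mul_ne_zero (ENNReal.ofReal_pos.2 hpk).ne' (mul_ne_zero (ENNReal.ofReal_pos.2 ?_).ne'
      (ENNReal.ofReal_pos.2 ?_).ne')
    · have : (0 : ℝ) < harm (fun y => p (-y)) 1 := by
        refine lt_of_lt_of_le ?_ h1
        norm_num
      positivity
    · linarith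

theorem sum_range_mul_sub (k : ℝ) (n : ℕ) :
    ∑ i ∈ Finset.range n, ((i : ℝ) + 1) * (k - (i + 1))
      = k * (n * (n + 1) / 2) - n * (n + 1) * (2 * n + 1) / 6 := by
  induction n with
  | zero => simp
  | succ n ih =>
    rw [Finset.sum_range_succ, ih]
    push_cast
    ring

/-- The weights `z |w|`, summed over the steps `y = w - z` from `z ≥ 1` to `w ≤ -1`, add up to
`(|y|³ - |y|)/6`. -/
theorem tsum_exit_weight (n : ℕ) :
    ∑' z : ℤ, (if 1 ≤ z ∧ z + (-((n : ℤ) + 1)) < 0 then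
      ENNReal.ofReal (z * |((z + (-((n : ℤ) + 1)) : ℤ) : ℝ)|) else 0)
      = ENNReal.ofReal ((((n : ℝ) + 1) ^ 3 - (n + 1)) / 6) := by
  have h1 : ∑' z : ℤ, (if 1 ≤ z ∧ z + (-((n : ℤ) + 1)) < 0 then
      ENNReal.ofReal (z * |((z + (-((n : ℤ) + 1)) : ℤ) : ℝ)|) else 0)
      = ∑ i ∈ Finset.range n, ENNReal.ofReal (((i : ℝ) + 1) * ((n + 1) - (i + 1))) := by
    have hinj : Function.Injective fun i : ℕ => (i : ℤ) + 1 := fun i j hij => by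
      simp only at hij
      omega
    rw [← hinj.tsum_eq, tsum_eq_sum (s := Finset.range n)]
    · refine Finset.sum_congr rfl fun i hi => ?_
      rw [Finset.mem_range] at hi
      rw [if_pos (by omega)]
      have h2 : (i : ℝ) ≤ n := by exact_mod_cast hi.le
      push_cast
      rw [abs_of_nonpos (by linarith)]
      congr 1
      ring
    · intro i hi
      rw [Finset.mem_range] at hi
      rw [if_neg (by omega)]
    · intro z hz
      have h2 : 1 ≤ z := by
        by_contra hcon
        exact hz (if_neg fun hc => hcon hc.1)
      exact ⟨(z - 1).toNat, by simp only; omega⟩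
  rw [h1, ← ENNReal.ofReal_sum_of_nonneg fun i hi => ?_]
  · congr 1
    rw [sum_range_mul_sub]
    ring
  · rw [Finset.mem_range] at hi
    have h2 : (i : ℝ) ≤ n := by exact_mod_cast hi.le
    exact mul_nonneg (by positivity) (by linarith)

theorem exitConst_lt_top_iff (h : PotentialKernel p a s) :
    exitConst p a s < ∞ ↔
      ∑' y : ℤ, (if y < 0 then
        ENNReal.ofReal (p y) * ENNReal.ofReal (|(y : ℝ)| ^ 3) else 0) < ∞ := by
  obtain ⟨K, hK, hKz⟩ := h.reflect.exists_harm_le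
  obtain ⟨M, hM, hMw⟩ := h.exists_growth
  have hs := h.pos
  set W : ℤ → ℝ≥0∞ := fun y => ∑' z : ℤ, (if 1 ≤ z ∧ z + y < 0 then
      ENNReal.ofReal (z * |((z + y : ℤ) : ℝ)|) else 0) with hW
  have hWneg : ∀ n : ℕ, W (-((n : ℤ) + 1)) = ENNReal.ofReal ((((n : ℝ) + 1) ^ 3 - (n + 1)) / 6) :=
    tsum_exit_weight
  have hWnn : ∀ y : ℤ, 0 ≤ y → W y = 0 := fun y hy => by
    refine ENNReal.tsum_eq_zero.2 fun z => ?_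
    rw [if_neg (by omega)]
  have hcomm : ∑' z, ∑' y, ENNReal.ofReal (p y) * (if 1 ≤ z ∧ z + y < 0 then
      ENNReal.ofReal (z * |((z + y : ℤ) : ℝ)|) else 0) = ∑' y, ENNReal.ofReal (p y) * W y := by
    rw [ENNReal.tsum_comm]
    exact tsum_congr fun y => ENNReal.tsum_mul_left
  have hle1 : exitConst p a s
      ≤ ENNReal.ofReal (2 / s * K * M) * ∑' y, ENNReal.ofReal (p y) * W y := by
    rw [h.exitConst_eq, ← hcomm, ← ENNReal.tsum_mul_left]
    refine ENNReal.tsum_le_tsum fun z => ?_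
    rw [← ENNReal.tsum_mul_left]
    refine ENNReal.tsum_le_tsum fun y => ?_
    rw [mul_left_comm]
    gcongr
    split_ifs with hzy
    · have hz : (0 : ℝ) < z := by exact_mod_cast (by omega : 0 < z)
      rw [← ENNReal.ofReal_mul (mul_nonneg (by positivity) (h.reflect.harm_nonneg z)),
        ← ENNReal.ofReal_mul (by positivity)]
      refine ENNReal.ofReal_le_ofReal ?_
      have h1 := hKz z hzy.1
      have h2 := (le_abs_self _).trans (hMw (z + y))
      calc 2 / s * harm (fun y => p (-y)) z * (s * a (z + y) - (z + y : ℤ))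
          ≤ 2 / s * (K * z) * (M * |((z + y : ℤ) : ℝ)|) := by
            have := h.exit_nonneg hzy.2.le
            gcongr
        _ = _ := by ring
    · simp
  have hle2 : ENNReal.ofReal (2 / s) * ∑' y, ENNReal.ofReal (p y) * W y ≤ exitConst p a s := by
    rw [h.exitConst_eq, ← hcomm, ← ENNReal.tsum_mul_left]
    refine ENNReal.tsum_le_tsum fun z => ?_
    rw [← ENNReal.tsum_mul_left]
    refine ENNReal.tsum_le_tsum fun y => ?_
    rw [mul_left_comm]
    gcongr
    split_ifs with hzy
    · have hz : (0 : ℝ) < z := by exact_mod_cast (by omega : 0 < z)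
      rw [← ENNReal.ofReal_mul (mul_nonneg (by positivity) (h.reflect.harm_nonneg z)),
        ← ENNReal.ofReal_mul (by positivity)]
      refine ENNReal.ofReal_le_ofReal ?_
      have h1 := h.reflect.le_harm hzy.1
      have h2 : |((z + y : ℤ) : ℝ)| ≤ s * a (z + y) - (z + y : ℤ) := by
        have h3 : ((z + y : ℤ) : ℝ) ≤ 0 := by exact_mod_cast hzy.2.le
        rw [abs_of_nonpos h3]
        have := mul_nonneg hs.le (h.a_nonneg (z + y))
        linarith
      rw [← mul_assoc]
      have := h.reflect.harm_nonneg z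
      gcongr
    · simp
  have hiff : exitConst p a s < ∞ ↔ ∑' y, ENNReal.ofReal (p y) * W y < ∞ := by
    constructor
    · intro hlt
      by_contra hcon
      rw [not_lt_top_iff] at hcon
      rw [hcon, ENNReal.mul_top (ENNReal.ofReal_pos.2 (by positivity)).ne', top_le_iff] at hle2
      exact hlt.ne hle2
    · exact fun hlt => hle1.trans_lt (ENNReal.mul_lt_top ENNReal.ofReal_lt_top hlt)
  rw [hiff]
  have hcase : ∀ y : ℤ, y < 0 → ∃ n : ℕ, y = -((n : ℤ) + 1) := fun y hy =>
    ⟨(-y - 1).toNat, by omega⟩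
  have hcast : ∀ n : ℕ, |((-((n : ℤ) + 1) : ℤ) : ℝ)| = (n : ℝ) + 1 := fun n => by
    push_cast
    rw [abs_neg, abs_of_pos (by positivity)]
  constructor
  · intro hlt
    have hone : ∑' y, ENNReal.ofReal (p y) = 1 := by
      rw [← ENNReal.ofReal_tsum_of_nonneg h.nonneg h.hasSum_one.summable, h.hasSum_one.tsum_eq,
        ENNReal.ofReal_one]
    -- `k³ ≤ 8 (k³ - k)/6 + 1` for every integer `k ≥ 1`
    refine lt_of_le_of_lt (b := 8 * (∑' y, ENNReal.ofReal (p y) * W y)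
      + ∑' y, ENNReal.ofReal (p y)) ?_ ?_
    · rw [← ENNReal.tsum_mul_left, ← ENNReal.tsum_add]
      refine ENNReal.tsum_le_tsum fun y => ?_
      split_ifs with hy
      · obtain ⟨n, rfl⟩ := hcase y hy
        rw [hWneg, hcast, mul_left_comm, ← mul_add_one]
        gcongr
        rw [← ENNReal.ofReal_one, show (8 : ℝ≥0∞) = ENNReal.ofReal 8 by simp,
          ← ENNReal.ofReal_mul (by norm_num), ← ENNReal.ofReal_add _ zero_le_one]
        · refine ENNReal.ofReal_le_ofReal ?_
          rcases n with _ | n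
          · norm_num
          · push_cast
            have : (0 : ℝ) ≤ n := by positivity
            nlinarith [pow_nonneg this 3, pow_nonneg this 2]
        · have : (0 : ℝ) ≤ n := by positivity
          nlinarith [pow_nonneg this 3, pow_nonneg this 2]
      · exact zero_le
    · rw [hone]
      exact ENNReal.add_lt_top.2 ⟨ENNReal.mul_lt_top (by simp) hlt, by simp⟩
  · refine fun hlt => lt_of_le_of_lt (ENNReal.tsum_le_tsum fun y => ?_) hlt
    split_ifs with hy
    · obtain ⟨n, rfl⟩ := hcase y hy
      rw [hWneg, hcast]
      gcongr
      have : (0 : ℝ) ≤ n := by positivity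
      nlinarith [pow_nonneg this 3, pow_nonneg this 2]
    · rw [hWnn y (by omega), mul_zero]

end PotentialKernel

/-! ### The characteristic function of a centred kernel -/

/-- The character `t ↦ e^{ikt}`. -/
noncomputable def ech (k : ℤ) (t : ℝ) : ℂ := Complex.exp (((k : ℝ) * t : ℝ) * Complex.I)

@[simp] theorem norm_ech (k : ℤ) (t : ℝ) : ‖ech k t‖ = 1 := Complex.norm_exp_ofReal_mul_I _

@[simp] theorem ech_zero (t : ℝ) : ech 0 t = 1 := by simp [ech]

theorem ech_add (k l : ℤ) (t : ℝ) : ech (k + l) t = ech k t * ech l t := by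
  rw [ech, ech, ech, ← Complex.exp_add]
  push_cast
  ring_nf

theorem ech_re (k : ℤ) (t : ℝ) : (ech k t).re = Real.cos (k * t) := Complex.exp_ofReal_mul_I_re _

theorem ech_im (k : ℤ) (t : ℝ) : (ech k t).im = Real.sin (k * t) := Complex.exp_ofReal_mul_I_im _

theorem continuous_ech (k : ℤ) : Continuous (ech k) := by
  unfold ech
  fun_prop

theorem hasDerivAt_ech (k : ℤ) (t : ℝ) :
    HasDerivAt (ech k) ((k : ℂ) * Complex.I * ech k t) t := by
  have h1 : HasDerivAt (fun t : ℝ => (((k : ℝ) * t : ℝ) : ℂ) * Complex.I)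
      ((k : ℂ) * Complex.I) t := by
    have := (((hasDerivAt_id t).const_mul (k : ℝ)).ofReal_comp).mul_const Complex.I
    simpa using this
  have h2 := h1.cexp
  rw [mul_comm] at h2
  exact h2

theorem norm_ech_sub_one_le (k : ℤ) (t : ℝ) : ‖ech k t - 1‖ ≤ |(k : ℝ)| * |t| := by
  have := Real.norm_exp_I_mul_ofReal_sub_one_le (x := k * t)
  rw [Real.norm_eq_abs, abs_mul] at this
  rwa [ech, mul_comm]

theorem norm_ech_sub_linear_le (k : ℤ) (t : ℝ) :
    ‖ech k t - 1 - ((k * t : ℝ) : ℂ) * Complex.I‖ ≤ 2 * ((k : ℝ) * t) ^ 2 := by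
  have h0 : ‖((k * t : ℝ) : ℂ) * Complex.I‖ = |(k : ℝ) * t| := by simp
  rw [← sq_abs]
  rcases le_total |(k : ℝ) * t| 1 with h | h
  · have := Complex.norm_exp_sub_one_sub_id_le (x := ((k * t : ℝ) : ℂ) * Complex.I) (by rwa [h0])
    rw [h0] at this
    refine this.trans ?_
    nlinarith [sq_nonneg |(k : ℝ) * t|]
  · refine (norm_sub_le _ _).trans ?_
    rw [h0]
    have := norm_ech_sub_one_le k t
    rw [← abs_mul] at this
    nlinarith

theorem abs_sin_sub_le {u : ℝ} (hu : 0 ≤ u) : |Real.sin u - u| ≤ 4 * u ^ 3 * (1 + u ^ 2)⁻¹ := by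
  have h1 := Real.sin_le hu
  have h2 := Real.sin_ge_sub_cube hu
  have h3 := Real.neg_one_le_sin u
  rw [abs_of_nonpos (by linarith), ← div_eq_mul_inv, le_div_iff₀ (by positivity)]
  have h4 := pow_nonneg hu 3
  rcases le_total u 1 with h | h
  · calc -(Real.sin u - u) * (1 + u ^ 2) ≤ u ^ 3 / 6 * (1 + 1) := by
          gcongr
          · linarith
          · exact pow_le_one₀ hu h
      _ ≤ _ := by linarith
  · calc -(Real.sin u - u) * (1 + u ^ 2) ≤ (2 * u) * (u ^ 2 + u ^ 2) := by
          gcongr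
          · linarith
          · exact one_le_pow₀ h
      _ = _ := by ring

theorem tendsto_ech_second_order (k : ℤ) :
    Tendsto (fun t : ℝ => (ech k t - 1 - ((k * t : ℝ) : ℂ) * Complex.I) / (t : ℂ) ^ 2) (𝓝[>] 0)
      (𝓝 (-((k : ℂ) ^ 2 / 2))) := by
  rw [tendsto_iff_norm_sub_tendsto_zero]
  have h1 : Tendsto (fun t : ℝ => |(k : ℝ)| ^ 3 * t * Real.exp (|(k : ℝ)| * t)) (𝓝[>] 0) (𝓝 0) := by
    have : Continuous fun t : ℝ => |(k : ℝ)| ^ 3 * t * Real.exp (|(k : ℝ)| * t) := by fun_prop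
    have h2 := this.tendsto 0
    simp only [mul_zero, zero_mul] at h2
    exact h2.mono_left nhdsWithin_le_nhds
  refine squeeze_zero_norm' ?_ h1
  filter_upwards [self_mem_nhdsWithin] with t (ht : 0 < t)
  have h0 : ‖((k * t : ℝ) : ℂ) * Complex.I‖ = |(k : ℝ)| * t := by
    rw [norm_mul, Complex.norm_I, mul_one, Complex.norm_real, Real.norm_eq_abs, abs_mul,
      abs_of_pos ht]
  have h2 := Complex.norm_exp_sub_sum_le_norm_mul_exp (((k * t : ℝ) : ℂ) * Complex.I) 3
  rw [h0] at h2
  have ht' : (t : ℂ) ≠ 0 := by exact_mod_cast ht.ne'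
  have h3 : (ech k t - 1 - ((k * t : ℝ) : ℂ) * Complex.I) / (t : ℂ) ^ 2 - -((k : ℂ) ^ 2 / 2)
      = (Complex.exp (((k * t : ℝ) : ℂ) * Complex.I)
        - ∑ m ∈ Finset.range 3, (((k * t : ℝ) : ℂ) * Complex.I) ^ m / (m.factorial : ℂ))
          / (t : ℂ) ^ 2 := by
    simp only [Finset.sum_range_succ, Finset.sum_range_zero, ech]
    rw [eq_div_iff (pow_ne_zero 2 ht'), sub_mul, div_mul_cancel₀ _ (pow_ne_zero 2 ht')]
    simp only [mul_pow, Complex.I_sq]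
    push_cast
    norm_num
    ring
  rw [norm_norm, h3, norm_div, norm_pow, Complex.norm_real, Real.norm_of_nonneg ht.le,
    div_le_iff₀ (by positivity)]
  refine h2.trans (le_of_eq ?_)
  ring

/-- The characteristic function `φ(t) = ∑ p(k) e^{ikt}`. -/
noncomputable def cf (p : ℤ → ℝ) (t : ℝ) : ℂ := ∑' k, (p k : ℂ) * ech k t

/-- The derivative of the characteristic function. -/
noncomputable def cfDeriv (p : ℤ → ℝ) (t : ℝ) : ℂ :=
  ∑' k : ℤ, (p k : ℂ) * ((k : ℂ) * Complex.I * ech k t)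

namespace CenteredKernel

variable {p : ℤ → ℝ} {s : ℝ}

theorem norm_coe (h : CenteredKernel p s) (k : ℤ) : ‖(p k : ℂ)‖ = p k := by
  rw [Complex.norm_real, Real.norm_of_nonneg (h.nonneg k)]

theorem hasSum_cf (h : CenteredKernel p s) (t : ℝ) :
    HasSum (fun k => (p k : ℂ) * ech k t) (cf p t) :=
  (Summable.of_norm_bounded h.hasSum_one.summable fun k => by
    rw [norm_mul, norm_ech, h.norm_coe, mul_one]).hasSum

theorem norm_cf_le (h : CenteredKernel p s) (t : ℝ) : ‖cf p t‖ ≤ 1 :=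
  tsum_of_norm_bounded h.hasSum_one fun k => by
    rw [norm_mul, norm_ech, h.norm_coe, mul_one]

theorem continuous_cf (h : CenteredKernel p s) : Continuous (cf p) :=
  continuous_tsum (fun k => continuous_const.mul (continuous_ech k)) h.hasSum_one.summable
    fun k t => by rw [norm_mul, norm_ech, h.norm_coe, mul_one]

theorem summable_abs (h : CenteredKernel p s) : Summable fun k : ℤ => p k * |(k : ℝ)| :=
  Summable.of_nonneg_of_le (fun k => mul_nonneg (h.nonneg k) (abs_nonneg _))
    (fun k => mul_le_mul_of_nonneg_left (abs_le_sq_intCast k) (h.nonneg k)) h.hasSum_sq.summable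

theorem norm_cfDeriv_term (h : CenteredKernel p s) (k : ℤ) (t : ℝ) :
    ‖(p k : ℂ) * ((k : ℂ) * Complex.I * ech k t)‖ = p k * |(k : ℝ)| := by
  rw [norm_mul, norm_mul, norm_mul, norm_ech, h.norm_coe, Complex.norm_I, Complex.norm_intCast]
  ring

theorem continuous_cfDeriv (h : CenteredKernel p s) : Continuous (cfDeriv p) :=
  continuous_tsum (fun k => continuous_const.mul (continuous_const.mul (continuous_ech k)))
    h.summable_abs fun k t => (h.norm_cfDeriv_term k t).le

theorem hasDerivAt_cf (h : CenteredKernel p s) (t : ℝ) : HasDerivAt (cf p) (cfDeriv p t) t :=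
  hasDerivAt_tsum h.summable_abs (fun k t => (hasDerivAt_ech k t).const_mul (p k : ℂ))
    (fun k t => (h.norm_cfDeriv_term k t).le) (h.hasSum_cf 0).summable t

theorem hasSum_mean_complex (h : CenteredKernel p s) :
    HasSum (fun k : ℤ => (p k : ℂ) * (k : ℂ)) 0 := by
  have := Complex.hasSum_ofReal.2 h.hasSum_mean
  simpa using this

theorem norm_cfDeriv_le (h : CenteredKernel p s) (t : ℝ) : ‖cfDeriv p t‖ ≤ s * |t| := by
  have h1 : cfDeriv p t = ∑' k : ℤ, (p k : ℂ) * ((k : ℂ) * Complex.I * (ech k t - 1)) := by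
    have h2 := ((Summable.of_norm_bounded h.summable_abs
      fun k => (h.norm_cfDeriv_term k t).le).hasSum).sub
        (h.hasSum_mean_complex.mul_right Complex.I)
    rw [zero_mul, sub_zero] at h2
    rw [cfDeriv, ← h2.tsum_eq]
    exact tsum_congr fun k => by ring
  rw [h1]
  refine tsum_of_norm_bounded (h.hasSum_sq.mul_right |t|) fun k => ?_
  rw [norm_mul, norm_mul, norm_mul, h.norm_coe, Complex.norm_I, Complex.norm_intCast, mul_one,
    ← sq_abs, pow_two, mul_assoc (p k), mul_assoc |(k : ℝ)|]
  have := h.nonneg k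
  gcongr
  exact norm_ech_sub_one_le k t

theorem hasSum_cf_sub_one (h : CenteredKernel p s) (t : ℝ) :
    HasSum (fun k : ℤ => (p k : ℂ) * (ech k t - 1 - ((k * t : ℝ) : ℂ) * Complex.I))
      (cf p t - 1) := by
  have h1 : HasSum (fun k : ℤ => (p k : ℂ)) 1 := by
    have := Complex.hasSum_ofReal.2 h.hasSum_one
    simpa using this
  have h2 := ((h.hasSum_cf t).sub h1).sub ((h.hasSum_mean_complex.mul_right ((t : ℂ) * Complex.I)))
  rw [zero_mul, sub_zero] at h2
  refine (congrArg (HasSum · _) (funext fun k => ?_)).mpr h2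
  push_cast
  ring

/-- Second-order expansion of the characteristic function at the origin. -/
theorem tendsto_one_sub_cf_div (h : CenteredKernel p s) :
    Tendsto (fun t : ℝ => (1 - cf p t) / (t : ℂ) ^ 2) (𝓝[>] 0) (𝓝 ((s : ℂ) / 2)) := by
  have h1 : Tendsto (fun t : ℝ => ∑' k : ℤ, (p k : ℂ)
      * ((ech k t - 1 - ((k * t : ℝ) : ℂ) * Complex.I) / (t : ℂ) ^ 2)) (𝓝[>] 0)
      (𝓝 (∑' k : ℤ, (p k : ℂ) * (-((k : ℂ) ^ 2 / 2)))) := by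
    refine tendsto_tsum_of_dominated_convergence (h.hasSum_sq.summable.mul_left 2)
      (fun k => (tendsto_ech_second_order k).const_mul _) ?_
    filter_upwards [self_mem_nhdsWithin] with t (ht : 0 < t) k
    rw [norm_mul, h.norm_coe, norm_div, norm_pow, Complex.norm_real, Real.norm_of_nonneg ht.le]
    have h2 : ‖ech k t - 1 - ((k * t : ℝ) : ℂ) * Complex.I‖ / t ^ 2 ≤ 2 * (k : ℝ) ^ 2 := by
      rw [div_le_iff₀ (by positivity)]
      refine (norm_ech_sub_linear_le k t).trans (le_of_eq (by ring))
    calc _ ≤ p k * (2 * (k : ℝ) ^ 2) := mul_le_mul_of_nonneg_left h2 (h.nonneg k)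
      _ = _ := by ring
  have h3 : ∑' k : ℤ, (p k : ℂ) * (-((k : ℂ) ^ 2 / 2)) = -((s : ℂ) / 2) := by
    have := ((Complex.hasSum_ofReal.2 h.hasSum_sq).div_const 2).neg
    rw [← this.tsum_eq]
    refine tsum_congr fun k => ?_
    push_cast
    ring
  rw [h3] at h1
  have h4 := h1.neg
  rw [neg_neg] at h4
  refine h4.congr fun t => ?_
  have h5 := (h.hasSum_cf_sub_one t).div_const ((t : ℂ) ^ 2)
  rw [← neg_sub (cf p t), neg_div, ← h5.tsum_eq]
  congr 1
  exact tsum_congr fun k => by ring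

theorem abs_im_cf_le (h : CenteredKernel p s) {t : ℝ} (ht : 0 < t) :
    ENNReal.ofReal (|(cf p t).im| / t ^ 3)
      ≤ ∑' k : ℤ, ENNReal.ofReal (p k * (4 * |(k : ℝ)| ^ 3 * (1 + (|(k : ℝ)| * t) ^ 2)⁻¹)) := by
  have h1 := (Complex.hasSum_iff _ _).1 (h.hasSum_cf_sub_one t) |>.2
  have h2 : HasSum (fun k : ℤ => p k * (Real.sin (k * t) - k * t)) (cf p t).im := by
    refine hasSum_of_eq h1 (fun k => ?_) (by simp)
    simp [ech_im]
  have h3 : ∀ k : ℤ, |Real.sin (k * t) - k * t|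
      ≤ 4 * (|(k : ℝ)| * t) ^ 3 * (1 + (|(k : ℝ)| * t) ^ 2)⁻¹ := by
    intro k
    have h4 := abs_sin_sub_le (u := |(k : ℝ)| * t) (by positivity)
    rcases abs_cases (k : ℝ) with ⟨hk, -⟩ | ⟨hk, -⟩
    · rw [hk] at h4 ⊢
      exact h4
    · rw [hk] at h4 ⊢
      rw [neg_mul, Real.sin_neg, ← abs_neg] at h4
      rw [neg_mul]
      convert h4 using 2
      ring
  have h5 : ∀ k : ℤ, |p k * (Real.sin (k * t) - k * t)| / t ^ 3
      ≤ p k * (4 * |(k : ℝ)| ^ 3 * (1 + (|(k : ℝ)| * t) ^ 2)⁻¹) := by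
    intro k
    rw [div_le_iff₀ (by positivity), abs_mul, abs_of_nonneg (h.nonneg k)]
    refine (mul_le_mul_of_nonneg_left (h3 k) (h.nonneg k)).trans (le_of_eq (by ring))
  calc ENNReal.ofReal (|(cf p t).im| / t ^ 3)
      ≤ ENNReal.ofReal (∑' k : ℤ, |p k * (Real.sin (k * t) - k * t)| / t ^ 3) := by
        refine ENNReal.ofReal_le_ofReal ?_
        rw [tsum_div_const, ← h2.tsum_eq]
        gcongr
        exact norm_tsum_le_tsum_norm h2.summable.norm
    _ = ∑' k : ℤ, ENNReal.ofReal (|p k * (Real.sin (k * t) - k * t)| / t ^ 3) :=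
        ENNReal.ofReal_tsum_of_nonneg (fun k => by positivity) (h2.summable.norm.div_const _)
    _ ≤ _ := ENNReal.tsum_le_tsum fun k => ENNReal.ofReal_le_ofReal (h5 k)

/-- The imaginary part of the characteristic function is integrable against `t⁻³`: a step `k`
contributes `∫ |sin kt - kt| t⁻³ dt`, which is of order `k²`. -/
theorem integrableOn_im_cf_div (h : CenteredKernel p s) :
    IntegrableOn (fun t => |(cf p t).im| / t ^ 3) (Set.Ioc 0 Real.pi) := by
  refine ⟨?_, ?_⟩
  · refine Measurable.aestronglyMeasurable ?_
    have := h.continuous_cf.measurable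
    fun_prop
  · rw [hasFiniteIntegral_iff_ofReal]
    · have hint : ∀ k : ℤ, ∫⁻ t : ℝ,
          ENNReal.ofReal (p k * (4 * |(k : ℝ)| ^ 3 * (1 + (|(k : ℝ)| * t) ^ 2)⁻¹))
          ≤ ENNReal.ofReal (p k * (k : ℝ) ^ 2 * (4 * Real.pi)) := by
        intro k
        rcases eq_or_ne k 0 with rfl | hk
        · simp
        have hk' : |(k : ℝ)| ≠ 0 := by simpa using hk
        have hi : Integrable fun t : ℝ =>
            p k * (4 * |(k : ℝ)| ^ 3 * (1 + (|(k : ℝ)| * t) ^ 2)⁻¹) := by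
          have := (integrable_inv_one_add_sq.comp_mul_left' hk').const_mul
            (p k * (4 * |(k : ℝ)| ^ 3))
          simpa [mul_assoc] using this
        rw [← ofReal_integral_eq_lintegral_ofReal hi (Eventually.of_forall fun t => by
          have := h.nonneg k
          simp only [Pi.zero_apply]
          positivity)]
        refine ENNReal.ofReal_le_ofReal (le_of_eq ?_)
        simp only [← mul_assoc]
        rw [integral_const_mul, Measure.integral_comp_mul_left (fun u => (1 + u ^ 2)⁻¹),
          integral_univ_inv_one_add_sq, abs_inv, abs_abs, smul_eq_mul, ← sq_abs (k : ℝ)]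
        field_simp
      calc ∫⁻ t in Set.Ioc 0 Real.pi, ENNReal.ofReal (|(cf p t).im| / t ^ 3)
          ≤ ∫⁻ t in Set.Ioc 0 Real.pi, ∑' k : ℤ,
            ENNReal.ofReal (p k * (4 * |(k : ℝ)| ^ 3 * (1 + (|(k : ℝ)| * t) ^ 2)⁻¹)) :=
            setLIntegral_mono' measurableSet_Ioc fun t ht => h.abs_im_cf_le ht.1
        _ ≤ ∫⁻ t, ∑' k : ℤ,
            ENNReal.ofReal (p k * (4 * |(k : ℝ)| ^ 3 * (1 + (|(k : ℝ)| * t) ^ 2)⁻¹)) :=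
            setLIntegral_le_lintegral _ _
        _ = ∑' k : ℤ, ∫⁻ t,
            ENNReal.ofReal (p k * (4 * |(k : ℝ)| ^ 3 * (1 + (|(k : ℝ)| * t) ^ 2)⁻¹)) :=
            lintegral_tsum fun k => by fun_prop
        _ ≤ ∑' k : ℤ, ENNReal.ofReal (p k * (k : ℝ) ^ 2 * (4 * Real.pi)) :=
            ENNReal.tsum_le_tsum hint
        _ < ∞ := (h.hasSum_sq.summable.mul_right (4 * Real.pi)).tsum_ofReal_lt_top
    · filter_upwards [ae_restrict_mem measurableSet_Ioc] with t ht
      have := ht.1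
      simp only [Pi.zero_apply]
      positivity

end CenteredKernel

/-! ### Fourier representation of the potential function -/

/-- The `n`-step transition probabilities of the walk with step distribution `p`. -/
noncomputable def stepP (p : ℤ → ℝ) : ℕ → ℤ → ℝ
  | 0, x => if x = 0 then 1 else 0
  | n + 1, x => ∑' y, p y * stepP p n (x - y)

/-- The partial sums of the series of the potential function. -/
noncomputable def potPartial (p : ℤ → ℝ) (N : ℕ) (x : ℤ) : ℝ :=
  ∑ n ∈ Finset.range N, (stepP p n 0 - stepP p n (-x))

/-- The kernel `(1 - e^{ixt})/(1 - φ(t))` of the Fourier representation. Its real part is integrable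
on `(0, π]`, although its imaginary part is of order `1/t` at the origin. -/
noncomputable def potFourier (p : ℤ → ℝ) (x : ℤ) (t : ℝ) : ℂ := (1 - ech x t) / (1 - cf p t)

/-- The potential function, as a Fourier integral. -/
noncomputable def pot (p : ℤ → ℝ) (x : ℤ) : ℝ :=
  Real.pi⁻¹ * ∫ t in (0 : ℝ)..Real.pi, (potFourier p x t).re

theorem integral_cos_int_mul (x : ℤ) :
    Real.pi⁻¹ * ∫ t in (0 : ℝ)..Real.pi, Real.cos (x * t) = if x = 0 then 1 else 0 := by
  have := Real.pi_pos.ne'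
  split_ifs with hx
  · simp [hx, this]
  · have hx' : (x : ℝ) ≠ 0 := by exact_mod_cast hx
    rw [intervalIntegral.integral_comp_mul_left _ hx']
    simp [Real.sin_int_mul_pi]

theorem abs_im_pow_le {z : ℂ} (hz : ‖z‖ ≤ 1) (n : ℕ) :
    |(z ^ n).im| * (1 - ‖z‖) ≤ |z.im| * (1 - ‖z‖ ^ n) := by
  induction n with
  | zero => simp
  | succ n ih =>
    have h0 := norm_nonneg z
    have h1 : |(z ^ (n + 1)).im| ≤ |(z ^ n).im| * ‖z‖ + ‖z‖ ^ n * |z.im| := by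
      rw [pow_succ, Complex.mul_im, add_comm]
      refine (abs_add_le _ _).trans ?_
      rw [abs_mul, abs_mul]
      have h2 : |(z ^ n).re| ≤ ‖z‖ ^ n := by
        rw [← norm_pow]
        exact Complex.abs_re_le_norm _
      have h3 := Complex.abs_re_le_norm z
      gcongr
    have h4 : ‖z‖ ^ n ≤ 1 := pow_le_one₀ h0 hz
    have h5 := abs_nonneg z.im
    have h6 : |(z ^ n).im| * (1 - ‖z‖) * ‖z‖ ≤ |z.im| * (1 - ‖z‖ ^ n) * ‖z‖ := by gcongr
    have h7 := mul_le_mul_of_nonneg_right h1 (sub_nonneg.2 hz)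
    have h8 : 0 ≤ |z.im| * ((1 - ‖z‖ ^ n) * (1 - ‖z‖)) :=
      mul_nonneg h5 (mul_nonneg (sub_nonneg.2 h4) (sub_nonneg.2 hz))
    rw [pow_succ ‖z‖]
    linarith

theorem measurable_ech (x : ℤ) : Measurable (ech x) := (continuous_ech x).measurable

namespace CenteredKernel

variable {p : ℤ → ℝ} {s : ℝ}

theorem stepP_mem (h : CenteredKernel p s) (n : ℕ) (x : ℤ) : 0 ≤ stepP p n x ∧ stepP p n x ≤ 1 := by
  induction n generalizing x with
  | zero =>
    rw [stepP]
    split_ifs <;> norm_num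
  | succ n ih =>
    rw [stepP]
    refine ⟨tsum_nonneg fun y => mul_nonneg (h.nonneg y) (ih _).1, ?_⟩
    have hle : ∀ y, p y * stepP p n (x - y) ≤ p y := fun y =>
      mul_le_of_le_one_right (h.nonneg y) (ih _).2
    rw [← h.hasSum_one.tsum_eq]
    exact Summable.tsum_le_tsum hle (Summable.of_nonneg_of_le
      (fun y => mul_nonneg (h.nonneg y) (ih _).1) hle h.hasSum_one.summable) h.hasSum_one.summable

theorem hasSum_stepP (h : CenteredKernel p s) (n : ℕ) (x : ℤ) :
    HasSum (fun y => p y * stepP p n (x - y)) (stepP p (n + 1) x) :=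
  (Summable.of_nonneg_of_le (fun y => mul_nonneg (h.nonneg y) (h.stepP_mem n _).1)
    (fun y => mul_le_of_le_one_right (h.nonneg y) (h.stepP_mem n _).2) h.hasSum_one.summable).hasSum

/-- Fourier inversion for the transition probabilities. -/
theorem stepP_eq_integral (h : CenteredKernel p s) (n : ℕ) (x : ℤ) :
    stepP p n x = Real.pi⁻¹ * ∫ t in (0 : ℝ)..Real.pi, (cf p t ^ n * ech (-x) t).re := by
  induction n generalizing x with
  | zero =>
    have h1 := integral_cos_int_mul (-x)
    simp only [pow_zero, one_mul, ech_re]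
    rw [h1, stepP]
    simp
  | succ n ih =>
    have h1 : HasSum (fun y => ∫ t in (0 : ℝ)..Real.pi, p y * (cf p t ^ n * ech (-(x - y)) t).re)
        (∫ t in (0 : ℝ)..Real.pi, (cf p t ^ (n + 1) * ech (-x) t).re) := by
      refine intervalIntegral.hasSum_integral_of_dominated_convergence (fun y _ => p y)
        (fun y => ?_) (fun y => Eventually.of_forall fun t _ => ?_)
        (Eventually.of_forall fun t _ => h.hasSum_one.summable) ?_
        (Eventually.of_forall fun t _ => ?_)
      · have := h.continuous_cf
        have h2 := continuous_ech (-(x - y))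
        exact Continuous.aestronglyMeasurable (by fun_prop)
      · rw [norm_mul, Real.norm_of_nonneg (h.nonneg y)]
        refine mul_le_of_le_one_right (h.nonneg y) ((Complex.abs_re_le_norm _).trans ?_)
        rw [norm_mul, norm_ech, mul_one, norm_pow]
        exact pow_le_one₀ (norm_nonneg _) (h.norm_cf_le t)
      · exact intervalIntegrable_const
      · have h2 := ((Complex.hasSum_iff _ _).1
          ((h.hasSum_cf t).mul_left (cf p t ^ n * ech (-x) t))).1
        refine hasSum_of_eq h2 (fun y => ?_) ?_
        · rw [← Complex.re_ofReal_mul, show -(x - y) = -x + y by ring, ech_add]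
          congr 1
          ring
        · congr 1
          ring
    rw [stepP, ← h1.tsum_eq, ← tsum_mul_left]
    refine tsum_congr fun y => ?_
    rw [ih, intervalIntegral.integral_const_mul]
    ring

theorem potPartial_eq_integral (h : CenteredKernel p s)
    (hap : ∀ t ∈ Set.Ioc 0 Real.pi, cf p t ≠ 1) (N : ℕ) (x : ℤ) :
    potPartial p N x
      = Real.pi⁻¹ * ∫ t in (0 : ℝ)..Real.pi, ((1 - cf p t ^ N) * potFourier p x t).re := by
  have hc := h.continuous_cf
  have h1 : ∀ n : ℕ, stepP p n 0 - stepP p n (-x)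
      = Real.pi⁻¹ * ∫ t in (0 : ℝ)..Real.pi, (cf p t ^ n * (1 - ech x t)).re := by
    intro n
    have h2 := continuous_ech (- -x)
    have h3 := continuous_ech (-0)
    rw [h.stepP_eq_integral, h.stepP_eq_integral, ← mul_sub, ← intervalIntegral.integral_sub]
    · congr 1
      refine intervalIntegral.integral_congr fun t _ => ?_
      simp only [neg_neg, neg_zero, ech_zero]
      rw [← Complex.sub_re, ← mul_sub]
    · exact Continuous.intervalIntegrable (by fun_prop) _ _
    · exact Continuous.intervalIntegrable (by fun_prop) _ _
  have h2 := continuous_ech x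
  simp only [potPartial, h1]
  rw [← Finset.mul_sum, ← intervalIntegral.integral_finsetSum
    fun n _ => Continuous.intervalIntegrable (by fun_prop) _ _]
  congr 1
  refine intervalIntegral.integral_congr_ae (Eventually.of_forall fun t ht => ?_)
  rw [Set.uIoc_of_le Real.pi_pos.le] at ht
  have h3 : 1 - cf p t ≠ 0 := sub_ne_zero.2 (hap t ht).symm
  rw [← Complex.re_sum, ← Finset.sum_mul, ← mul_neg_geom_sum, potFourier]
  congr 1
  field_simp

theorem eventually_norm_sub_lt (h : CenteredKernel p s) :
    ∃ δ > 0, ∀ t, 0 < t → t < δ → ‖1 - cf p t - (s : ℂ) / 2 * (t : ℂ) ^ 2‖ ≤ s / 4 * t ^ 2 := by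
  have hs := h.pos
  have h1 := (Metric.tendsto_nhds.1 h.tendsto_one_sub_cf_div) (s / 4) (by positivity)
  rw [eventually_nhdsWithin_iff, Metric.eventually_nhds_iff] at h1
  obtain ⟨δ, hδ, hδ'⟩ := h1
  refine ⟨δ, hδ, fun t ht htδ => ?_⟩
  have h2 := hδ' (y := t) (by simpa [abs_of_pos ht] using htδ) ht
  have ht' : (t : ℂ) ≠ 0 := by exact_mod_cast ht.ne'
  rw [dist_eq_norm] at h2
  have h3 : 1 - cf p t - (s : ℂ) / 2 * (t : ℂ) ^ 2
      = ((1 - cf p t) / (t : ℂ) ^ 2 - (s : ℂ) / 2) * (t : ℂ) ^ 2 := by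
    field_simp
  rw [h3, norm_mul, norm_pow, Complex.norm_real, Real.norm_of_nonneg ht.le]
  gcongr

theorem exists_le_norm_one_sub_cf (h : CenteredKernel p s)
    (hap : ∀ t ∈ Set.Ioc 0 Real.pi, cf p t ≠ 1) :
    ∃ c > 0, ∀ t ∈ Set.Ioc 0 Real.pi, c * t ^ 2 ≤ ‖1 - cf p t‖ := by
  have hs := h.pos
  obtain ⟨δ, hδ, hsmall⟩ := h.eventually_norm_sub_lt
  have hc : ContinuousOn (fun t => ‖1 - cf p t‖) (Set.Icc (min δ Real.pi) Real.pi) := by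
    have := h.continuous_cf
    exact Continuous.continuousOn (by fun_prop)
  obtain ⟨t₀, ht₀, hmin⟩ := isCompact_Icc.exists_isMinOn
    ⟨Real.pi, Set.right_mem_Icc.2 (min_le_right _ _)⟩ hc
  have hm : 0 < ‖1 - cf p t₀‖ := norm_pos_iff.2 (sub_ne_zero.2
    (hap t₀ ⟨(lt_min hδ Real.pi_pos).trans_le ht₀.1, ht₀.2⟩).symm)
  have hpi := Real.pi_pos
  refine ⟨min (s / 4) (‖1 - cf p t₀‖ / Real.pi ^ 2), by positivity, fun t ht => ?_⟩
  rcases lt_or_ge t δ with htδ | htδ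
  · have h1 := hsmall t ht.1 htδ
    have h2 := norm_sub_norm_le ((s : ℂ) / 2 * (t : ℂ) ^ 2) (1 - cf p t)
    rw [norm_sub_rev ((s : ℂ) / 2 * (t : ℂ) ^ 2)] at h2
    have h3 : ‖(s : ℂ) / 2 * (t : ℂ) ^ 2‖ = s / 2 * t ^ 2 := by
      rw [norm_mul, norm_div, norm_pow, Complex.norm_real, Complex.norm_real,
        Real.norm_of_nonneg ht.1.le, Real.norm_of_nonneg hs.le]
      simp
    have h4 : min (s / 4) (‖1 - cf p t₀‖ / Real.pi ^ 2) * t ^ 2 ≤ s / 4 * t ^ 2 := by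
      gcongr
      exact min_le_left _ _
    rw [h3] at h2
    linarith
  · have h1 : ‖1 - cf p t₀‖ ≤ ‖1 - cf p t‖ := hmin ⟨(min_le_left _ _).trans htδ, ht.2⟩
    refine le_trans ?_ h1
    calc _ ≤ ‖1 - cf p t₀‖ / Real.pi ^ 2 * Real.pi ^ 2 := by
          have := ht.1.le
          have := ht.2
          gcongr
          exact min_le_right _ _
      _ = _ := by field_simp

theorem exists_norm_cf_le (h : CenteredKernel p s) :
    ∃ δ > 0, ∃ c > 0, ∀ t, 0 < t → t < δ → c * t ^ 2 ≤ 1 - ‖cf p t‖ := by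
  have hs := h.pos
  obtain ⟨δ, hδ, hsmall⟩ := h.eventually_norm_sub_lt
  refine ⟨min δ (Real.sqrt (2 / s)), lt_min hδ (Real.sqrt_pos.2 (by positivity)), s / 4,
    by positivity, fun t ht htδ => ?_⟩
  have h1 := hsmall t ht (htδ.trans_le (min_le_left _ _))
  have h2 : t ^ 2 < 2 / s := (Real.lt_sqrt ht.le).1 (htδ.trans_le (min_le_right _ _))
  rw [lt_div_iff₀ hs] at h2
  have h3 : ‖1 - (s : ℂ) / 2 * (t : ℂ) ^ 2‖ = 1 - s / 2 * t ^ 2 := by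
    have : 1 - (s : ℂ) / 2 * (t : ℂ) ^ 2 = ((1 - s / 2 * t ^ 2 : ℝ) : ℂ) := by push_cast; ring
    rw [this, Complex.norm_real, Real.norm_of_nonneg (by linarith)]
  have h4 := norm_sub_norm_le (cf p t) (1 - (s : ℂ) / 2 * (t : ℂ) ^ 2)
  rw [h3, norm_sub_rev, show 1 - (s : ℂ) / 2 * (t : ℂ) ^ 2 - cf p t
    = 1 - cf p t - (s : ℂ) / 2 * (t : ℂ) ^ 2 by ring] at h4
  linarith

theorem ech_eq_of_norm_cf (h : CenteredKernel p s) {t : ℝ} (ht : ‖cf p t‖ = 1) {k : ℤ}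
    (hk : 0 < p k) : ech k t = cf p t := by
  set c := cf p t with hc
  have h1 : (starRingEnd ℂ) c * c = 1 := by
    rw [← Complex.normSq_eq_conj_mul_self, Complex.normSq_eq_norm_sq, ht]
    simp
  have h2 : HasSum (fun k => p k * (1 - ((starRingEnd ℂ) c * ech k t).re)) 0 := by
    have h3 := ((Complex.hasSum_iff _ _).1 ((h.hasSum_cf t).mul_left ((starRingEnd ℂ) c))).1
    refine hasSum_of_eq (h.hasSum_one.sub h3) (fun k => ?_) ?_
    · rw [mul_sub, mul_one, ← Complex.re_ofReal_mul]
      congr 2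
      ring
    · rw [← hc, h1]
      simp
  have h4 : ∀ k, ‖(starRingEnd ℂ) c * ech k t‖ = 1 := fun k => by
    rw [norm_mul, norm_ech, Complex.norm_conj, ht, mul_one]
  have h5 := congrFun ((hasSum_zero_iff_of_nonneg fun k => mul_nonneg (h.nonneg k)
    (sub_nonneg.2 ((Complex.re_le_norm _).trans (h4 k).le))).1 h2) k
  have h6 : ((starRingEnd ℂ) c * ech k t).re = 1 := by
    rcases mul_eq_zero.1 h5 with h7 | h7
    · exact absurd h7 hk.ne'
    · linarith
  have h7 : (starRingEnd ℂ) c * ech k t = 1 := by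
    have h8 := Complex.sq_norm_sub_sq_re ((starRingEnd ℂ) c * ech k t)
    rw [h4, h6] at h8
    refine Complex.ext h6 ?_
    have h9 : ((starRingEnd ℂ) c * ech k t).im ^ 2 = 0 := by linarith
    simpa using h9
  calc ech k t = c * ((starRingEnd ℂ) c * ech k t) := by
        rw [← mul_assoc, mul_comm c, h1, one_mul]
    _ = c := by rw [h7, mul_one]

/-- `|φ| = 1` at countably many points only: there the characters of two distinct steps agree. -/
theorem ae_norm_cf_lt_one (h : CenteredKernel p s) : ∀ᵐ t : ℝ, ‖cf p t‖ < 1 := by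
  obtain ⟨k, hk, hpk⟩ := h.exists_neg
  obtain ⟨l, hl, hpl⟩ := h.reflect.exists_neg
  have hd : ((k - -l : ℤ) : ℝ) ≠ 0 := by
    have : k - -l ≠ 0 := by omega
    exact_mod_cast this
  have hsub : {t : ℝ | ¬ ‖cf p t‖ < 1}
      ⊆ Set.range fun n : ℤ => n * (2 * Real.pi) / ((k - -l : ℤ) : ℝ) := by
    intro t (ht : ¬ ‖cf p t‖ < 1)
    have h1 : ‖cf p t‖ = 1 := le_antisymm (h.norm_cf_le t) (not_lt.1 ht)
    have h2 : ech (k - -l) t = 1 := by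
      have h3 := ech_add (k - -l) (-l) t
      rw [sub_add_cancel, h.ech_eq_of_norm_cf h1 hpk, h.ech_eq_of_norm_cf h1 hpl] at h3
      have h4 : cf p t ≠ 0 := by
        rw [← norm_pos_iff, h1]
        exact one_pos
      exact (mul_eq_right₀ h4).1 h3.symm
    rw [ech, Complex.exp_eq_one_iff] at h2
    obtain ⟨n, hn⟩ := h2
    refine ⟨n, ?_⟩
    have h5 : (((k - -l : ℤ) : ℝ) * t : ℝ) = n * (2 * Real.pi) := by
      have h6 := mul_right_cancel₀ Complex.I_ne_zero
        (hn.trans (by ring : _ = ((n : ℂ) * (2 * Real.pi)) * Complex.I))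
      exact_mod_cast h6
    rw [div_eq_iff hd, ← h5]
    ring
  exact ((Set.countable_range _).mono hsub).measure_zero _

theorem tendsto_cf_pow (h : CenteredKernel p s) :
    ∀ᵐ t : ℝ, Tendsto (fun N : ℕ => cf p t ^ N) atTop (𝓝 0) := by
  filter_upwards [h.ae_norm_cf_lt_one] with t ht
  exact tendsto_pow_atTop_nhds_zero_of_norm_lt_one ht

theorem tendsto_stepP (h : CenteredKernel p s) (x : ℤ) :
    Tendsto (fun N => stepP p N x) atTop (𝓝 0) := by
  have hc := h.continuous_cf
  have he := continuous_ech (-x)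
  have h1 : Tendsto (fun N : ℕ => ∫ t in (0 : ℝ)..Real.pi, (cf p t ^ N * ech (-x) t).re) atTop
      (𝓝 (∫ _ in (0 : ℝ)..Real.pi, (0 : ℝ))) := by
    refine intervalIntegral.tendsto_integral_filter_of_dominated_convergence (fun _ => 1)
      (Eventually.of_forall fun N => Continuous.aestronglyMeasurable (by fun_prop))
      (Eventually.of_forall fun N => Eventually.of_forall fun t _ => ?_)
      intervalIntegrable_const ?_
    · refine (Complex.abs_re_le_norm _).trans ?_
      rw [norm_mul, norm_ech, mul_one, norm_pow]
      exact pow_le_one₀ (norm_nonneg _) (h.norm_cf_le t)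
    · filter_upwards [h.tendsto_cf_pow] with t ht _
      have := (Complex.continuous_re.tendsto _).comp (ht.mul_const (ech (-x) t))
      simpa [Function.comp_def, -Complex.mul_re] using this
  have h2 := h1.const_mul Real.pi⁻¹
  simp only [intervalIntegral.integral_zero, mul_zero] at h2
  exact h2.congr fun N => (h.stepP_eq_integral N x).symm

theorem norm_potFourier_le {c : ℝ} (hc : 0 < c) {t : ℝ} (ht : 0 < t)
    (hct : c * t ^ 2 ≤ ‖1 - cf p t‖) (x : ℤ) : ‖potFourier p x t‖ ≤ |(x : ℝ)| / (c * t) := by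
  have h1 := norm_ech_sub_one_le x t
  rw [norm_sub_rev, abs_of_pos ht] at h1
  rw [potFourier, norm_div]
  calc _ ≤ |(x : ℝ)| * t / (c * t ^ 2) := by gcongr
    _ = _ := by field_simp

theorem abs_re_potFourier_le {c : ℝ} (hc : 0 < c) {t : ℝ} (ht : 0 < t)
    (hct : c * t ^ 2 ≤ ‖1 - cf p t‖) (x : ℤ) :
    |(potFourier p x t).re| ≤ (x : ℝ) ^ 2 * (1 / (2 * c) + |(cf p t).im| / t ^ 3 / c ^ 2) := by
  have hpos : 0 < c * t ^ 2 := by positivity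
  have hw := hpos.trans_le hct
  rw [potFourier, Complex.div_re, Complex.normSq_eq_norm_sq]
  refine (abs_add_le _ _).trans ?_
  rw [mul_add]
  refine add_le_add ?_ ?_
  · rw [abs_div, abs_mul, abs_of_pos (pow_pos hw 2), div_le_iff₀ (pow_pos hw 2)]
    have h1 : |(1 - ech x t).re| ≤ (x * t) ^ 2 / 2 := by
      rw [Complex.sub_re, Complex.one_re, ech_re, abs_of_nonneg (sub_nonneg.2 (Real.cos_le_one _))]
      linarith [Real.one_sub_sq_div_two_le_cos (x := x * t)]
    calc _ ≤ (x * t) ^ 2 / 2 * ‖1 - cf p t‖ := by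
          gcongr
          exact Complex.abs_re_le_norm _
      _ = (x : ℝ) ^ 2 * (1 / (2 * c)) * ((c * t ^ 2) * ‖1 - cf p t‖) := by field_simp
      _ ≤ (x : ℝ) ^ 2 * (1 / (2 * c)) * (‖1 - cf p t‖ * ‖1 - cf p t‖) := by gcongr
      _ = _ := by ring
  · rw [abs_div, abs_mul, abs_of_pos (pow_pos hw 2)]
    have h1 : |(1 - ech x t).im| ≤ (x : ℝ) ^ 2 * t := by
      rw [Complex.sub_im, Complex.one_im, ech_im, zero_sub, abs_neg]
      refine (Real.abs_sin_le_abs).trans ?_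
      rw [abs_mul, abs_of_pos ht]
      gcongr
      exact abs_le_sq_intCast x
    have h2 : |(1 - cf p t).im| = |(cf p t).im| := by simp
    rw [h2]
    calc _ ≤ (x : ℝ) ^ 2 * t * |(cf p t).im| / (c * t ^ 2) ^ 2 := by gcongr
      _ = _ := by field_simp

/-- A single integrable function, up to the factor `x²`, dominates the integrands of all partial
sums. Near the origin `|Im φ^N| ≤ |Im φ| / (1 - |φ|)` is of order `|Im φ| / t²`, which makes up
for the singularity `1/t` of the kernel. -/
theorem exists_dominating (h : CenteredKernel p s)
    (hap : ∀ t ∈ Set.Ioc 0 Real.pi, cf p t ≠ 1) :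
    ∃ D : ℝ → ℝ, IntegrableOn D (Set.Ioc 0 Real.pi) ∧ ∀ t ∈ Set.Ioc 0 Real.pi, ∀ x : ℤ,
      |(potFourier p x t).re| ≤ (x : ℝ) ^ 2 * D t ∧
      ∀ N : ℕ, |((1 - cf p t ^ N) * potFourier p x t).re| ≤ (x : ℝ) ^ 2 * D t := by
  obtain ⟨c, hc, hct⟩ := h.exists_le_norm_one_sub_cf hap
  obtain ⟨δ, hδ, c', hc', hct'⟩ := h.exists_norm_cf_le
  set J : ℝ → ℝ := fun t => |(cf p t).im| / t ^ 3 with hJ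
  have hJi : IntegrableOn J (Set.Ioc 0 Real.pi) := h.integrableOn_im_cf_div
  have hconst : ∀ r : ℝ, IntegrableOn (fun _ : ℝ => r) (Set.Ioc 0 Real.pi) := fun r =>
    integrableOn_const (by simp)
  refine ⟨fun t => 2 * (1 / (2 * c) + J t / c ^ 2) + (J t / (c * c') + 1 / (c * δ)), ?_, ?_⟩
  · exact (((hconst _).add (hJi.div_const _)).const_mul 2).add ((hJi.div_const _).add (hconst _))
  · intro t ht x
    have ht0 := ht.1
    have hJ0 : 0 ≤ J t := by simp only [hJ]; positivity
    have h1 := abs_re_potFourier_le (p := p) hc ht0 (hct t ht) x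
    have h2 := norm_potFourier_le (p := p) hc ht0 (hct t ht) x
    have hx := abs_le_sq_intCast x
    refine ⟨h1.trans ?_, fun N => ?_⟩
    · have : 0 ≤ J t / c ^ 2 := by positivity
      have : 0 ≤ J t / (c * c') := by positivity
      have : 0 ≤ 1 / (c * δ) := by positivity
      have : 0 ≤ 1 / (2 * c) := by positivity
      refine mul_le_mul_of_nonneg_left ?_ (sq_nonneg _)
      linarith
    · have hpow : ‖cf p t ^ N‖ ≤ 1 := by
        rw [norm_pow]
        exact pow_le_one₀ (norm_nonneg _) (h.norm_cf_le t)
      have h3 : |(1 - cf p t ^ N).re| ≤ 2 := by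
        refine (Complex.abs_re_le_norm _).trans ((norm_sub_le _ _).trans ?_)
        rw [norm_one]
        linarith
      have h4 : |(potFourier p x t).im| * |(cf p t ^ N).im|
          ≤ (x : ℝ) ^ 2 * (J t / (c * c') + 1 / (c * δ)) := by
        have h5 := (Complex.abs_im_le_norm _).trans h2
        rcases lt_or_ge t δ with htδ | htδ
        · have h6 : |(cf p t ^ N).im| ≤ |(cf p t).im| / (c' * t ^ 2) := by
            rw [le_div_iff₀ (by positivity)]
            calc _ ≤ |(cf p t ^ N).im| * (1 - ‖cf p t‖) := by
                  gcongr
                  exact hct' t ht0 htδ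
              _ ≤ |(cf p t).im| * (1 - ‖cf p t‖ ^ N) := abs_im_pow_le (h.norm_cf_le t) N
              _ ≤ |(cf p t).im| * 1 := by
                  gcongr
                  linarith [pow_nonneg (norm_nonneg (cf p t)) N]
              _ = _ := mul_one _
          calc _ ≤ |(x : ℝ)| / (c * t) * (|(cf p t).im| / (c' * t ^ 2)) := by gcongr
            _ = |(x : ℝ)| * (J t / (c * c')) := by simp only [hJ]; field_simp
            _ ≤ (x : ℝ) ^ 2 * (J t / (c * c')) := by gcongr
            _ ≤ _ := by
              gcongr
              have : 0 ≤ 1 / (c * δ) := by positivity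
              linarith
        · have h6 : |(cf p t ^ N).im| ≤ 1 := (Complex.abs_im_le_norm _).trans hpow
          calc _ ≤ |(x : ℝ)| / (c * t) * 1 := by gcongr
            _ ≤ (x : ℝ) ^ 2 / (c * δ) * 1 := by gcongr
            _ = (x : ℝ) ^ 2 * (1 / (c * δ)) := by ring
            _ ≤ _ := by
              gcongr
              have : 0 ≤ J t / (c * c') := by positivity
              linarith
      rw [Complex.mul_re]
      refine (abs_sub _ _).trans ?_
      rw [abs_mul, abs_mul]
      have h7 : |(1 - cf p t ^ N).im| = |(cf p t ^ N).im| := by simp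
      rw [h7, mul_comm |(cf p t ^ N).im|, mul_add]
      refine add_le_add ?_ h4
      calc _ ≤ 2 * ((x : ℝ) ^ 2 * (1 / (2 * c) + J t / c ^ 2)) := by gcongr
        _ = _ := by ring

theorem measurable_potFourier (h : CenteredKernel p s) (x : ℤ) : Measurable (potFourier p x) := by
  have h1 := h.continuous_cf.measurable
  have h2 := measurable_ech x
  unfold potFourier
  fun_prop

/-- The series of the potential function converges, and its partial sums are `O(x²)` uniformly. -/
theorem tendsto_potPartial (h : CenteredKernel p s)
    (hap : ∀ t ∈ Set.Ioc 0 Real.pi, cf p t ≠ 1) :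
    (∀ x, Tendsto (fun N => potPartial p N x) atTop (𝓝 (pot p x))) ∧
      ∃ C : ℝ, ∀ N x, |potPartial p N x| ≤ C * (x : ℝ) ^ 2 := by
  obtain ⟨D, hD, hdom⟩ := h.exists_dominating hap
  have hpi := Real.pi_pos
  have hD' : IntervalIntegrable D volume 0 Real.pi :=
    (intervalIntegrable_iff_integrableOn_Ioc_of_le hpi.le).2 hD
  have hmeas := h.continuous_cf.measurable
  constructor
  · intro x
    have hm := h.measurable_potFourier x
    have h1 : Tendsto (fun N : ℕ => ∫ t in (0 : ℝ)..Real.pi,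
        ((1 - cf p t ^ N) * potFourier p x t).re) atTop
        (𝓝 (∫ t in (0 : ℝ)..Real.pi, (potFourier p x t).re)) := by
      refine intervalIntegral.tendsto_integral_filter_of_dominated_convergence
        (fun t => (x : ℝ) ^ 2 * D t)
        (Eventually.of_forall fun N => Measurable.aestronglyMeasurable (by fun_prop))
        (Eventually.of_forall fun N => Eventually.of_forall fun t ht => ?_) (hD'.const_mul _) ?_
      · rw [Set.uIoc_of_le hpi.le] at ht
        exact (hdom t ht x).2 N
      · filter_upwards [h.tendsto_cf_pow] with t ht _
        have := (Complex.continuous_re.tendsto _).comp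
          ((ht.const_sub 1).mul_const (potFourier p x t))
        simpa [Function.comp_def, -Complex.mul_re] using this
    exact (h1.const_mul Real.pi⁻¹).congr fun N => (h.potPartial_eq_integral hap N x).symm
  · refine ⟨Real.pi⁻¹ * ∫ t in (0 : ℝ)..Real.pi, D t, fun N x => ?_⟩
    rw [h.potPartial_eq_integral hap, abs_mul, abs_of_pos (inv_pos.2 hpi), mul_assoc]
    refine mul_le_mul_of_nonneg_left ?_ (inv_pos.2 hpi).le
    rw [mul_comm, ← intervalIntegral.integral_const_mul, ← Real.norm_eq_abs]
    refine intervalIntegral.norm_integral_le_of_norm_le hpi.le (Eventually.of_forall fun t ht => ?_)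
      (hD'.const_mul _)
    exact (hdom t ht x).2 N

theorem hasSum_potPartial (h : CenteredKernel p s) (N : ℕ) (x : ℤ) :
    HasSum (fun y => p y * potPartial p N (x + y))
      (potPartial p N x + (if x = 0 then 1 else 0) - stepP p N (-x)) := by
  have h1 : ∀ n : ℕ, HasSum (fun y => p y * (stepP p n 0 - stepP p n (-(x + y))))
      (stepP p n 0 - stepP p (n + 1) (-x)) := fun n => by
    refine hasSum_of_eq ((h.hasSum_one.mul_right (stepP p n 0)).sub (h.hasSum_stepP n (-x)))
      (fun y => ?_) (by ring)
    rw [neg_add, ← sub_eq_add_neg]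
    ring
  refine hasSum_of_eq (hasSum_sum (s := Finset.range N) fun n _ => h1 n) (fun y => ?_) ?_
  · rw [potPartial, Finset.mul_sum]
  · have h2 := Finset.sum_range_sub' (fun n => stepP p n (-x)) N
    have h3 : stepP p 0 (-x) = if x = 0 then 1 else 0 := by simp [stepP]
    rw [h3] at h2
    rw [potPartial, add_sub_assoc, ← h2, ← Finset.sum_add_distrib]
    exact Finset.sum_congr rfl fun n _ => by ring

theorem poisson_pot (h : CenteredKernel p s)
    (hap : ∀ t ∈ Set.Ioc 0 Real.pi, cf p t ≠ 1) (x : ℤ) :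
    HasSum (fun y => p y * pot p (x + y)) (pot p x + if x = 0 then 1 else 0) := by
  obtain ⟨hlim, C, hC⟩ := h.tendsto_potPartial hap
  have hb : Summable fun y : ℤ => p y * (C * ((x + y : ℤ) : ℝ) ^ 2) := by
    have := (((h.hasSum_one.mul_right ((x : ℝ) ^ 2)).add
      (h.hasSum_mean.mul_right (2 * (x : ℝ)))).add h.hasSum_sq).mul_left C
    refine (hasSum_of_eq this (fun y => ?_) rfl).summable
    push_cast
    ring
  have hbound : ∀ N y, ‖p y * potPartial p N (x + y)‖ ≤ p y * (C * ((x + y : ℤ) : ℝ) ^ 2) := by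
    intro N y
    rw [norm_mul, Real.norm_of_nonneg (h.nonneg y)]
    exact mul_le_mul_of_nonneg_left (hC N _) (h.nonneg y)
  have h1 := tendsto_tsum_of_dominated_convergence hb (fun y => (hlim (x + y)).const_mul (p y))
    (Eventually.of_forall hbound)
  have h2 : Tendsto (fun N => ∑' y, p y * potPartial p N (x + y)) atTop
      (𝓝 (pot p x + (if x = 0 then 1 else 0) - 0)) := by
    refine (((hlim x).add_const _).sub (h.tendsto_stepP (-x))).congr fun N => ?_
    exact (h.hasSum_potPartial N x).tsum_eq.symm
  rw [sub_zero] at h2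
  rw [← tendsto_nhds_unique h1 h2]
  refine (Summable.of_norm_bounded hb fun y => ?_).hasSum
  exact le_of_tendsto (((hlim (x + y)).const_mul (p y)).norm)
    (Eventually.of_forall fun N => hbound N y)

end CenteredKernel

/-! ### Increments of the potential function at infinity -/

/-- An oscillatory integral estimate: `∫₀^π Re(e^{ixt} R(t)) dt → 0` as `|x| → ∞` for a function `R`
that is `o(1/t)` at the origin, with derivative `O(t⁻²)` and integrable real part. The range
`t ≤ M/|x|` is estimated directly, the range `t ≥ M/|x|` after an integration by parts. -/
theorem oscillatory_integral_small {R R' : ℝ → ℂ} {C : ℝ} (hC : 0 < C)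
    (hR : ∀ t ∈ Set.Ioc 0 Real.pi, HasDerivAt R (R' t) t)
    (hR' : ContinuousOn R' (Set.Ioc 0 Real.pi))
    (hRC : ∀ t ∈ Set.Ioc 0 Real.pi, ‖R t‖ ≤ C / t)
    (hRC' : ∀ t ∈ Set.Ioc 0 Real.pi, ‖R' t‖ ≤ C / t ^ 2)
    (hlim : Tendsto (fun t => t * ‖R t‖) (𝓝[>] 0) (𝓝 0))
    (hint : IntegrableOn (fun t => (R t).re) (Set.Ioc 0 Real.pi)) {η : ℝ} (hη : 0 < η) :
    ∃ K : ℝ, ∀ x : ℤ, K < |(x : ℝ)| →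
      |∫ t in (0 : ℝ)..Real.pi, (ech x t * R t).re| ≤ η := by
  have hpi := Real.pi_pos
  set M : ℝ := 8 * C / η with hM
  have hM0 : 0 < M := by positivity
  have hRcont : ContinuousOn R (Set.Ioc 0 Real.pi) :=
    fun t ht => (hR t ht).continuousAt.continuousWithinAt
  obtain ⟨δ₁, hδ₁, hsmall₁⟩ : ∃ δ > 0, ∀ t, 0 < t → t < δ → t * ‖R t‖ ≤ η / (4 * M) := by
    have h1 := (Metric.tendsto_nhds.1 hlim) (η / (4 * M)) (by positivity)
    rw [eventually_nhdsWithin_iff, Metric.eventually_nhds_iff] at h1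
    obtain ⟨δ, hδ, hδ'⟩ := h1
    refine ⟨δ, hδ, fun t ht htδ => ?_⟩
    have h2 := hδ' (y := t) (by simpa [abs_of_pos ht] using htδ) ht
    rw [Real.dist_eq, sub_zero] at h2
    exact (le_abs_self _).trans h2.le
  have hintR : IntervalIntegrable (fun t => |(R t).re|) volume 0 Real.pi :=
    (intervalIntegrable_iff_integrableOn_Ioc_of_le hpi.le).2 hint.norm
  obtain ⟨δ₂, hδ₂, hsmall₂⟩ : ∃ δ > 0, ∀ r, 0 < r → r < δ → r ≤ Real.pi →
      ∫ t in (0 : ℝ)..r, |(R t).re| ≤ η / 4 := by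
    have h1 : ContinuousOn (fun r => ∫ t in (0 : ℝ)..r, |(R t).re|) (Set.uIcc 0 Real.pi) :=
      intervalIntegral.continuousOn_primitive_interval
        ((intervalIntegrable_iff_integrableOn_Icc_of_le hpi.le).1 hintR |>.mono_set
          (by rw [Set.uIcc_of_le hpi.le]))
    have h2 := h1 0 Set.left_mem_uIcc
    rw [Metric.continuousWithinAt_iff] at h2
    obtain ⟨δ, hδ, hδ'⟩ := h2 (η / 4) (by positivity)
    refine ⟨δ, hδ, fun r hr hrδ hrpi => ?_⟩
    have h3 := hδ' (x := r) (by rw [Set.uIcc_of_le hpi.le]; exact ⟨hr.le, hrpi⟩)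
      (by simpa [abs_of_pos hr] using hrδ)
    rw [Real.dist_eq, intervalIntegral.integral_same, sub_zero] at h3
    exact (le_abs_self _).trans h3.le
  refine ⟨M / min (min δ₁ δ₂) Real.pi, fun x hx => ?_⟩
  have hmin : 0 < min (min δ₁ δ₂) Real.pi := lt_min (lt_min hδ₁ hδ₂) hpi
  have hx0 : 0 < |(x : ℝ)| := lt_trans (by positivity) hx
  set δ := M / |(x : ℝ)| with hδdef
  have hδ0 : 0 < δ := by positivity
  have hδlt : δ < min (min δ₁ δ₂) Real.pi := by
    rw [div_lt_iff₀ hmin] at hx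
    rw [hδdef, div_lt_iff₀ hx0]
    linarith
  have hδ1 : δ < δ₁ := hδlt.trans_le ((min_le_left _ _).trans (min_le_left _ _))
  have hδ2 : δ < δ₂ := hδlt.trans_le ((min_le_left _ _).trans (min_le_right _ _))
  have hδpi : δ < Real.pi := hδlt.trans_le (min_le_right _ _)
  have hxδ : |(x : ℝ)| * δ = M := by rw [hδdef]; field_simp
  have hech := continuous_ech x
  -- pointwise estimate of the real part near the origin
  have hpt : ∀ t, 0 < t → |(ech x t * R t).re| ≤ |(R t).re| + |(x : ℝ)| * (t * ‖R t‖) := by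
    intro t ht
    rw [Complex.mul_re]
    refine (abs_sub _ _).trans ?_
    rw [abs_mul, abs_mul, ech_re, ech_im]
    refine add_le_add (mul_le_of_le_one_left (abs_nonneg _) (Real.abs_cos_le_one _)) ?_
    rw [← mul_assoc]
    have h1 := Real.abs_sin_le_abs (x := x * t)
    rw [abs_mul, abs_of_pos ht] at h1
    have h2 := Complex.abs_im_le_norm (R t)
    gcongr
  have hmeas : ContinuousOn (fun t => (ech x t * R t).re) (Set.Ioc 0 Real.pi) :=
    Complex.continuous_re.comp_continuousOn (hech.continuousOn.mul hRcont)
  have hI : IntervalIntegrable (fun t => (ech x t * R t).re) volume 0 Real.pi := by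
    rw [intervalIntegrable_iff_integrableOn_Ioc_of_le hpi.le]
    have h1 : IntegrableOn (fun t => |(R t).re| + |(x : ℝ)| * C) (Set.Ioc 0 Real.pi) :=
      hint.norm.add (integrableOn_const (by simp))
    refine Integrable.mono' h1 (hmeas.aestronglyMeasurable measurableSet_Ioc) ?_
    filter_upwards [ae_restrict_mem measurableSet_Ioc] with t ht
    refine (hpt t ht.1).trans ?_
    have h2 := hRC t ht
    rw [le_div_iff₀ ht.1] at h2
    gcongr
    linarith
  have hsub1 : Set.uIcc 0 δ ⊆ Set.uIcc 0 Real.pi := by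
    rw [Set.uIcc_of_le hδ0.le, Set.uIcc_of_le hpi.le]
    exact Set.Icc_subset_Icc_right hδpi.le
  have hsub2 : Set.uIcc δ Real.pi ⊆ Set.uIcc 0 Real.pi := by
    rw [Set.uIcc_of_le hδpi.le, Set.uIcc_of_le hpi.le]
    exact Set.Icc_subset_Icc_left hδ0.le
  have hsub3 : Set.uIcc δ Real.pi ⊆ Set.Ioc 0 Real.pi := by
    rw [Set.uIcc_of_le hδpi.le]
    exact fun t ht => ⟨hδ0.trans_le ht.1, ht.2⟩
  have hpart1 : |∫ t in (0 : ℝ)..δ, (ech x t * R t).re| ≤ η / 4 + η / 4 := by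
    have h1 : ‖∫ t in (0 : ℝ)..δ, (ech x t * R t).re‖
        ≤ ∫ t in (0 : ℝ)..δ, (|(R t).re| + |(x : ℝ)| * (η / (4 * M))) := by
      refine intervalIntegral.norm_integral_le_of_norm_le hδ0.le
        (Eventually.of_forall fun t ht => ?_)
        ((hintR.mono_set hsub1).add intervalIntegrable_const)
      refine (hpt t ht.1).trans ?_
      gcongr
      exact hsmall₁ t ht.1 (ht.2.trans_lt hδ1)
    rw [intervalIntegral.integral_add (hintR.mono_set hsub1) intervalIntegrable_const,
      intervalIntegral.integral_const, sub_zero, smul_eq_mul, ← mul_assoc, mul_comm δ, hxδ,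
      show M * (η / (4 * M)) = η / 4 by field_simp] at h1
    exact h1.trans (add_le_add (hsmall₂ δ hδ0 hδ2 hδpi.le) le_rfl)
  have hpart2 : |∫ t in δ..Real.pi, (ech x t * R t).re| ≤ η / 4 := by
    have hxI : (x : ℂ) * Complex.I ≠ 0 := by
      refine mul_ne_zero ?_ Complex.I_ne_zero
      have : (x : ℝ) ≠ 0 := abs_pos.1 hx0
      exact_mod_cast this
    have hnx : ‖(x : ℂ) * Complex.I‖ = |(x : ℝ)| := by
      rw [norm_mul, Complex.norm_I, mul_one, Complex.norm_intCast]
    have hv : ∀ t, HasDerivAt (fun t => ech x t / ((x : ℂ) * Complex.I)) (ech x t) t := fun t => by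
      have := (hasDerivAt_ech x t).div_const ((x : ℂ) * Complex.I)
      rwa [mul_div_cancel_left₀ _ hxI] at this
    have hvn : ∀ t, ‖ech x t / ((x : ℂ) * Complex.I)‖ = 1 / |(x : ℝ)| := fun t => by
      rw [norm_div, norm_ech, hnx]
    have hR'i : IntervalIntegrable R' volume δ Real.pi :=
      (hR'.mono hsub3).intervalIntegrable
    have h1 := intervalIntegral.integral_mul_deriv_eq_deriv_mul (a := δ) (b := Real.pi)
      (fun t ht => hR t (hsub3 ht)) (fun t _ => hv t) hR'i (hech.intervalIntegrable _ _)
    have h2 : ‖∫ t in δ..Real.pi, R' t * (ech x t / ((x : ℂ) * Complex.I))‖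
        ≤ C / |(x : ℝ)| * (1 / δ - 1 / Real.pi) := by
      have h3 : ∫ t in δ..Real.pi, C / |(x : ℝ)| * t ^ (-2 : ℤ)
          = C / |(x : ℝ)| * (1 / δ - 1 / Real.pi) := by
        rw [intervalIntegral.integral_const_mul, integral_zpow]
        · congr 1
          norm_num [zpow_neg_one]
          ring
        · right
          refine ⟨by norm_num, fun h0 => ?_⟩
          exact lt_irrefl _ (hsub3 h0).1
      rw [← h3]
      refine intervalIntegral.norm_integral_le_of_norm_le hδpi.le
        (Eventually.of_forall fun t ht => ?_) ?_
      · have ht' : t ∈ Set.Ioc 0 Real.pi := ⟨hδ0.trans ht.1, ht.2⟩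
        rw [norm_mul, hvn]
        calc _ ≤ C / t ^ 2 * (1 / |(x : ℝ)|) := by
              gcongr
              exact hRC' t ht'
          _ = _ := by
            rw [zpow_neg, show (2 : ℤ) = ((2 : ℕ) : ℤ) from rfl, zpow_natCast]
            field_simp
      · refine ContinuousOn.intervalIntegrable ?_
        refine continuousOn_const.mul fun t ht => ?_
        exact (continuousAt_zpow₀ t _ (Or.inl (hsub3 ht).1.ne')).continuousWithinAt
    have h4 : (∫ t in δ..Real.pi, (ech x t * R t).re) = (∫ t in δ..Real.pi, R t * ech x t).re := by
      rw [← Complex.reCLM_apply, ← ContinuousLinearMap.intervalIntegral_comp_comm]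
      · simp only [Complex.reCLM_apply, mul_comm]
      · exact ((hRcont.mono hsub3).mul hech.continuousOn).intervalIntegrable
    rw [h4]
    refine (Complex.abs_re_le_norm _).trans ?_
    rw [h1]
    refine (norm_sub_le _ _).trans ((add_le_add (norm_sub_le _ _) h2).trans ?_)
    rw [norm_mul, norm_mul, hvn, hvn]
    have h5 := hRC Real.pi ⟨hpi, le_rfl⟩
    have h6 := hRC δ ⟨hδ0, hδpi.le⟩
    calc _ ≤ C / Real.pi * (1 / |(x : ℝ)|) + C / δ * (1 / |(x : ℝ)|)
          + C / |(x : ℝ)| * (1 / δ - 1 / Real.pi) := by gcongr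
      _ = 2 * C / (|(x : ℝ)| * δ) := by field_simp; ring
      _ = η / 4 := by rw [hxδ, hM]; field_simp; norm_num
  rw [← intervalIntegral.integral_add_adjacent_intervals (hI.mono_set hsub1) (hI.mono_set hsub2)]
  refine (abs_add_le _ _).trans ?_
  linarith

/-- The step distribution of the simple random walk. -/
noncomputable def simpleKernel (y : ℤ) : ℝ := if y = 1 ∨ y = -1 then 1 / 2 else 0

theorem hasSum_simpleKernel {E : Type*} [NormedAddCommGroup E] [NormedSpace ℝ E] (F : ℤ → E) :
    HasSum (fun y => simpleKernel y • F y) ((1 / 2 : ℝ) • F 1 + (1 / 2 : ℝ) • F (-1)) := by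
  have h1 : HasSum (fun y => simpleKernel y • F y)
      (∑ y ∈ ({1, -1} : Finset ℤ), simpleKernel y • F y) :=
    hasSum_sum_of_ne_finset_zero fun y hy => by
      have : ¬ (y = 1 ∨ y = -1) := by simpa using hy
      simp [simpleKernel, this]
  have h2 : ∑ y ∈ ({1, -1} : Finset ℤ), simpleKernel y • F y
      = (1 / 2 : ℝ) • F 1 + (1 / 2 : ℝ) • F (-1) := by
    rw [Finset.sum_pair (by norm_num)]
    simp [simpleKernel]
  rwa [h2] at h1

theorem centeredKernel_simpleKernel : CenteredKernel simpleKernel 1 where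
  nonneg y := by
    rw [simpleKernel]
    split_ifs <;> norm_num
  hasSum_one := hasSum_of_eq (hasSum_simpleKernel fun _ => (1 : ℝ)) (fun y => by simp) (by norm_num)
  hasSum_mean := hasSum_of_eq (hasSum_simpleKernel fun y => (y : ℝ)) (fun y => by simp)
    (by norm_num)
  hasSum_sq := hasSum_of_eq (hasSum_simpleKernel fun y => (y : ℝ) ^ 2) (fun y => by simp)
    (by norm_num)
  pos := one_pos

theorem cf_simpleKernel (t : ℝ) : cf simpleKernel t = (Real.cos t : ℂ) := by
  have h1 := hasSum_simpleKernel fun y => ech y t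
  have h2 : cf simpleKernel t = ∑' y, simpleKernel y • ech y t :=
    tsum_congr fun y => by rw [Complex.real_smul]
  rw [h2, h1.tsum_eq]
  refine Complex.ext ?_ ?_
  · simp [ech_re, -Complex.ofReal_cos]
    ring
  · simp [ech_im, -Complex.ofReal_cos]

theorem cf_simpleKernel_ne_one (t : ℝ) (ht : t ∈ Set.Ioc 0 Real.pi) : cf simpleKernel t ≠ 1 := by
  rw [cf_simpleKernel]
  intro h1
  have h2 : Real.cos t = 1 := by exact_mod_cast h1
  have h3 := Real.cos_lt_cos_of_nonneg_of_le_pi le_rfl ht.2 ht.1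
  rw [Real.cos_zero] at h3
  exact h3.ne h2

/-- The potential function of the simple random walk is `|x|`: this follows from the Poisson
equation and symmetry. -/
theorem pot_simpleKernel (x : ℤ) : pot simpleKernel x = |(x : ℝ)| := by
  have heven : ∀ x, pot simpleKernel (-x) = pot simpleKernel x := by
    intro x
    rw [pot, pot]
    congr 1
    refine intervalIntegral.integral_congr fun t _ => ?_
    have h1 : ((1 - cf simpleKernel t : ℂ)) = ((1 - Real.cos t : ℝ) : ℂ) := by
      rw [cf_simpleKernel]
      push_cast
      ring
    simp only [potFourier, h1, Complex.div_ofReal_re, Complex.sub_re, ech_re]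
    simp
  have hzero : pot simpleKernel 0 = 0 := by simp [pot, potFourier]
  have hrec : ∀ x : ℤ, (pot simpleKernel (x + 1) + pot simpleKernel (x - 1)) / 2
      = pot simpleKernel x + if x = 0 then 1 else 0 := by
    intro x
    have h1 := centeredKernel_simpleKernel.poisson_pot cf_simpleKernel_ne_one x
    have h2 := (hasSum_simpleKernel fun y => pot simpleKernel (x + y)).unique h1
    rw [← h2, sub_eq_add_neg, smul_eq_mul, smul_eq_mul]
    ring
  have hnat : ∀ n : ℕ, pot simpleKernel n = n ∧ pot simpleKernel (n + 1) = n + 1 := by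
    intro n
    induction n with
    | zero =>
      have h1 := hrec 0
      rw [zero_sub, heven, hzero] at h1
      simp only [zero_add, if_true] at h1
      refine ⟨by simpa using hzero, ?_⟩
      simp only [Nat.cast_zero, zero_add]
      linarith
    | succ n ih =>
      refine ⟨by push_cast; exact ih.2, ?_⟩
      have h1 := hrec (n + 1)
      rw [if_neg (by omega), add_sub_cancel_right, ih.1, ih.2] at h1
      push_cast
      linarith
  rcases le_total 0 x with hx | hx
  · obtain ⟨n, rfl⟩ := Int.eq_ofNat_of_zero_le hx
    rw [(hnat n).1]
    simp
  · obtain ⟨n, hn⟩ := Int.eq_ofNat_of_zero_le (neg_nonneg.2 hx)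
    rw [← heven, hn, (hnat n).1]
    obtain rfl : x = -(n : ℤ) := by omega
    simp

namespace CenteredKernel

variable {p : ℤ → ℝ} {s : ℝ}

theorem intervalIntegrable_re_potFourier (h : CenteredKernel p s)
    (hap : ∀ t ∈ Set.Ioc 0 Real.pi, cf p t ≠ 1) (x : ℤ) :
    IntervalIntegrable (fun t => (potFourier p x t).re) volume 0 Real.pi := by
  obtain ⟨D, hD, hdom⟩ := h.exists_dominating hap
  rw [intervalIntegrable_iff_integrableOn_Ioc_of_le Real.pi_pos.le]
  have hm := h.measurable_potFourier x
  refine Integrable.mono' (hD.const_mul ((x : ℝ) ^ 2))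
    (Measurable.aestronglyMeasurable (by fun_prop)) ?_
  filter_upwards [ae_restrict_mem measurableSet_Ioc] with t ht
  exact (hdom t ht x).1

theorem ech_mul_potFourier_one (p : ℤ → ℝ) (x : ℤ) (t : ℝ) :
    ech x t * potFourier p 1 t = potFourier p (x + 1) t - potFourier p x t := by
  rw [potFourier, potFourier, potFourier, ech_add]
  ring

theorem intervalIntegrable_ech_mul (h : CenteredKernel p s)
    (hap : ∀ t ∈ Set.Ioc 0 Real.pi, cf p t ≠ 1) (x : ℤ) :
    IntervalIntegrable (fun t => (ech x t * potFourier p 1 t).re) volume 0 Real.pi := by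
  simp only [ech_mul_potFourier_one, Complex.sub_re]
  exact (h.intervalIntegrable_re_potFourier hap _).sub (h.intervalIntegrable_re_potFourier hap _)

theorem pot_increment (h : CenteredKernel p s)
    (hap : ∀ t ∈ Set.Ioc 0 Real.pi, cf p t ≠ 1) (x : ℤ) :
    pot p (x + 1) - pot p x
      = Real.pi⁻¹ * ∫ t in (0 : ℝ)..Real.pi, (ech x t * potFourier p 1 t).re := by
  simp only [ech_mul_potFourier_one, Complex.sub_re]
  rw [intervalIntegral.integral_sub (h.intervalIntegrable_re_potFourier hap _)
    (h.intervalIntegrable_re_potFourier hap _), mul_sub, pot, pot]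

theorem hasDerivAt_potFourier_one (h : CenteredKernel p s) {t : ℝ} (ht : cf p t ≠ 1) :
    HasDerivAt (potFourier p 1) ((-(Complex.I * ech 1 t) * (1 - cf p t)
      - (1 - ech 1 t) * (-cfDeriv p t)) / (1 - cf p t) ^ 2) t := by
  have h1 := ((hasDerivAt_ech 1 t).const_sub 1)
  have h2 := ((h.hasDerivAt_cf t).const_sub 1)
  have h3 := h1.div h2 (sub_ne_zero.2 ht.symm)
  exact h3.congr_deriv (by simp)

/-- The Fourier kernel of the increments has derivative `O(t⁻²)`. -/
theorem norm_deriv_potFourier_one_le (h : CenteredKernel p s) {c : ℝ} (hc : 0 < c) {t : ℝ}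
    (ht : 0 < t) (hct : c * t ^ 2 ≤ ‖1 - cf p t‖) :
    ‖(-(Complex.I * ech 1 t) * (1 - cf p t) - (1 - ech 1 t) * (-cfDeriv p t)) / (1 - cf p t) ^ 2‖
      ≤ (1 / c + s / c ^ 2) / t ^ 2 := by
  have hs := h.pos
  have hpos : 0 < c * t ^ 2 := by positivity
  have hw := hpos.trans_le hct
  have h1 := norm_ech_sub_one_le 1 t
  rw [norm_sub_rev, abs_of_pos ht, Int.cast_one, abs_one, one_mul] at h1
  have h2 := h.norm_cfDeriv_le t
  rw [abs_of_pos ht] at h2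
  rw [norm_div, norm_pow, div_le_iff₀ (by positivity)]
  refine (norm_sub_le _ _).trans ?_
  rw [norm_mul, norm_neg, norm_mul, Complex.norm_I, norm_ech, norm_mul, norm_neg, one_mul, one_mul]
  calc ‖1 - cf p t‖ + ‖1 - ech 1 t‖ * ‖cfDeriv p t‖
      ≤ ‖1 - cf p t‖ + t * (s * t) := by gcongr
    _ = 1 / c / t ^ 2 * ((c * t ^ 2) * ‖1 - cf p t‖) + s / c ^ 2 / t ^ 2 * (c * t ^ 2) ^ 2 := by
        field_simp
    _ ≤ 1 / c / t ^ 2 * (‖1 - cf p t‖ * ‖1 - cf p t‖) + s / c ^ 2 / t ^ 2 * ‖1 - cf p t‖ ^ 2 := by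
        gcongr
    _ = _ := by ring

theorem continuousOn_deriv_potFourier_one (h : CenteredKernel p s)
    (hap : ∀ t ∈ Set.Ioc 0 Real.pi, cf p t ≠ 1) :
    ContinuousOn (fun t => (-(Complex.I * ech 1 t) * (1 - cf p t)
      - (1 - ech 1 t) * (-cfDeriv p t)) / (1 - cf p t) ^ 2) (Set.Ioc 0 Real.pi) := by
  have h1 := h.continuous_cf
  have h2 := h.continuous_cfDeriv
  have h3 := continuous_ech 1
  exact ContinuousOn.div (Continuous.continuousOn (by fun_prop))
    (Continuous.continuousOn (by fun_prop))
    fun t ht => pow_ne_zero 2 (sub_ne_zero.2 (hap t ht).symm)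

/-- Comparison with the simple random walk: the Fourier kernel of the increments differs by `o(1/t)`
from `1/s` times that of the simple random walk. -/
theorem tendsto_mul_norm_sub (h : CenteredKernel p s)
    (hap : ∀ t ∈ Set.Ioc 0 Real.pi, cf p t ≠ 1) {q : ℤ → ℝ} (hq : CenteredKernel q 1)
    (hapq : ∀ t ∈ Set.Ioc 0 Real.pi, cf q t ≠ 1) :
    Tendsto (fun t => t * ‖potFourier p 1 t - (s : ℂ)⁻¹ * potFourier q 1 t‖) (𝓝[>] 0) (𝓝 0) := by
  have hs := h.pos
  have hsC : (s : ℂ) ≠ 0 := by exact_mod_cast hs.ne'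
  obtain ⟨c, hc, hct⟩ := h.exists_le_norm_one_sub_cf hap
  obtain ⟨d, hd, hdt⟩ := hq.exists_le_norm_one_sub_cf hapq
  have h1 : Tendsto (fun t : ℝ => ‖(s : ℂ) * ((1 - cf q t) / (t : ℂ) ^ 2)
      - (1 - cf p t) / (t : ℂ) ^ 2‖ / (s * c * d)) (𝓝[>] 0) (𝓝 0) := by
    have := (((hq.tendsto_one_sub_cf_div.const_mul (s : ℂ)).sub
      h.tendsto_one_sub_cf_div).norm).div_const (s * c * d)
    have h0 : (s : ℂ) * (((1 : ℝ) : ℂ) / 2) - (s : ℂ) / 2 = 0 := by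
      push_cast
      ring
    rwa [h0, norm_zero, zero_div] at this
  refine squeeze_zero' ?_ ?_ h1
  · filter_upwards [self_mem_nhdsWithin] with t (ht : 0 < t)
    positivity
  · filter_upwards [Ioo_mem_nhdsGT Real.pi_pos] with t ht
    have ht0 := ht.1
    have ht' : t ∈ Set.Ioc 0 Real.pi := ⟨ht.1, ht.2.le⟩
    have hp1 : 1 - cf p t ≠ 0 := sub_ne_zero.2 (hap t ht').symm
    have hq1 : 1 - cf q t ≠ 0 := sub_ne_zero.2 (hapq t ht').symm
    have htC : (t : ℂ) ≠ 0 := by exact_mod_cast ht0.ne'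
    have h2 : potFourier p 1 t - (s : ℂ)⁻¹ * potFourier q 1 t
        = (1 - ech 1 t) * (t : ℂ) ^ 2 * ((s : ℂ) * ((1 - cf q t) / (t : ℂ) ^ 2)
          - (1 - cf p t) / (t : ℂ) ^ 2) / ((s : ℂ) * (1 - cf p t) * (1 - cf q t)) := by
      rw [potFourier, potFourier]
      field_simp
    have h3 := norm_ech_sub_one_le 1 t
    rw [norm_sub_rev, abs_of_pos ht0, Int.cast_one, abs_one, one_mul] at h3
    rw [h2, norm_div, norm_mul, norm_mul, norm_mul, norm_mul, norm_pow, Complex.norm_real,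
      Complex.norm_real, Real.norm_of_nonneg ht0.le, Real.norm_of_nonneg hs.le]
    set Z := ‖(s : ℂ) * ((1 - cf q t) / (t : ℂ) ^ 2) - (1 - cf p t) / (t : ℂ) ^ 2‖
    calc _ ≤ t * (t * t ^ 2 * Z / (s * (c * t ^ 2) * (d * t ^ 2))) := by
          gcongr
          · exact hct t ht'
          · exact hdt t ht'
      _ = _ := by field_simp

/-- The increments of the potential function differ by `o(1)` from `1/s` times those of `|x|`. -/
theorem increment_close (h : CenteredKernel p s)
    (hap : ∀ t ∈ Set.Ioc 0 Real.pi, cf p t ≠ 1) {ε : ℝ} (hε : 0 < ε) :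
    ∃ K : ℝ, ∀ x : ℤ, K < |(x : ℝ)| →
      |(pot p (x + 1) - pot p x) - s⁻¹ * (|((x + 1 : ℤ) : ℝ)| - |(x : ℝ)|)| ≤ ε := by
  have hs := h.pos
  have hq := centeredKernel_simpleKernel
  have hapq := cf_simpleKernel_ne_one
  obtain ⟨c, hc, hct⟩ := h.exists_le_norm_one_sub_cf hap
  obtain ⟨d, hd, hdt⟩ := hq.exists_le_norm_one_sub_cf hapq
  have hpi := Real.pi_pos
  set A : ℝ := (1 / c + s / c ^ 2) + s⁻¹ * (1 / d + 1 / d ^ 2) with hA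
  have hA0 : 0 < A := by positivity
  have hnsinv : ‖(s : ℂ)⁻¹‖ = s⁻¹ := by
    rw [norm_inv, Complex.norm_real, Real.norm_of_nonneg hs.le]
  obtain ⟨K, hK⟩ := oscillatory_integral_small
    (R := fun t => potFourier p 1 t - (s : ℂ)⁻¹ * potFourier simpleKernel 1 t) (C := A) hA0
    (fun t ht => (h.hasDerivAt_potFourier_one (hap t ht)).sub
      ((hq.hasDerivAt_potFourier_one (hapq t ht)).const_mul (s : ℂ)⁻¹))
    ((h.continuousOn_deriv_potFourier_one hap).sub
      (continuousOn_const.mul (hq.continuousOn_deriv_potFourier_one hapq)))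
    (fun t ht => by
      have ht0 := ht.1
      have h1 := norm_potFourier_le (p := p) hc ht.1 (hct t ht) 1
      have h2 := norm_potFourier_le (p := simpleKernel) hd ht.1 (hdt t ht) 1
      rw [Int.cast_one, abs_one] at h1 h2
      refine (norm_sub_le _ _).trans ?_
      rw [norm_mul, hnsinv]
      calc _ ≤ 1 / (c * t) + s⁻¹ * (1 / (d * t)) := by gcongr
        _ = (1 / c + s⁻¹ * (1 / d)) / t := by field_simp
        _ ≤ A / t := by
          have h3 : 0 ≤ s / c ^ 2 := by positivity
          have h4 : 0 ≤ s⁻¹ * (1 / d ^ 2) := by positivity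
          gcongr
          rw [hA, mul_add]
          linarith)
    (fun t ht => by
      have h1 := h.norm_deriv_potFourier_one_le hc ht.1 (hct t ht)
      have h2 := hq.norm_deriv_potFourier_one_le hd ht.1 (hdt t ht)
      refine (norm_sub_le _ _).trans ?_
      rw [norm_mul, hnsinv, hA, add_div, mul_div_assoc]
      gcongr)
    (h.tendsto_mul_norm_sub hap hq hapq)
    (by
      have h1 := (intervalIntegrable_iff_integrableOn_Ioc_of_le hpi.le).1
        (h.intervalIntegrable_re_potFourier hap 1)
      have h2 := (intervalIntegrable_iff_integrableOn_Ioc_of_le hpi.le).1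
        (hq.intervalIntegrable_re_potFourier hapq 1)
      refine (h1.sub (h2.const_mul s⁻¹)).congr (Eventually.of_forall fun t => ?_)
      simp only [Pi.sub_apply]
      rw [Complex.sub_re, ← Complex.ofReal_inv, Complex.re_ofReal_mul])
    (η := ε * Real.pi) (by positivity)
  refine ⟨K, fun x hx => ?_⟩
  have h1 := hK x hx
  have h2 : (∫ t in (0 : ℝ)..Real.pi,
      (ech x t * (potFourier p 1 t - (s : ℂ)⁻¹ * potFourier simpleKernel 1 t)).re)
      = (∫ t in (0 : ℝ)..Real.pi, (ech x t * potFourier p 1 t).re)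
        - s⁻¹ * ∫ t in (0 : ℝ)..Real.pi, (ech x t * potFourier simpleKernel 1 t).re := by
    rw [← intervalIntegral.integral_const_mul, ← intervalIntegral.integral_sub
      (h.intervalIntegrable_ech_mul hap x) ((hq.intervalIntegrable_ech_mul hapq x).const_mul _)]
    refine intervalIntegral.integral_congr fun t _ => ?_
    rw [← Complex.re_ofReal_mul, ← Complex.sub_re]
    congr 1
    push_cast
    ring
  rw [h2] at h1
  have h3 := hq.pot_increment hapq x
  rw [pot_simpleKernel, pot_simpleKernel] at h3
  rw [h.pot_increment hap, h3, mul_left_comm, ← mul_sub, abs_mul, abs_of_pos (inv_pos.2 hpi),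
    inv_mul_le_iff₀ hpi, mul_comm Real.pi]
  exact h1

theorem potentialKernel_pot (h : CenteredKernel p s)
    (hap : ∀ t ∈ Set.Ioc 0 Real.pi, cf p t ≠ 1) : PotentialKernel p (pot p) s where
  toCenteredKernel := h
  a_zero := by simp [pot, potFourier]
  poisson := h.poisson_pot hap
  tendsto_top := by
    rw [Metric.tendsto_nhds]
    intro ε hε
    obtain ⟨K, hK⟩ := h.increment_close hap (half_pos hε)
    filter_upwards [eventually_ge_atTop 0, eventually_gt_atTop ⌈K⌉] with x hx0 hx
    have hx0' : (0 : ℝ) ≤ x := by exact_mod_cast hx0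
    have h1 := hK x (by
      rw [abs_of_nonneg hx0']
      exact (Int.le_ceil K).trans_lt (by exact_mod_cast hx))
    push_cast at h1
    rw [abs_of_nonneg hx0', abs_of_nonneg (a := (x : ℝ) + 1) (by linarith), add_sub_cancel_left,
      mul_one] at h1
    rw [Real.dist_eq, one_div]
    linarith
  tendsto_bot := by
    rw [Metric.tendsto_nhds]
    intro ε hε
    obtain ⟨K, hK⟩ := h.increment_close hap (half_pos hε)
    filter_upwards [eventually_le_atBot (-1), eventually_lt_atBot (-⌈K⌉)] with x hx0 hx
    have hx0' : (x : ℝ) ≤ -1 := by exact_mod_cast hx0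
    have h1 := hK x (by
      rw [abs_of_nonpos (by linarith)]
      refine (Int.le_ceil K).trans_lt ?_
      have : (x : ℝ) < -(⌈K⌉ : ℝ) := by exact_mod_cast hx
      linarith)
    push_cast at h1
    rw [abs_of_nonpos (a := (x : ℝ)) (by linarith), abs_of_nonpos (a := (x : ℝ) + 1) (by linarith),
      show -((x : ℝ) + 1) - -x = -1 by ring, mul_neg_one] at h1
    rw [Real.dist_eq, one_div]
    linarith

end CenteredKernel

/-! ### The step distribution of the random walk -/

section Law

variable {Ω : Type*} [MeasurableSpace Ω] {P : Measure Ω}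

/-- The distribution of an integer-valued random variable, as a function on `ℤ`. -/
noncomputable def law (P : Measure Ω) (X : Ω → ℤ) (k : ℤ) : ℝ := P.real {ω | X ω = k}

theorem measurableSet_eq {X : Ω → ℤ} (hX : Measurable X) (k : ℤ) : MeasurableSet {ω | X ω = k} :=
  hX (measurableSet_singleton k)

theorem lintegral_law [IsFiniteMeasure P] {X : Ω → ℤ} (hX : Measurable X) (G : ℤ → ℝ≥0∞) :
    ∫⁻ ω, G (X ω) ∂P = ∑' k, ENNReal.ofReal (law P X k) * G k := by
  rw [← lintegral_map (f := G) measurable_from_top hX, lintegral_countable']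
  refine tsum_congr fun k => ?_
  rw [mul_comm, Measure.map_apply hX (measurableSet_singleton k), law, ofReal_measureReal]
  rfl

theorem hasSum_law {X : Ω → ℤ} (hX : Measurable X) {F : ℤ → ℝ}
    (hF : Integrable (fun ω => F (X ω)) P) :
    HasSum (fun k => law P X k * F k) (∫ ω, F (X ω) ∂P) := by
  have hU : ⋃ k, {ω | X ω = k} = Set.univ := by
    ext ω
    simp
  have h1 := hasSum_integral_iUnion (μ := P) (f := fun ω => F (X ω))
    (fun k => measurableSet_eq hX k) (fun k l hkl => Set.disjoint_left.2 fun ω hk hl =>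
      hkl (Eq.trans (Eq.symm hk) hl)) (hU ▸ hF.integrableOn)
  rw [hU, setIntegral_univ] at h1
  refine hasSum_of_eq h1 (fun k => ?_) rfl
  rw [setIntegral_congr_fun (g := fun _ => F k) (measurableSet_eq hX k) (fun ω (hω : X ω = k) => by
    simp only [hω]), setIntegral_const, law, smul_eq_mul]

theorem integrable_law_iff [IsFiniteMeasure P] {X : Ω → ℤ} (hX : Measurable X) {F : ℤ → ℝ} :
    Integrable (fun ω => F (X ω)) P ↔ Summable fun k => law P X k * F k := by
  refine ⟨fun h => (hasSum_law hX h).summable, fun h => ⟨?_, ?_⟩⟩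
  · exact ((measurable_from_top (f := F)).comp hX).aestronglyMeasurable
  · rw [hasFiniteIntegral_iff_norm, lintegral_law hX fun k => ENNReal.ofReal ‖F k‖]
    refine lt_of_eq_of_lt (tsum_congr fun k => ?_) h.norm.tsum_ofReal_lt_top
    rw [norm_mul, ENNReal.ofReal_mul (norm_nonneg _),
      Real.norm_of_nonneg (r := law P X k) measureReal_nonneg]

theorem setIntegral_law {X : Ω → ℤ} (hX : Measurable X) (Q : ℤ → Prop) [DecidablePred Q]
    (F : ℤ → ℝ) :
    ∫ ω in {ω | Q (X ω)}, F (X ω) ∂P = ∫ ω, (if Q (X ω) then F (X ω) else 0) ∂P := by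
  have hQ : MeasurableSet {ω | Q (X ω)} := hX (MeasurableSet.of_discrete (s := {k | Q k}))
  rw [← integral_indicator hQ]
  refine integral_congr_ae (Eventually.of_forall fun ω => ?_)
  simp only [Set.indicator_apply, Set.mem_ofPred_eq]

end Law

section Harmonic

variable {Ω : Type*} [MeasurableSpace Ω] {P : Measure Ω} {X : Ω → ℤ} {a : ℤ → ℝ} {s : ℝ}

/-- Uniqueness. The defining integral converges, as it is positive. -/
theorem IsHalfLineHarmonic.eq_harm (hX : Measurable X) (h : PotentialKernel (law P X) a s)
    {f : ℤ → ℝ} (hf : IsHalfLineHarmonic P X f) : f = harm (law P X) := by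
  refine h.harm_unique hf.zero (fun x hx => ?_) hf.asymp
  have h1 := hf.harmonic x hx
  rw [setIntegral_law hX (fun k => 0 < x + k) fun k => f (x + k)] at h1
  have h2 : ∀ k : ℤ, (if 0 < x + k then f (x + k) else 0) = f (x + k) := fun k => by
    split_ifs with hk
    · rfl
    · exact (hf.zero _ (not_lt.1 hk)).symm
  simp only [h2] at h1
  rw [h1]
  refine hasSum_law hX (F := fun k => f (x + k)) ?_
  by_contra hcon
  rw [integral_undef hcon] at h1
  exact (hf.pos x hx).ne' h1

variable [IsFiniteMeasure P]

theorem isHalfLineHarmonic_harm (hX : Measurable X) (h : PotentialKernel (law P X) a s) :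
    IsHalfLineHarmonic P X (harm (law P X)) where
  zero x hx := harm_of_nonpos _ hx
  pos x hx := lt_of_lt_of_le (by exact_mod_cast (by omega : 0 < x)) (h.le_harm hx)
  harmonic x hx := by
    have h1 := h.hasSum_harm hx
    rw [setIntegral_law hX (fun k => 0 < x + k) fun k => harm (law P X) (x + k)]
    have h2 : ∀ k : ℤ, (if 0 < x + k then harm (law P X) (x + k) else 0) = harm (law P X) (x + k) :=
      fun k => by
        split_ifs with hk
        · rfl
        · exact (harm_of_nonpos _ (not_lt.1 hk)).symm
    simp only [h2]
    exact h1.unique (hasSum_law hX ((integrable_law_iff hX).2 h1.summable))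
  asymp := h.tendsto_harm_div

theorem existsUnique_isHalfLineHarmonic (hX : Measurable X)
    (h : PotentialKernel (law P X) a s) : ∃! f : ℤ → ℝ, IsHalfLineHarmonic P X f :=
  ⟨_, isHalfLineHarmonic_harm hX h, fun _ hf => hf.eq_harm hX h⟩

theorem halfLineHarmonic_eq (hX : Measurable X) (h : PotentialKernel (law P X) a s) :
    halfLineHarmonic P X = harm (law P X) :=
  (Classical.epsilon_spec (p := IsHalfLineHarmonic P X)
    ⟨_, isHalfLineHarmonic_harm hX h⟩ : IsHalfLineHarmonic P X _).eq_harm hX h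

theorem law_neg (P : Measure Ω) (X : Ω → ℤ) :
    law P (fun ω => -X ω) = fun k => law P X (-k) := by
  funext k
  simp only [law, neg_eq_iff_eq_neg]

end Harmonic

/-- The standing assumptions on the increments of the walk. -/
structure Increments {Ω : Type*} [MeasurableSpace Ω] (P : Measure Ω) (Y : ℕ → Ω → ℤ) : Prop where
  meas : ∀ i, Measurable (Y i)
  indep : iIndepFun Y P
  ident : ∀ i, IdentDistrib (Y i) (Y 0) P P
  irr : IsIrreducible P Y
  sq : MemLp (fun ω => (Y 0 ω : ℝ)) 2 P
  mean : ∫ ω, (Y 0 ω : ℝ) ∂P = 0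

section Reflection

theorem walk_neg {Ω : Type*} (Y : ℕ → Ω → ℤ) (x : ℤ) (n : ℕ) (ω : Ω) :
    walk (fun i ω => -Y i ω) x n ω = -walk Y (-x) n ω := by
  simp [walk, Finset.sum_neg_distrib, add_comm]

variable {Ω : Type*} [MeasurableSpace Ω] {P : Measure Ω} {Y : ℕ → Ω → ℤ}

theorem Increments.neg (h : Increments P Y) : Increments P fun i ω => -Y i ω where
  meas i := (h.meas i).neg
  indep := h.indep.comp (fun _ => Neg.neg) fun _ => measurable_neg
  ident i := (h.ident i).comp measurable_neg
  irr x y := by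
    obtain ⟨n, hn⟩ := h.irr (-x) (-y)
    refine ⟨n, ?_⟩
    simpa only [walk_neg, neg_eq_iff_eq_neg] using hn
  sq := by
    have := h.sq.neg
    refine this.ae_eq (Eventually.of_forall fun ω => ?_)
    simp
  mean := by
    have := h.mean
    simp [integral_neg, this]

theorem stepProb_neg (P : Measure Ω) (Y : ℕ → Ω → ℤ) (n : ℕ) (x : ℤ) :
    stepProb P (fun i ω => -Y i ω) n x = stepProb P Y n (-x) := by
  simp only [stepProb, walk_neg, neg_eq_iff_eq_neg, neg_zero]

theorem potential_neg (P : Measure Ω) (Y : ℕ → Ω → ℤ) (x : ℤ) :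
    potential P (fun i ω => -Y i ω) x = potential P Y (-x) := by
  have : potentialPartial P (fun i ω => -Y i ω) x = potentialPartial P Y (-x) := by
    funext N
    simp only [potentialPartial, stepProb_neg, neg_zero]
  rw [potential, potential, this]

theorem sigmaSq_neg (P : Measure Ω) (Y : ℕ → Ω → ℤ) :
    sigmaSq P (fun i ω => -Y i ω) = sigmaSq P Y := by
  simp [sigmaSq]

theorem HPlus_neg (P : Measure Ω) (Y : ℕ → Ω → ℤ) (y : ℤ) :
    HPlus P (fun i ω => -Y i ω) (-y) = HMinus P Y y := by
  simp only [HPlus, HMinus, sigmaSq_neg, neg_lt_neg_iff, fMinus, fPlus, neg_neg]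
  congr 2
  funext ω
  congr 1
  ring

theorem CPlus_neg (P : Measure Ω) (Y : ℕ → Ω → ℤ) :
    CPlus P (fun i ω => -Y i ω) = CMinus P Y := by
  let e : Set.Ioi (0 : ℤ) ≃ Set.Iio (0 : ℤ) := (Equiv.neg ℤ).subtypeEquiv fun y => by simp
  rw [CPlus, CMinus, ← e.tsum_eq]
  refine tsum_congr fun y => ?_
  have h1 : ((e y : Set.Iio (0 : ℤ)) : ℤ) = -(y : ℤ) := rfl
  have h2 : (0 : ℝ) < ((y : ℤ) : ℝ) := by exact_mod_cast y.2
  rw [h1, HPlus_neg, sigmaSq_neg, potential_neg, neg_neg, Int.cast_neg, abs_neg, abs_of_pos h2]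

end Reflection

namespace Increments

variable {Ω : Type*} [MeasurableSpace Ω] {P : Measure Ω} {Y : ℕ → Ω → ℤ}

theorem sigmaSq_pos (h : Increments P Y) : 0 < sigmaSq P Y := by
  have hnn : 0 ≤ sigmaSq P Y := integral_nonneg fun ω => sq_nonneg _
  refine hnn.lt_of_ne fun h0 => ?_
  have h1 : ∀ᵐ ω ∂P, Y 0 ω = 0 := by
    have := (integral_eq_zero_iff_of_nonneg (fun ω => sq_nonneg _) h.sq.integrable_sq).1 h0.symm
    filter_upwards [this] with ω hω
    simpa using hω
  have h2 : ∀ i, ∀ᵐ ω ∂P, Y i ω = 0 := fun i => by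
    have h3 := (h.ident i).measure_mem_eq (s := {0}ᶜ) (MeasurableSet.of_discrete)
    rw [ae_iff] at h1 ⊢
    exact h3.trans h1
  obtain ⟨n, hn⟩ := h.irr 0 1
  refine hn.ne' ?_
  have h4 : ∀ᵐ ω ∂P, walk Y 0 n ω ≠ 1 := by
    filter_upwards [ae_all_iff.2 h2] with ω hω
    simp [walk, hω]
  simpa [ae_iff] using h4

theorem measurable_walk (h : Increments P Y) (x : ℤ) (n : ℕ) : Measurable (walk Y x n) := by
  have := h.meas
  unfold walk
  fun_prop

variable [IsProbabilityMeasure P]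

theorem centeredKernel (h : Increments P Y) : CenteredKernel (law P (Y 0)) (sigmaSq P Y) where
  nonneg k := measureReal_nonneg
  hasSum_one := by
    have := hasSum_law (P := P) (h.meas 0) (F := fun _ => 1) (integrable_const _)
    simpa using this
  hasSum_mean := by
    have := hasSum_law (P := P) (h.meas 0) (F := fun k => (k : ℝ)) (h.sq.integrable one_le_two)
    rwa [h.mean] at this
  hasSum_sq := hasSum_law (h.meas 0) (F := fun k => (k : ℝ) ^ 2) h.sq.integrable_sq
  pos := h.sigmaSq_pos

theorem stepProb_eq (h : Increments P Y) (n : ℕ) (x : ℤ) :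
    stepProb P Y n x = stepP (law P (Y 0)) n x := by
  induction n generalizing x with
  | zero =>
    rw [stepProb, stepP]
    by_cases hx : x = 0
    · simp [walk, hx]
    · simp [walk, hx, Ne.symm hx]
  | succ n ih =>
    have hind : IndepFun (fun ω => walk Y 0 n ω) (Y n) P := by
      have h1 := h.indep.indepFun_finsetSum_of_notMem h.meas (s := Finset.range n) (i := n)
        (by simp)
      refine h1.congr (Eventually.of_forall fun ω => ?_) (by rfl)
      simp [walk, Finset.sum_apply]
    have hlaw : ∀ y, P.real {ω | Y n ω = y} = law P (Y 0) y := fun y => by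
      rw [law, measureReal_def, measureReal_def]
      congr 1
      exact (h.ident n).measure_mem_eq (measurableSet_singleton y)
    have hinter : ∀ y, P.real ({ω | walk Y 0 n ω = x - y} ∩ {ω | Y n ω = y})
        = law P (Y 0) y * stepProb P Y n (x - y) := fun y => by
      have h1 := hind.measure_inter_preimage_eq_mul {x - y} {y} (measurableSet_singleton _)
        (measurableSet_singleton _)
      rw [measureReal_def]
      refine (congrArg ENNReal.toReal h1).trans ?_
      rw [ENNReal.toReal_mul, mul_comm, ← hlaw]
      rfl
    have hU : {ω | walk Y 0 (n + 1) ω = x}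
        = ⋃ y, {ω | walk Y 0 n ω = x - y} ∩ {ω | Y n ω = y} := by
      ext ω
      simp only [Set.mem_ofPred_eq, Set.mem_iUnion, Set.mem_inter_iff, walk, zero_add,
        Finset.sum_range_succ]
      constructor
      · intro hω
        exact ⟨Y n ω, by omega, rfl⟩
      · rintro ⟨y, hy1, hy2⟩
        omega
    rw [stepP, stepProb, hU, measureReal_def, measure_iUnion, ENNReal.tsum_toReal_eq
      fun _ => measure_ne_top _ _]
    · refine tsum_congr fun y => ?_
      rw [← ih]
      exact hinter y
    · exact fun k l hkl => Set.disjoint_left.2 fun ω hk hl => hkl (Eq.trans (Eq.symm hk.2) hl.2)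
    · exact fun y => (measurableSet_eq (h.measurable_walk 0 n) _).inter
        (measurableSet_eq (h.meas n) _)

/-- Irreducibility enters here: if `φ(t) = 1`, then `e^{ixt} = 1` at every site `x` that the walk
can reach. -/
theorem cf_ne_one (h : Increments P Y) (t : ℝ) (ht : t ∈ Set.Ioc 0 Real.pi) :
    cf (law P (Y 0)) t ≠ 1 := by
  intro h1
  have hk := h.centeredKernel
  have hech : ∀ k, 0 < law P (Y 0) k → ech k t = 1 := fun k hpk => by
    rw [hk.ech_eq_of_norm_cf (by rw [h1, norm_one]) hpk, h1]
  have hstep : ∀ n x, 0 < stepP (law P (Y 0)) n x → ech x t = 1 := by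
    intro n
    induction n with
    | zero =>
      intro x hx
      rw [stepP] at hx
      have : x = 0 := by
        by_contra hne
        simp [hne] at hx
      rw [this, ech_zero]
    | succ n ih =>
      intro x hx
      obtain ⟨y, hy⟩ : ∃ y, law P (Y 0) y * stepP (law P (Y 0)) n (x - y) ≠ 0 := by
        by_contra! hcon
        rw [stepP] at hx
        simp [hcon] at hx
      have hy1 : 0 < law P (Y 0) y := (hk.nonneg y).lt_of_ne' (left_ne_zero_of_mul hy)
      have hy2 : 0 < stepP (law P (Y 0)) n (x - y) :=
        (hk.stepP_mem n _).1.lt_of_ne' (right_ne_zero_of_mul hy)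
      rw [← sub_add_cancel x y, ech_add, ih _ hy2, hech y hy1, one_mul]
  obtain ⟨n, hn⟩ := h.irr 0 1
  have h2 : ech 1 t = 1 := by
    refine hstep n 1 ?_
    rw [← h.stepProb_eq, stepProb, measureReal_def]
    exact ENNReal.toReal_pos hn.ne' (measure_ne_top _ _)
  have h3 := congrArg Complex.re h2
  rw [ech_re, Int.cast_one, one_mul, Complex.one_re] at h3
  have h4 := Real.cos_lt_cos_of_nonneg_of_le_pi le_rfl ht.2 ht.1
  rw [Real.cos_zero] at h4
  exact h4.ne h3

theorem potentialPartial_eq (h : Increments P Y) (x : ℤ) (N : ℕ) :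
    potentialPartial P Y x N = potPartial (law P (Y 0)) N x := by
  simp only [potentialPartial, potPartial, h.stepProb_eq]

theorem tendsto_potentialPartial (h : Increments P Y) (x : ℤ) :
    Tendsto (potentialPartial P Y x) atTop (𝓝 (pot (law P (Y 0)) x)) :=
  ((h.centeredKernel.tendsto_potPartial h.cf_ne_one).1 x).congr fun N =>
    (h.potentialPartial_eq x N).symm

theorem potential_eq (h : Increments P Y) (x : ℤ) : potential P Y x = pot (law P (Y 0)) x :=
  (h.tendsto_potentialPartial x).limUnder_eq

theorem potentialKernel (h : Increments P Y) :
    PotentialKernel (law P (Y 0)) (potential P Y) (sigmaSq P Y) := by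
  rw [show potential P Y = pot (law P (Y 0)) from funext h.potential_eq]
  exact h.centeredKernel.potentialKernel_pot h.cf_ne_one

theorem fMinus_eq (h : Increments P Y) : fMinus P Y = harm fun k => law P (Y 0) (-k) := by
  have h1 := h.potentialKernel.reflect
  rw [← law_neg] at h1 ⊢
  exact halfLineHarmonic_eq (h.meas 0).neg h1

/-! ### The limit, its finiteness and its positivity -/

theorem CPlus_eq (h : Increments P Y) :
    CPlus P Y = exitConst (law P (Y 0)) (potential P Y) (sigmaSq P Y) := by
  have hK := h.potentialKernel
  rw [hK.exitConst_eq_tsum_exit, CPlus]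
  refine tsum_congr fun w => ?_
  congr 3
  rw [HPlus, setIntegral_law (h.meas 0) (fun k => k < (w : ℤ)) fun k => fMinus P Y (w - k),
    h.fMinus_eq]
  congr 1
  exact (hasSum_law (h.meas 0) (F := fun k => if k < (w : ℤ) then
    harm (fun y => law P (Y 0) (-y)) (w - k) else 0)
      ((integrable_law_iff (h.meas 0)).2 (hK.summable_entrance w))).tsum_eq.symm

theorem tendsto_CPlus (h : Increments P Y) :
    Tendsto (fun x : ℤ => ((sigmaSq P Y * potential P Y x - (x : ℝ) : ℝ) : EReal)) atTop
      (𝓝 ((CPlus P Y : ℝ≥0∞) : EReal)) := by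
  have hK := h.potentialKernel
  rw [h.CPlus_eq]
  have h1 := (continuous_coe_ennreal_ereal.tendsto _).comp hK.tendsto_exitConst
  refine h1.congr' ?_
  filter_upwards [eventually_ge_atTop 1] with x hx
  have h2 : 0 ≤ sigmaSq P Y * potential P Y x - x := by
    rw [hK.sub_eq_greenPot hx]
    exact greenPot_nonneg _ (hK.bd_nonneg fun w hw => hK.exit_nonneg hw) x
  rw [Function.comp, EReal.coe_ennreal_ofReal, max_eq_left h2]

theorem CPlus_lt_top_iff (h : Increments P Y) :
    CPlus P Y < ∞ ↔ ∫⁻ ω in {ω | Y 0 ω < 0}, ENNReal.ofReal (|(Y 0 ω : ℝ)| ^ 3) ∂P < ∞ := by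
  have hset : MeasurableSet {ω | Y 0 ω < 0} :=
    h.meas 0 (MeasurableSet.of_discrete (s := {k : ℤ | k < 0}))
  rw [h.CPlus_eq, h.potentialKernel.exitConst_lt_top_iff, ← lintegral_indicator hset]
  have h1 := lintegral_law (P := P) (h.meas 0)
    fun k => if k < 0 then ENNReal.ofReal (|(k : ℝ)| ^ 3) else 0
  simp only [mul_ite, mul_zero] at h1
  rw [← h1]
  simp only [Set.indicator_apply, Set.mem_ofPred_eq]

theorem CPlus_pos_iff (h : Increments P Y) : 0 < CPlus P Y ↔ ¬ IsLeftContinuous P Y := by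
  rw [h.CPlus_eq, h.potentialKernel.exitConst_pos_iff, IsLeftContinuous]
  constructor
  · rintro ⟨k, hk, hpk⟩ h0
    have h1 : P {ω | Y 0 ω = k} = 0 :=
      measure_mono_null (fun ω (hω : Y 0 ω = k) => show Y 0 ω ≤ -2 from hω ▸ hk) h0
    rw [law, measureReal_def, h1] at hpk
    simp at hpk
  · intro h0
    by_contra! hcon
    refine h0 ?_
    have h1 : {ω | Y 0 ω ≤ -2} ⊆ ⋃ k : Set.Iic (-2 : ℤ), {ω | Y 0 ω = k} := fun ω hω =>
      Set.mem_iUnion.2 ⟨⟨Y 0 ω, hω⟩, rfl⟩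
    refine measure_mono_null h1 (measure_iUnion_null fun k => ?_)
    have h2 : law P (Y 0) k = 0 := le_antisymm (hcon k k.2) measureReal_nonneg
    exact (measureReal_eq_zero_iff).1 h2

end Increments

end LatticeWalk

theorem corollary2p1 {Ω : Type*} [MeasurableSpace Ω] (P : Measure Ω) [IsProbabilityMeasure P]
    (Y : ℕ → Ω → ℤ)
    (hmeas : ∀ i, Measurable (Y i))
    (hindep : iIndepFun Y P)
    (hident : ∀ i, IdentDistrib (Y i) (Y 0) P P)
    (hirr : LatticeWalk.IsIrreducible P Y)
    (hsq : MemLp (fun ω => (Y 0 ω : ℝ)) 2 P)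
    (hmean : ∫ ω, (Y 0 ω : ℝ) ∂P = 0) :
    -- the objects entering `C⁺` and `C⁻` are well defined
    ((∀ x : ℤ, Tendsto (LatticeWalk.potentialPartial P Y x) atTop
        (𝓝 (LatticeWalk.potential P Y x))) ∧
      (∀ x : ℤ, 0 ≤ LatticeWalk.potential P Y x) ∧
      (∃! f : ℤ → ℝ, LatticeWalk.IsHalfLineHarmonic P (fun ω => Y 0 ω) f) ∧
      (∃! f : ℤ → ℝ, LatticeWalk.IsHalfLineHarmonic P (fun ω => -Y 0 ω) f)) ∧
    -- the two limits, in the extended reals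
    Tendsto (fun x : ℤ =>
        ((LatticeWalk.sigmaSq P Y * LatticeWalk.potential P Y x - (x : ℝ) : ℝ) : EReal))
      atTop (𝓝 ((LatticeWalk.CPlus P Y : ℝ≥0∞) : EReal)) ∧
    Tendsto (fun x : ℤ =>
        ((LatticeWalk.sigmaSq P Y * LatticeWalk.potential P Y x - |(x : ℝ)| : ℝ) : EReal))
      atBot (𝓝 ((LatticeWalk.CMinus P Y : ℝ≥0∞) : EReal)) ∧
    -- finiteness
    (LatticeWalk.CPlus P Y < ∞ ↔
      ∫⁻ ω in {ω | Y 0 ω < 0}, ENNReal.ofReal (|(Y 0 ω : ℝ)| ^ 3) ∂P < ∞) ∧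
    (LatticeWalk.CMinus P Y < ∞ ↔
      ∫⁻ ω in {ω | 0 < Y 0 ω}, ENNReal.ofReal (|(Y 0 ω : ℝ)| ^ 3) ∂P < ∞) ∧
    -- positivity
    (0 < LatticeWalk.CPlus P Y ↔ ¬ LatticeWalk.IsLeftContinuous P Y) ∧
    (0 < LatticeWalk.CMinus P Y ↔ ¬ LatticeWalk.IsRightContinuous P Y) := by
  have h : LatticeWalk.Increments P Y := ⟨hmeas, hindep, hident, hirr, hsq, hmean⟩
  have h' := h.neg
  refine ⟨⟨fun x => ?_, h.potentialKernel.a_nonneg,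
    LatticeWalk.existsUnique_isHalfLineHarmonic (hmeas 0) h.potentialKernel,
    LatticeWalk.existsUnique_isHalfLineHarmonic (h'.meas 0) h'.potentialKernel⟩,
    h.tendsto_CPlus, ?_, h.CPlus_lt_top_iff, ?_, h.CPlus_pos_iff, ?_⟩
  · rw [h.potential_eq]
    exact h.tendsto_potentialPartial x
  · have h1 := h'.tendsto_CPlus.comp tendsto_neg_atBot_atTop
    rw [LatticeWalk.CPlus_neg] at h1
    refine h1.congr' ?_
    filter_upwards [eventually_le_atBot 0] with x hx
    have hx' : (x : ℝ) ≤ 0 := by exact_mod_cast hx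
    simp only [Function.comp, LatticeWalk.sigmaSq_neg, LatticeWalk.potential_neg, neg_neg,
      Int.cast_neg, abs_of_nonpos hx']
  · have h1 := h'.CPlus_lt_top_iff
    simpa only [LatticeWalk.CPlus_neg, Int.cast_neg, abs_neg, Left.neg_neg_iff] using h1
  · have h1 := h'.CPlus_pos_iff
    rw [LatticeWalk.CPlus_neg] at h1
    rw [h1, LatticeWalk.IsLeftContinuous, LatticeWalk.IsRightContinuous]
    simp only [neg_le_neg_iff]
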